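/- **Notation.** For $\lambda\in\mathbb C\setminus\{0\}$ let $G_\lambda=\langle S,T\rangle$ be the marked Möbius group with generators $S(z)=z/(z+1)$ and $T(z)=z+2\lambda$ acting on $\hat{\mathbb C}$. A *Schottky configuration* for an ordered pair $(g_1,g_2)$ of Möbius transformations consists of four Jordan curves $A_1,A_2,B_1,B_2$ in $\hat{\mathbb C}$, each with a chosen side (its interior; the other side is its exterior), such that the four interiors are pairwise disjoint, different curves meet in at most finitely many points (arbitrary tangencies are allowed), $g_1$ maps $A_1$ onto $A_2$ and the exterior of $A_1$ onto the interior of $A_2$, and $g_2$ maps $B_1$ onto $B_2$ and the exterior of $B_1$ onto the interior of $B_2$. It is *classical* if the four curves are round circles of $\hat{\mathbb C}$ (Euclidean circles or lines with $\infty$ added). *Classical $\mathrm T$-Schottky space* $\mathcal S$ is the set of $\lambda\neq 0$ for which $(S,T)$ has a classical Schottky configuration; such a configuration is written $(C_1,C_2,T_1,T_2)$, where $S$ pairs $C_1$ with $C_2$ and $T$ pairs $T_1$ with $T_2$. Write $\lambda=x+iy$. Let $\mathcal A_1$ be the set of $\lambda$ in the first quadrant with $|y|<1-\frac{x^2}{4}$,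 $|\lambda|\ge 1$, $\frac{\pi}{3}\le\arg\lambda\le\frac{\pi}{2}$, let $\mathcal A_2$ be the set of those with $|y|<1-\frac{x^2}{4}$, $y\ge -\frac{\sqrt3}{3}x+\frac{2\sqrt3}{3}$, $0\le\arg\lambda\le\frac{\pi}{3}$, and let $\mathcal{NCF}$ be the union of $\mathcal A_1\cup\mathcal A_2$ and its mirror images in the real and imaginary axes. Its lower boundary consists of the segment $K_0$ from $\frac12+\frac{\sqrt3}{2}i$ to $2$ (on the "$K$-line" $3y=-\sqrt3x+2\sqrt3$), the arc of the unit circle from $e^{i\pi/3}$ to $i$, and their mirror images in the axes. For $c\in\mathbb C$ with $\operatorname{Re}c=1$ let $R=|c|$ and let $C_1,C_2$ be the circles with centers $-c$, $c$ and radius $R$; they are tangent at $0$, and $S(C_1)=C_2$. If $\operatorname{Re}\lambda\ge0$, one may take $(A,B)=(C_1,C_2)$; if $\operatorname{Re}\lambda\le 0$, one may take $(A,B)=(C_2,C_1)$. Items 3, 4 and 5 hold for every such choice. **Theorem.** $\mathcal S=\{x+iy:\ |y|\ge 1-\frac{x^2}{4}\}$, and $\partial\mathcal S=\{x+iy:\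 -2\le x\le 2,\ |y|=1-\frac{x^2}{4}\}$. Moreover: 1. *If $\lambda$ is in the interior of $\mathcal S$,* there is a classical Schottky configuration $(C_1,C_2,T_1,T_2)$ for $(S,T)$, with $C_1,C_2$ as above for some $c$ with $\operatorname{Re} c=1$, in which $C_1$ and $C_2$ lie in the exteriors of both $T_1$ and $T_2$, with $C_1\cap C_2=\{0\}$, $T_1\cap T_2=\{\infty\}$, and which has exactly two points of tangency. 2. *If $\lambda\in\partial\mathcal S$,* there is a classical Schottky configuration for $(S,T)$. If $\lambda\ne\pm2$, every such configuration has exactly six points of tangency. If $\lambda=\pm2$, every such configuration has four or six points of tangency; infinitely many have four, and exactly two have six. 3. *If $\lambda$ lies on $K_0$ or on one of its mirror images,* there is $c$ with $\operatorname{Re}c=1$ such that, for the circles $C_1,C_2$ and $A,B$ above, the following holds. The curves $C_1,C_2,T(C_1),T(C_2)$ form a (classical) Schottky configuration for $(S,TST^{-1})$. $A$ meets $T(A)$ exactly at one point $p_1$, $B$ meets $T(B)$ exactly at one point $p_2$, and $B$ meets $T(A)$ exactly at one point $p$. Let $M_1$ be the tangent line to $A$ at $p_1$, $M_2$ the tangent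 line to $B$ at $p_2$, and $M_3$ the common tangent line to $T(A)$ and $B$ at $p$. Then $M_1\cap M_3=\{v_1\}$ and $M_3\cap M_2=\{v_2\}$ are single points. Let $L_2$ be the curve made up of the half-line of $M_1$ from $\infty$ through $p_1$ to $v_1$, the segment of $M_3$ from $v_1$ to $v_2$, the half-line of $M_2$ from $v_2$ through $p_2$ to $\infty$, and the point $\infty$, and let $L_1=T^{-1}(L_2)$. Then $C_1,C_2,L_1,L_2$ form a Schottky configuration for $(S,T)$; in particular $T$ pairs the Jordan curves $L_1$ and $L_2$. 4. *If $\lambda$ lies on the arc of the unit circle from $e^{i\pi/3}$ to $i$ or on one of its mirror images,* all of item 3 holds with $c=1$ (so $C_1,C_2$ are the circles $|z\pm1|=1$), except that $B$ and $T(A)$ are disjoint, unless $\lambda$ also lies on $K_0$ or one of its mirror images, and that $M_3$ is the perpendicular bisector of the segment between the centers of $T(A)$ and $B$. 5. *If $\lambda$ is in the interior of $\mathcal{NCF}$,* there are $c$ with $\operatorname{Re}c=1$ and a unit vector $n$ perpendicular to $c$ such that the following holds (with the circles above). Let $P=\mathbb R n$, the perpendicular bisector of the centers of $C_1$ and $C_2$;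 for real $h$ let $\ell_h$ be the line perpendicular to $P$ through $hn$; put $M_1=\ell_{-R}$, $M_2=\ell_R$ (the lines tangent to both $C_1$ and $C_2$), and $T(M_1)=\ell_{H-R}$. Then * $-R<H-R<R$, that is, $T(M_1)$ lies between $M_1$ and $M_2$; * the perpendicular bisector $\beta_1$ of the centers of $A$ and $T(A)$ and the perpendicular bisector $\beta_2$ of the centers of $T(A)$ and $B$ meet in exactly one point; it is $h_0n\in P$ with $0<h_0\le H-R$; * let $\beta_3$ be the perpendicular bisector of the centers of $B$ and $T(B)$, and let $M=\ell_h$ and $M'=\ell_{h'}$ with $h_0\le h\le H-R$ and $R\le h'\le H-h_0$ (for instance $M=T(M_1)$ and $M'=M_2$, or any such $M$ and the line $M'=\ell_{H-h}$, which is as far from $M_2$ as $M$ is from $T(M_1)$). Then $\beta_1\cap M$, $M\cap\beta_2$, $\beta_2\cap M'$, $M'\cap\beta_3$ are single points $u_1,u_2,u_3,u_4$. Let $L_2$ be the curve made up of the half-line of $\beta_1$ from $\infty$ through the midpoint of the centers of $A$ and $T(A)$ to $u_1$, the segments $[u_1,u_2]\subset M$, $[u_2,u_3]\subset\beta_2$,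 $[u_3,u_4]\subset M'$, the half-line of $\beta_3$ from $u_4$ through the midpoint of the centers of $B$ and $T(B)$ to $\infty$, and the point $\infty$, and let $L_1=T^{-1}(L_2)$. Then $C_1,C_2,L_1,L_2$ form a Schottky configuration for $(S,T)$. If $|x|+\sqrt3|y|>2$, one can choose $c$ so that, in addition, the center of $T(A)$ lies on $P$. 6. Conversely, let $\operatorname{Re}c=1$, let $n$ be a unit vector perpendicular to $c$, let $(A,B)=(C_1,C_2)$ or $(A,B)=(C_2,C_1)$, let $q_0=hn$ with $(\sqrt3-1)R<h<R$, let $q=(h+R)n$ be the point of $P$ at distance $R$ beyond $q_0$, let $2\lambda$ be the vector from the center of $A$ to $q$, and let $T(z)=z+2\lambda$. Then everything said in the three bullets of item 5 holds for these $c,n,A,B$ and $\lambda$, and $\lambda$ is in the interior of $\mathcal{NCF}$ if and only if $|y|<1-\frac{x^2}{4}$. -/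

import Mathlib

open OnePoint

noncomputable section

namespace TwoParabolic

/-- The Riemann sphere `ℂ ∪ {∞}`; `GL (Fin 2) ℂ` acts on it by Möbius transformations. -/
abbrev Sphere : Type := OnePoint ℂ

/-- The generator `S(z) = z / (z + 1)`. -/
def S : GL (Fin 2) ℂ :=
  Matrix.GeneralLinearGroup.mkOfDetNeZero !![1, 0; 1, 1] (by simp)

/-- The generator `T(z) = z + 2 l`. -/
def T (l : ℂ) : GL (Fin 2) ℂ :=
  Matrix.GeneralLinearGroup.mkOfDetNeZero !![1, 2 * l; 0, 1] (by simp)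

/-- The image of a subset of the sphere under a Möbius transformation. -/
def mob (g : GL (Fin 2) ℂ) (A : Set Sphere) : Set Sphere := (fun z => g • z) '' A

/-! ### Schottky configurations -/

/-- A subset of the sphere (a closed curve), with one of its sides, called the inside. -/
structure SidedCurve where
  curve : Set Sphere
  inside : Set Sphere

/-- The other side. -/
def SidedCurve.outside (J : SidedCurve) : Set Sphere := (J.curve ∪ J.inside)ᶜ

/-- `J.curve` is a Jordan curve on the sphere, and `J.inside`, `J.outside` are the two
connected components of its complement. -/
structure SidedCurve.IsJordan (J : SidedCurve) : Prop where
  exists_param : ∃ f : Circle → Sphere,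
    Continuous f ∧ Function.Injective f ∧ Set.range f = J.curve
  disjoint : Disjoint J.curve J.inside
  isOpen_inside : IsOpen J.inside
  isConnected_inside : IsConnected J.inside
  isOpen_outside : IsOpen J.outside
  isConnected_outside : IsConnected J.outside

/-- Four sided curves: the curves `0`, `1` are to be paired by the first generator, the curves
`2`, `3` by the second one. -/
abbrev Config : Type := Fin 4 → SidedCurve

/-- `X` is a (T-)Schottky configuration with side pairings `g₁`, `g₂`: four Jordan curves with
pairwise disjoint insides, `g₁` maps the curve `0` to the curve `1` and the outside of the former
onto the inside of the latter, and `g₂` does the same with the curves `2` and `3`. Different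
curves may touch, at finitely many points, without any further restriction. -/
structure IsSchottkyConfig (g₁ g₂ : GL (Fin 2) ℂ) (X : Config) : Prop where
  isJordan : ∀ i, (X i).IsJordan
  disjoint_inside : ∀ i j, i ≠ j → Disjoint (X i).inside (X j).inside
  finite_inter : ∀ i j, i ≠ j → ((X i).curve ∩ (X j).curve).Finite
  curve₁ : mob g₁ (X 0).curve = (X 1).curve
  side₁ : mob g₁ (X 0).outside = (X 1).inside
  curve₂ : mob g₂ (X 2).curve = (X 3).curve
  side₂ : mob g₂ (X 2).outside = (X 3).inside

/-- The four curves `A₁, A₂, B₁, B₂` form a Schottky configuration, where `g₁` pairs `A₁` with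
`A₂` and `g₂` pairs `B₁` with `B₂`. -/
def AreSchottkyCurves (g₁ g₂ : GL (Fin 2) ℂ) (A₁ A₂ B₁ B₂ : Set Sphere) : Prop :=
  ∃ X : Config, IsSchottkyConfig g₁ g₂ X ∧
    (X 0).curve = A₁ ∧ (X 1).curve = A₂ ∧ (X 2).curve = B₁ ∧ (X 3).curve = B₂

/-- The Euclidean circle with center `a` and radius `r`, on the sphere. -/
def circleCurve (a : ℂ) (r : ℝ) : Set Sphere := (fun z : ℂ => (z : Sphere)) '' Metric.sphere a r

/-- The level line of height `h` in the direction `n` (a line perpendicular to `n`). -/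
def levelLine (n : ℂ) (h : ℝ) : Set ℂ := {z | (z * (starRingEnd ℂ) n).re = h}

/-- A round circle of the sphere: a Euclidean circle or a Euclidean line with `∞` added. -/
def IsRoundCircle (C : Set Sphere) : Prop :=
  (∃ (a : ℂ) (r : ℝ), 0 < r ∧ C = circleCurve a r) ∨
  (∃ (n : ℂ) (h : ℝ), n ≠ 0 ∧ C = insert ∞ ((fun z : ℂ => (z : Sphere)) '' levelLine n h))

/-- A Schottky configuration consisting of round circles. -/
structure IsClassicalConfig (g₁ g₂ : GL (Fin 2) ℂ) (X : Config) : Prop where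
  isSchottkyConfig : IsSchottkyConfig g₁ g₂ X
  isRoundCircle : ∀ i, IsRoundCircle (X i).curve

/-- The points of tangency between the curves (as the insides are disjoint, two round circles
of a configuration are tangent wherever they meet). -/
def tangencyPoints (X : Config) : Set Sphere :=
  {p | ∃ i j, i ≠ j ∧ p ∈ (X i).curve ∧ p ∈ (X j).curve}

/-! ### Regions of the parameter space -/

/-- Classical T-Schottky space: the nonzero parameters `l` such that the marked group
`⟨S, T l⟩` has a classical configuration, tangencies being allowed. -/
def classicalTSchottkySpace : Set ℂ := {l | l ≠ 0 ∧ ∃ X : Config, IsClassicalConfig S (T l) X}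

/-- The Schottky parabolas. -/
def schottkyParabolas : Set ℂ := {l | -2 ≤ l.re ∧ l.re ≤ 2 ∧ |l.im| = 1 - l.re ^ 2 / 4}

/-- A subset of the closed first quadrant together with its mirror images in the axes. -/
def symmetrized (s : Set ℂ) : Set ℂ := {l | (⟨|l.re|, |l.im|⟩ : ℂ) ∈ s}

/-- The segment of the line `3 y = - √3 x + 2 √3` from its point of tangency with the unit circle
to the point `2`. -/
def kSegment : Set ℂ := segment ℝ (⟨1 / 2, √3 / 2⟩ : ℂ) 2

/-- The arc of the unit circle from angle `π / 3` to angle `π / 2`. -/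
def unitArc : Set ℂ := {l | ‖l‖ = 1 ∧ Real.pi / 3 ≤ l.arg ∧ l.arg ≤ Real.pi / 2}

/-- First quadrant, below the Schottky parabola, outside the open unit disc, angle at least
`π / 3`. -/
def ncfA₁ : Set ℂ :=
  {l | |l.im| < 1 - l.re ^ 2 / 4 ∧ 1 ≤ ‖l‖ ∧ Real.pi / 3 ≤ l.arg ∧ l.arg ≤ Real.pi / 2}

/-- First quadrant, below the Schottky parabola, on or above the line of `kSegment`, angle at most
`π / 3`. -/
def ncfA₂ : Set ℂ :=
  {l | |l.im| < 1 - l.re ^ 2 / 4 ∧ -(√3 * l.re / 3) + 2 * √3 / 3 ≤ l.im ∧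
    0 ≤ l.arg ∧ l.arg ≤ Real.pi / 3}

/-- The region of the non-classical family. -/
def ncf : Set ℂ := symmetrized (ncfA₁ ∪ ncfA₂)

/-! ### The non-classical curves -/

/-- The perpendicular bisector of the segment from `a` to `b`. -/
def bisector (a b : ℂ) : Set ℂ := {z | dist z a = dist z b}

/-- The tangent line at `p` to the circle with center `a` through `p`. -/
def tangentLine (a p : ℂ) : Set ℂ := {z | ((z - p) * (starRingEnd ℂ) (p - a)).re = 0}

/-- The half-line from `u` through `m`. -/
def halfLine (u m : ℂ) : Set ℂ := {z | ∃ s : ℝ, 0 ≤ s ∧ z = u + s * (m - u)}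

/-- From `∞` along the half-line through `m₁` to `u₁`, then to `u₂`, then along the half-line
through `m₂` back to `∞`. -/
def threeArcCurve (m₁ u₁ u₂ m₂ : ℂ) : Set Sphere :=
  insert ∞ ((fun z : ℂ => (z : Sphere)) '' (halfLine u₁ m₁ ∪ segment ℝ u₁ u₂ ∪ halfLine u₂ m₂))

/-- From `∞` along the half-line through `m₁` to `u₁`, then to `u₂`, `u₃`, `u₄`, then along the
half-line through `m₂` back to `∞`. -/
def fiveArcCurve (m₁ u₁ u₂ u₃ u₄ m₂ : ℂ) : Set Sphere :=
  insert ∞ ((fun z : ℂ => (z : Sphere)) ''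
    (halfLine u₁ m₁ ∪ segment ℝ u₁ u₂ ∪ segment ℝ u₂ u₃ ∪ segment ℝ u₃ u₄ ∪ halfLine u₄ m₂))

/-- The configuration with a curve of three arcs. The circles are `C₁`, `C₂` with centers
`-c`, `c` and radius `‖c‖`; `a = - e c` and `b = e c` with `e = 1` or `e = -1`, and `A`, `B` are
the circles around `a`, `b` (so `A = C₁`, `B = C₂` if `e = 1`, and the names are interchanged
if `e = -1`). `M₃` is a given line.
* `C₁, C₂, T(C₁), T(C₂)` are a classical configuration for `S` and `T S T⁻¹`;
* `A` touches `T(A)` exactly at `p₁`, and `B` touches `T(B)` exactly at `p₂`;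
* `L` consists of the part of the tangent `M₁` to `A` at `p₁` from `∞` to `v₁ = M₁ ∩ M₃`, the
  segment from `v₁` to `v₂` on `M₃`, and the part of the tangent `M₂` to `B` at `p₂` from
  `v₂ = M₂ ∩ M₃` to `∞`;
* `C₁, C₂, T⁻¹(L), L` are a Schottky configuration for `S` and `T`. -/
def ThreeArcConfiguration (l c : ℂ) (e : ℝ) (M₃ : Set ℂ) : Prop :=
  let R : ℝ := ‖c‖
  let a : ℂ := -(e * c)
  let b : ℂ := e * c
  let C₁ := circleCurve (-c) R
  let C₂ := circleCurve c R
  AreSchottkyCurves S (T l * S * (T l)⁻¹) C₁ C₂ (mob (T l) C₁) (mob (T l) C₂) ∧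
  ∃ p₁ p₂ v₁ v₂ : ℂ,
    circleCurve a R ∩ mob (T l) (circleCurve a R) = {(p₁ : Sphere)} ∧
    circleCurve b R ∩ mob (T l) (circleCurve b R) = {(p₂ : Sphere)} ∧
    tangentLine a p₁ ∩ M₃ = {v₁} ∧
    M₃ ∩ tangentLine b p₂ = {v₂} ∧
    AreSchottkyCurves S (T l) C₁ C₂
      (mob (T l)⁻¹ (threeArcCurve p₁ v₁ v₂ p₂)) (threeArcCurve p₁ v₁ v₂ p₂)

/-- The configuration with a curve of five arcs; `C₁`, `C₂`, `a`, `b`, `A`, `B` are as before.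
`n` is a unit normal of the line through the centers; so the parallel lines tangent to both
circles are `M₁ = levelLine n (-R)`, `M₂ = levelLine n R`, the perpendicular bisector `P` of the
centers is `ℝ n`, and `T(M₁) = levelLine n (H - R)`.
* `T(M₁)` lies between `M₁` and `M₂`;
* the bisectors of (the centers of) `A, T(A)` and of `T(A), B` meet at one point `h₀ n` of `P`,
  above the point of tangency `0` of the circles and not above `T(M₁)`;
* let `M` be any line parallel to `M₁` that meets `P` between `h₀ n` and `T(M₁)`, and `M'` any
  line parallel to `M₁` that meets `P` between `M₂` and the point `(H - h₀) n` (whose level is the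
  image of the level of `h₀ n` under the half turn about `l`; such as `M = T(M₁)` and `M' = M₂`, or any `M` and its image under the half turn,
  which is as far from `M₂` as `M` is from `T(M₁)`); let `L` be the curve that consists of arcs
  along the bisector of `A, T(A)`, along `M`, along the bisector of `T(A), B`, along `M'`, and
  along the bisector of `B, T(B)`. Then `C₁, C₂, T⁻¹(L), L` are a Schottky configuration for
  `S` and `T`. -/
def FiveArcConfiguration (l c : ℂ) (e : ℝ) (n : ℂ) : Prop :=
  let R : ℝ := ‖c‖
  let a : ℂ := -(e * c)
  let b : ℂ := e * c
  let H : ℝ := (2 * l * (starRingEnd ℂ) n).re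
  H - R < R ∧ -R < H - R ∧
  ∃ h₀ : ℝ, 0 < h₀ ∧ h₀ ≤ H - R ∧
    bisector a (a + 2 * l) ∩ bisector (a + 2 * l) b = {(h₀ : ℂ) * n} ∧
    ∀ h h' : ℝ, h₀ ≤ h → h ≤ H - R → R ≤ h' → h' ≤ H - h₀ →
      ∃ u₁ u₂ u₃ u₄ : ℂ,
        bisector a (a + 2 * l) ∩ levelLine n h = {u₁} ∧
        levelLine n h ∩ bisector (a + 2 * l) b = {u₂} ∧
        bisector (a + 2 * l) b ∩ levelLine n h' = {u₃} ∧
        levelLine n h' ∩ bisector b (b + 2 * l) = {u₄} ∧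
        AreSchottkyCurves S (T l) (circleCurve (-c) R) (circleCurve c R)
          (mob (T l)⁻¹ (fiveArcCurve (a + l) u₁ u₂ u₃ u₄ (b + l)))
          (fiveArcCurve (a + l) u₁ u₂ u₃ u₄ (b + l))

end TwoParabolic

end

open scoped ComplexConjugate

namespace TwoParabolic

/-! ### Möbius transformations -/

/-! Write `⟨n, z⟩` for `coord n z`, the coordinate of `z` in the direction `n`.

Classical space. A round disc and a translate of it have the same radius, so circles cannot be
paired by `T`: the curves it pairs are parallel lines (`eq_lowerHalf_of_paired`). The inversion `z ↦
1/z` conjugates `S` to `z ↦ z + 1`, so the curves paired by `S` are inverted parallel lines. They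
turn out to be circles tangent at `0` with centers `-p c`, `q c`, where `Re c = 1` and `1/p + 1/q =
2` (`IsClassicalConfig.exists_standard`). Both discs lie in a strip of half-width `⟨n, l⟩`. Since `p
+ q ≥ 2`, this forces `‖c‖ + |⟨n, c⟩| ≤ ⟨n, l⟩`, and equality forces `p = q = 1` and a strip
centered at `0` (`IsClassicalConfig.height_ge`). Conversely the inequality suffices
(`stripConfig_isClassical`). Eliminating `n` and `c` from it gives the parabolas: `parabola_le` is
the bound with its equality cases, `exists_strip` the extremal choice. On the boundary the
configurations are therefore explicit, and the tangency points can be counted: `∞`, `0` and the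
contacts of circles with lines. At `±2` the equality cases form the one-parameter family
`cuspConfig`.

Non-classical families. The curve `L₂` is a graph over the line of centers of `A` and `B`, and `L₁`
is its translate. It then suffices that the graph lies strictly above its translate and that both
discs lie between the two (`graphConfig_isSchottkyConfig`). The graph is a zigzag made of the
bisectors of `A, T(A)`, of `T(A), B` and of `B, T(B)`, cut by levels `h ≤ H - R` and `h' ≥ R`. A
bisector separates discs of equal radius `R` whose centers are at least `2 R` apart, so `A`, `B` lie
below the zigzag and `T(A)`, `T(B)` above it (`IsStacked.areSchottkyCurves_zig`). The inequalities
needed are collected in `IsStacked`. The curve of three arcs is the degenerate case in which both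
horizontal pieces shrink to points.

Suitable circles come from two constructions. When `2 ≤ |x| + √3 |y|`, `exists_apex` chooses `c` so
that the center of `T(A)` lies on the bisector of `A` and `B`. In the rest of the region unit
circles work (`exists_isStacked_one`). -/

lemma T_smul_coe (l z : ℂ) : T l • (z : Sphere) = ((z + 2 * l : ℂ) : Sphere) := by
  rw [OnePoint.smul_some_eq_ite]
  simp [T, Matrix.GeneralLinearGroup.mkOfDetNeZero]

lemma T_smul_infty (l : ℂ) : T l • (∞ : Sphere) = ∞ := by
  rw [OnePoint.smul_infty_eq_self_iff]
  simp [T, Matrix.GeneralLinearGroup.mkOfDetNeZero]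

lemma S_smul_coe (z : ℂ) :
    S • (z : Sphere) = if z + 1 = 0 then (∞ : Sphere) else ((z / (z + 1) : ℂ) : Sphere) := by
  rw [OnePoint.smul_some_eq_ite]
  simp [S, Matrix.GeneralLinearGroup.mkOfDetNeZero]

lemma S_smul_infty : S • (∞ : Sphere) = ((1 : ℂ) : Sphere) := by
  rw [OnePoint.smul_infty_eq_ite]
  simp [S, Matrix.GeneralLinearGroup.mkOfDetNeZero]

lemma mob_mul (g h : GL (Fin 2) ℂ) (A : Set Sphere) : mob (g * h) A = mob g (mob h A) := by
  simp only [mob, Set.image_image, mul_smul]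

lemma mob_inv_mob (g : GL (Fin 2) ℂ) (A : Set Sphere) : mob g⁻¹ (mob g A) = A := by
  simp [mob, Set.image_image]

lemma mob_eq_of_forall_mem_iff {g : GL (Fin 2) ℂ} {A B : Set Sphere}
    (h : ∀ z, z ∈ A ↔ g • z ∈ B) : mob g A = B := by
  ext w
  constructor
  · rintro ⟨z, hz, rfl⟩
    exact (h z).1 hz
  · intro hw
    exact ⟨g⁻¹ • w, (h _).2 (by simpa using hw), by simp⟩

lemma mob_compl (g : GL (Fin 2) ℂ) (A : Set Sphere) : mob g Aᶜ = (mob g A)ᶜ :=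
  Set.image_compl_eq (MulAction.bijective g)

lemma mob_union (g : GL (Fin 2) ℂ) (A B : Set Sphere) : mob g (A ∪ B) = mob g A ∪ mob g B :=
  Set.image_union _ _ _

lemma mob_T_coe (l : ℂ) (A : Set ℂ) :
    mob (T l) ((fun z : ℂ => (z : Sphere)) '' A) =
      (fun z : ℂ => (z : Sphere)) '' {z | z - 2 * l ∈ A} := by
  ext w
  simp only [mob, Set.image_image, T_smul_coe, Set.mem_image, Set.mem_ofPred_eq]
  constructor
  · rintro ⟨z, hz, rfl⟩
    exact ⟨z + 2 * l, by simpa using hz, rfl⟩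
  · rintro ⟨z, hz, rfl⟩
    exact ⟨z - 2 * l, hz, by simp⟩

lemma mob_T_insert_infty (l : ℂ) (A : Set ℂ) :
    mob (T l) (insert ∞ ((fun z : ℂ => (z : Sphere)) '' A)) =
      insert ∞ ((fun z : ℂ => (z : Sphere)) '' {z | z - 2 * l ∈ A}) := by
  rw [← mob_T_coe, mob, Set.image_insert_eq, T_smul_infty]; rfl

lemma mob_T_circleCurve (l a : ℂ) (r : ℝ) :
    mob (T l) (circleCurve a r) = circleCurve (a + 2 * l) r := by
  rw [circleCurve, mob_T_coe, circleCurve]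
  congr 1
  ext z
  simp only [Set.mem_ofPred_eq, mem_sphere_iff_norm]
  rw [sub_sub, add_comm (2 * l)]

/-! ### Subsets of the sphere -/

lemma coe_mem_coe_image {A : Set ℂ} {z : ℂ} :
    (z : Sphere) ∈ (fun z : ℂ => (z : Sphere)) '' A ↔ z ∈ A := by
  simp

lemma infty_notMem_coe_image {A : Set ℂ} : (∞ : Sphere) ∉ (fun z : ℂ => (z : Sphere)) '' A := by
  simp

lemma disjoint_coe_image {A B : Set ℂ} (h : Disjoint A B) :
    Disjoint ((fun z : ℂ => (z : Sphere)) '' A) ((fun z : ℂ => (z : Sphere)) '' B) :=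
  (Set.disjoint_image_iff OnePoint.coe_injective).2 h

lemma isOpen_coe_image {A : Set ℂ} (h : IsOpen A) :
    IsOpen ((fun z : ℂ => (z : Sphere)) '' A) :=
  OnePoint.isOpen_image_coe.2 h

lemma isConnected_coe_image {A : Set ℂ} (h : IsConnected A) :
    IsConnected ((fun z : ℂ => (z : Sphere)) '' A) :=
  h.image _ OnePoint.continuous_coe.continuousOn

/-! ### Round discs -/

/-- The circle with its bounded side as inside. -/
def disk (a : ℂ) (r : ℝ) : SidedCurve where
  curve := circleCurve a r
  inside := (fun z : ℂ => (z : Sphere)) '' Metric.ball a r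

/-- A circle with the side of `∞` as inside. -/
def codisk (a : ℂ) (r : ℝ) : SidedCurve where
  curve := circleCurve a r
  inside := ((fun z : ℂ => (z : Sphere)) '' Metric.closedBall a r)ᶜ

lemma disk_outside (a : ℂ) (r : ℝ) :
    (disk a r).outside = ((fun z : ℂ => (z : Sphere)) '' Metric.closedBall a r)ᶜ := by
  rw [SidedCurve.outside, disk, circleCurve, ← Set.image_union, Set.union_comm,
    Metric.ball_union_sphere]

/-- Polar coordinates show that the finite part is a connected image, and `∞` lies in its closure,
so adding `∞` keeps the set connected. -/
lemma isConnected_compl_closedBall_sphere (a : ℂ) (r : ℝ) :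
    IsConnected (((fun z : ℂ => (z : Sphere)) '' Metric.closedBall a r)ᶜ) := by
  have h1 : IsConnected ((fun p : ℝ × ℝ => ((a + p.1 * Complex.exp (p.2 * Complex.I) : ℂ) : Sphere))
      '' (Set.Ioi r ×ˢ Set.univ)) := by
    apply (isConnected_Ioi.prod isConnected_univ).image
    apply Continuous.continuousOn
    exact OnePoint.continuous_coe.comp (by fun_prop)
  refine h1.subset_closure ?_ ?_
  · rintro _ ⟨⟨s, t⟩, ⟨hs, -⟩, rfl⟩
    simp only [Set.mem_compl_iff, coe_mem_coe_image, Metric.mem_closedBall, dist_eq_norm,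
      add_sub_cancel_left, norm_mul, Complex.norm_exp_ofReal_mul_I, mul_one, Complex.norm_real,
      not_le]
    exact lt_of_lt_of_le hs (le_abs_self s)
  · intro w hw
    induction w using OnePoint.rec with
    | infty =>
      rw [mem_closure_iff_frequently]
      have ht : Filter.Tendsto (fun z : ℂ => (z : Sphere)) (Filter.cocompact ℂ) (nhds ∞) := by
        rw [← Filter.coclosedCompact_eq_cocompact]
        exact OnePoint.tendsto_coe_infty
      refine ht.frequently (Filter.Eventually.frequently ?_)
      have := (tendsto_norm_cocompact_atTop (E := ℂ)).eventually (Filter.eventually_gt_atTop (r + ‖a‖))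
      filter_upwards [this] with z hz
      refine ⟨(‖z - a‖, (z - a).arg), ⟨?_, trivial⟩, ?_⟩
      · have := norm_sub_norm_le z a
        simp only [Set.mem_Ioi]; linarith
      · simp [Complex.norm_mul_exp_arg_mul_I]
    | coe z =>
      apply subset_closure
      have hz : r < ‖z - a‖ := by simpa [dist_eq_norm] using hw
      exact ⟨(‖z - a‖, (z - a).arg), ⟨hz, trivial⟩, by simp [Complex.norm_mul_exp_arg_mul_I]⟩

lemma isOpen_compl_closedBall_sphere (a : ℂ) (r : ℝ) :
    IsOpen (((fun z : ℂ => (z : Sphere)) '' Metric.closedBall a r)ᶜ) :=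
  OnePoint.isOpen_compl_image_coe.2 ⟨Metric.isClosed_closedBall, isCompact_closedBall a r⟩

lemma disk_isJordan (a : ℂ) {r : ℝ} (hr : 0 < r) : (disk a r).IsJordan where
  exists_param := by
    refine ⟨fun w => ((a + r * w : ℂ) : Sphere), OnePoint.continuous_coe.comp (by fun_prop), ?_, ?_⟩
    · intro w₁ w₂ h
      have := OnePoint.coe_injective h
      have hr' : (r : ℂ) ≠ 0 := by exact_mod_cast hr.ne'
      exact Circle.ext (mul_left_cancel₀ hr' (add_left_cancel this))
    · have hr' : (r : ℂ) ≠ 0 := by exact_mod_cast hr.ne'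
      ext w
      simp only [Set.mem_range, disk, circleCurve, Set.mem_image, mem_sphere_iff_norm]
      constructor
      · rintro ⟨w, rfl⟩
        exact ⟨_, by simp [abs_of_pos hr, Circle.norm_coe], rfl⟩
      · rintro ⟨z, hz, rfl⟩
        refine ⟨⟨(z - a) / r, mem_sphere_zero_iff_norm.2 ?_⟩, ?_⟩
        · rw [norm_div, hz, Complex.norm_real, Real.norm_of_nonneg hr.le,
            div_self hr.ne']
        · congr 1
          field_simp
          ring
  disjoint := by
    apply disjoint_coe_image
    exact Metric.sphere_disjoint_ball
  isOpen_inside := isOpen_coe_image Metric.isOpen_ball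
  isConnected_inside := isConnected_coe_image
    ((convex_ball a r).isConnected ⟨a, Metric.mem_ball_self hr⟩)
  isOpen_outside := by
    rw [disk_outside]; exact isOpen_compl_closedBall_sphere a r
  isConnected_outside := by
    rw [disk_outside]; exact isConnected_compl_closedBall_sphere a r

lemma norm_pos_of_re_eq_one {c : ℂ} (hc : c.re = 1) : 0 < ‖c‖ := by
  rw [norm_pos_iff]; rintro rfl; simp at hc

lemma norm_sq_eq (c : ℂ) : ‖c‖ ^ 2 = c.re ^ 2 + c.im ^ 2 := by
  rw [Complex.sq_norm, Complex.normSq_apply]; ring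

lemma norm_lt_iff_sq {z : ℂ} {r : ℝ} (hr : 0 ≤ r) : ‖z‖ < r ↔ z.re ^ 2 + z.im ^ 2 < r ^ 2 := by
  rw [← norm_sq_eq, sq_lt_sq₀ (norm_nonneg _) hr]

lemma norm_eq_iff_sq {z : ℂ} {r : ℝ} (hr : 0 ≤ r) : ‖z‖ = r ↔ z.re ^ 2 + z.im ^ 2 = r ^ 2 := by
  rw [← norm_sq_eq, sq_eq_sq₀ (norm_nonneg _) hr]

/-- Up to the factor `‖z + 1‖ ^ 2`, the power of `S z` with respect to `C₂` is minus the power of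
`z` with respect to `C₁`. This gives the pairing of the curves and of the sides at once. -/
lemma sq_norm_S_sub {c : ℂ} (hc : c.re = 1) (z : ℂ) :
    ‖z - c * (z + 1)‖ ^ 2 - (‖c‖ * ‖z + 1‖) ^ 2 = -(‖z + c‖ ^ 2 - ‖c‖ ^ 2) := by
  rw [mul_pow]
  simp only [norm_sq_eq]
  simp [hc]
  ring

lemma S_smul_mem_ball {c : ℂ} (hc : c.re = 1) (z : Sphere) :
    z ∈ (disk (-c) ‖c‖).outside ↔ S • z ∈ (disk c ‖c‖).inside := by
  rw [disk_outside]
  have hc0 := norm_pos_of_re_eq_one hc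
  induction z using OnePoint.rec with
  | infty =>
    rw [S_smul_infty]
    simp only [Set.mem_compl_iff, infty_notMem_coe_image, not_false_iff, disk, coe_mem_coe_image,
      true_iff, mem_ball_iff_norm]
    rw [norm_lt_iff_sq hc0.le, norm_sq_eq]
    simp [hc]
  | coe z =>
    rw [S_smul_coe]
    simp only [Set.mem_compl_iff, disk, coe_mem_coe_image, mem_closedBall_iff_norm, sub_neg_eq_add,
      not_le]
    split_ifs with h
    -- The pole `-1` is inside `C₁` and its image `∞` is not inside `C₂`, so both sides of the
    -- equivalence fail.
    · have : z = -1 := by linear_combination h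
      simp only [this, infty_notMem_coe_image, iff_false, not_lt]
      rw [← sq_le_sq₀ (norm_nonneg _) hc0.le, norm_sq_eq, norm_sq_eq]
      simp [hc]
    · have h1 : 0 < ‖z + 1‖ := norm_pos_iff.2 h
      rw [coe_mem_coe_image, mem_ball_iff_norm]
      have : z / (z + 1) - c = (z - c * (z + 1)) / (z + 1) := by field_simp
      rw [this, norm_div, div_lt_iff₀ h1, ← sq_lt_sq₀ (norm_nonneg _) (norm_nonneg (z + c)),
        ← sq_lt_sq₀ (norm_nonneg _) (by positivity)]
      have := sq_norm_S_sub hc z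
      constructor <;> intro h <;> linarith

lemma S_smul_mem_sphere {c : ℂ} (hc : c.re = 1) (z : Sphere) :
    z ∈ circleCurve (-c) ‖c‖ ↔ S • z ∈ circleCurve c ‖c‖ := by
  have hc0 := norm_pos_of_re_eq_one hc
  unfold circleCurve
  induction z using OnePoint.rec with
  | infty =>
    rw [S_smul_infty]
    simp only [infty_notMem_coe_image, coe_mem_coe_image,
      false_iff, mem_sphere_iff_norm]
    rw [norm_eq_iff_sq hc0.le, norm_sq_eq]
    simp [hc]
  | coe z =>
    rw [S_smul_coe]
    simp only [coe_mem_coe_image, mem_sphere_iff_norm, sub_neg_eq_add]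
    split_ifs with h
    · have : z = -1 := by linear_combination h
      simp only [this, infty_notMem_coe_image, iff_false]
      rw [norm_eq_iff_sq hc0.le, norm_sq_eq]
      simp [hc]
    · have h1 : 0 < ‖z + 1‖ := norm_pos_iff.2 h
      rw [coe_mem_coe_image, mem_sphere_iff_norm]
      have : z / (z + 1) - c = (z - c * (z + 1)) / (z + 1) := by field_simp
      rw [this, norm_div, div_eq_iff h1.ne', ← sq_eq_sq₀ (norm_nonneg (z + c)) (norm_nonneg _),
        ← sq_eq_sq₀ (norm_nonneg _) (by positivity)]
      have := sq_norm_S_sub hc z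
      constructor <;> intro h <;> linarith

lemma mob_S_disk_curve {c : ℂ} (hc : c.re = 1) :
    mob S (disk (-c) ‖c‖).curve = (disk c ‖c‖).curve :=
  mob_eq_of_forall_mem_iff (S_smul_mem_sphere hc)

lemma mob_S_disk_outside {c : ℂ} (hc : c.re = 1) :
    mob S (disk (-c) ‖c‖).outside = (disk c ‖c‖).inside :=
  mob_eq_of_forall_mem_iff (S_smul_mem_ball hc)

/-! ### Orthonormal frames -/

/-- The coordinate of `z` in the direction `n`. -/
def coord (n z : ℂ) : ℝ := (z * (starRingEnd ℂ) n).re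

lemma coord_eq (n z : ℂ) : coord n z = z.re * n.re + z.im * n.im := by
  simp [coord]

lemma continuous_coord (n : ℂ) : Continuous (coord n) := by
  unfold coord; fun_prop

lemma coord_add (n z w : ℂ) : coord n (z + w) = coord n z + coord n w := by
  simp only [coord_eq, Complex.add_re, Complex.add_im]; ring

lemma coord_sub (n z w : ℂ) : coord n (z - w) = coord n z - coord n w := by
  simp only [coord_eq, Complex.sub_re, Complex.sub_im]; ring

lemma coord_neg (n z : ℂ) : coord n (-z) = -coord n z := by
  simp only [coord_eq, Complex.neg_re, Complex.neg_im]; ring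

lemma coord_real_mul (n z : ℂ) (t : ℝ) : coord n (t * z) = t * coord n z := by
  simp only [coord_eq, Complex.mul_re, Complex.mul_im, Complex.ofReal_re, Complex.ofReal_im]; ring

/-- Two orthogonal unit vectors. -/
structure IsFrame (d n : ℂ) : Prop where
  norm_left : ‖d‖ = 1
  norm_right : ‖n‖ = 1
  coord_left : coord d n = 0

namespace IsFrame

variable {d n : ℂ}

/-- Here `k` is the orientation of the frame, `n = k i d`. Substituting it makes the frame
identities polynomial consequences of `k ^ 2 = 1` and `‖d‖ = 1`. -/
lemma exists_sign (h : IsFrame d n) :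
    ∃ k : ℝ, k ^ 2 = 1 ∧ n.re = -(k * d.im) ∧ n.im = k * d.re ∧ d.re ^ 2 + d.im ^ 2 = 1 := by
  have h1 := norm_sq_eq d
  have h2 := norm_sq_eq n
  have h3 := h.coord_left
  rw [h.norm_left] at h1
  rw [h.norm_right] at h2
  rw [coord_eq] at h3
  refine ⟨d.re * n.im - d.im * n.re, ?_, ?_, ?_, by linarith⟩
  · linear_combination (-n.re ^ 2 - n.im ^ 2) * h1 - h2 - (n.re * d.re + n.im * d.im) * h3
  · linear_combination n.re * h1 + d.re * h3
  · linear_combination n.im * h1 + d.im * h3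

lemma coord_frame_left (h : IsFrame d n) (x y : ℝ) : coord d (x * d + y * n) = x := by
  rw [coord_add, coord_real_mul, coord_real_mul, h.coord_left]
  have := norm_sq_eq d
  rw [h.norm_left] at this
  rw [coord_eq]
  linear_combination -x * this

lemma coord_frame_right (h : IsFrame d n) (x y : ℝ) : coord n (x * d + y * n) = y := by
  rw [coord_add, coord_real_mul, coord_real_mul]
  have h3 := h.coord_left
  have := norm_sq_eq n
  rw [h.norm_right] at this
  rw [coord_eq] at h3 ⊢
  rw [coord_eq]
  linear_combination -y * this + x * h3

lemma frame_coord (h : IsFrame d n) (z : ℂ) : (coord d z : ℂ) * d + coord n z * n = z := by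
  obtain ⟨k, hk, h1, h2, h3⟩ := h.exists_sign
  apply Complex.ext
  · simp [coord_eq, h1, h2]
    linear_combination z.re * h3 + d.im * (z.re * d.im - z.im * d.re) * hk
  · simp [coord_eq, h1, h2]
    linear_combination z.im * h3 + d.re * (z.im * d.re - z.re * d.im) * hk

lemma sq_norm (h : IsFrame d n) (z : ℂ) : ‖z‖ ^ 2 = coord d z ^ 2 + coord n z ^ 2 := by
  obtain ⟨k, hk, h1, h2, h3⟩ := h.exists_sign
  rw [norm_sq_eq]
  simp only [coord_eq, h1, h2]
  linear_combination (-(z.re ^ 2 + z.im ^ 2)) * h3 - (z.im * d.re - z.re * d.im) ^ 2 * hk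

lemma ext (h : IsFrame d n) {z w : ℂ} (h1 : coord d z = coord d w) (h2 : coord n z = coord n w) :
    z = w := by
  rw [← h.frame_coord z, h1, h2, h.frame_coord]

end IsFrame

/-! ### Graphs -/

/-- The graph of a function over the direction `d`, with the point `∞`. -/
def graphCurve (d n : ℂ) (f : ℝ → ℝ) : Set Sphere :=
  insert ∞ ((fun z : ℂ => (z : Sphere)) '' {z | coord n z = f (coord d z)})

/-- A graph with its upper side. -/
def above (d n : ℂ) (f : ℝ → ℝ) : SidedCurve where
  curve := graphCurve d n f
  inside := (fun z : ℂ => (z : Sphere)) '' {z | f (coord d z) < coord n z}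

/-- A graph with its lower side. -/
def below (d n : ℂ) (f : ℝ → ℝ) : SidedCurve where
  curve := graphCurve d n f
  inside := (fun z : ℂ => (z : Sphere)) '' {z | coord n z < f (coord d z)}

lemma above_outside (d n : ℂ) (f : ℝ → ℝ) : (above d n f).outside = (below d n f).inside := by
  ext w
  simp only [SidedCurve.outside, above, below, graphCurve]
  induction w using OnePoint.rec with
  | infty => simp
  | coe z =>
    simp only [Set.mem_compl_iff, Set.mem_union, Set.mem_insert_iff, coe_mem_coe_image,
      OnePoint.coe_ne_infty, false_or, Set.mem_ofPred_eq, not_or, not_lt]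
    exact ⟨fun h => lt_of_le_of_ne h.2 h.1, fun h => ⟨h.ne, h.le⟩⟩

lemma below_outside (d n : ℂ) (f : ℝ → ℝ) : (below d n f).outside = (above d n f).inside := by
  ext w
  simp only [SidedCurve.outside, above, below, graphCurve]
  induction w using OnePoint.rec with
  | infty => simp
  | coe z =>
    simp only [Set.mem_compl_iff, Set.mem_union, Set.mem_insert_iff, coe_mem_coe_image,
      OnePoint.coe_ne_infty, false_or, Set.mem_ofPred_eq, not_or, not_lt]
    exact ⟨fun h => lt_of_le_of_ne h.2 (Ne.symm h.1), fun h => ⟨h.ne', h.le⟩⟩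

/-- A closed embedded line together with `∞` is a Jordan curve. -/
lemma exists_param_of_isClosedEmbedding {γ : ℝ → ℂ} (hγ : Topology.IsClosedEmbedding γ) :
    ∃ f : Circle → Sphere, Continuous f ∧ Function.Injective f ∧
      Set.range f = insert ∞ ((fun z : ℂ => (z : Sphere)) '' Set.range γ) := by
  -- Stereographic projection identifies `OnePoint ℝ` with a circle; a closed embedding is proper,
  -- so it extends continuously by `∞ ↦ ∞`.
  let e := (onePointEquivSphereOfFinrankEq (ι := Fin 2) (V := ℝ) (by simp)).symm
  let i : Circle → Metric.sphere (0 : EuclideanSpace ℝ (Fin 2)) 1 := fun w =>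
    ⟨Complex.orthonormalBasisOneI.repr w, by
      rw [mem_sphere_zero_iff_norm, LinearIsometryEquiv.norm_map, Circle.norm_coe]⟩
  have hi : Continuous i := by
    apply Continuous.subtype_mk
    exact Complex.orthonormalBasisOneI.repr.continuous.comp continuous_subtype_val
  have hi' : Function.Bijective i := by
    constructor
    · intro w₁ w₂ h
      exact Circle.ext (Complex.orthonormalBasisOneI.repr.injective (congrArg Subtype.val h))
    · intro w
      refine ⟨⟨Complex.orthonormalBasisOneI.repr.symm w, mem_sphere_zero_iff_norm.2 ?_⟩, ?_⟩
      · rw [LinearIsometryEquiv.norm_map]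
        simp
      · exact Subtype.ext (LinearIsometryEquiv.apply_symm_apply _ _)
  have hm : Continuous (OnePoint.map γ : OnePoint ℝ → OnePoint ℂ) := by
    refine OnePoint.continuous_map hγ.continuous ?_
    simp only [Filter.coclosedCompact_eq_cocompact]
    exact hγ.tendsto_cocompact
  refine ⟨fun w => OnePoint.map γ (e (i w)), hm.comp (e.continuous.comp hi), ?_, ?_⟩
  · refine Function.Injective.comp ?_ (e.injective.comp hi'.1)
    intro a b h
    induction a using OnePoint.rec with
    | infty =>
      induction b using OnePoint.rec with
      | infty => rfl
      | coe b => exact absurd h (OnePoint.infty_ne_coe (γ b))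
    | coe a =>
      induction b using OnePoint.rec with
      | infty => exact absurd h (OnePoint.coe_ne_infty (γ a))
      | coe b => rw [hγ.injective (OnePoint.coe_injective h)]
  · have h1 : Set.range (fun w => OnePoint.map γ (e (i w))) =
        Set.range (OnePoint.map γ : OnePoint ℝ → OnePoint ℂ) :=
      (e.surjective.comp hi'.2).range_comp (OnePoint.map γ)
    rw [h1]
    ext w
    constructor
    · rintro ⟨a, rfl⟩
      induction a using OnePoint.rec with
      | infty => exact Or.inl rfl
      | coe a => exact Or.inr ⟨γ a, ⟨a, rfl⟩, rfl⟩
    · rintro (rfl | ⟨_, ⟨a, rfl⟩, rfl⟩)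
      · exact ⟨∞, rfl⟩
      · exact ⟨(a : OnePoint ℝ), rfl⟩

section Jordan

variable {d n : ℂ} {f : ℝ → ℝ}

lemma graphCurve_exists_param (h : IsFrame d n) (hf : Continuous f) :
    ∃ p : Circle → Sphere, Continuous p ∧ Function.Injective p ∧ Set.range p = graphCurve d n f := by
  have hγ : Topology.IsClosedEmbedding (fun t : ℝ => (t : ℂ) * d + (f t : ℂ) * n) := by
    refine Function.LeftInverse.isClosedEmbedding (f := coord d) ?_ (continuous_coord d)
      (by fun_prop)
    intro t
    exact h.coord_frame_left _ _
  convert exists_param_of_isClosedEmbedding hγ using 5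
  rw [graphCurve]
  congr 2
  ext z
  simp only [Set.mem_ofPred_eq, Set.mem_range]
  constructor
  · intro hz
    exact ⟨coord d z, by rw [← hz, h.frame_coord]⟩
  · rintro ⟨t, rfl⟩
    rw [h.coord_frame_left, h.coord_frame_right]

lemma isOpen_above_inside (hf : Continuous f) : IsOpen (above d n f).inside :=
  isOpen_coe_image (isOpen_lt (hf.comp (continuous_coord d)) (continuous_coord n))

lemma isOpen_below_inside (hf : Continuous f) : IsOpen (below d n f).inside :=
  isOpen_coe_image (isOpen_lt (continuous_coord n) (hf.comp (continuous_coord d)))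

lemma isConnected_above_inside (h : IsFrame d n) (hf : Continuous f) :
    IsConnected (above d n f).inside := by
  apply isConnected_coe_image
  have : {z | f (coord d z) < coord n z} =
      (fun p : ℝ × ℝ => (p.1 : ℂ) * d + ((f p.1 + p.2 : ℝ) : ℂ) * n) '' (Set.univ ×ˢ Set.Ioi 0) := by
    ext z
    constructor
    · intro hz
      refine ⟨(coord d z, coord n z - f (coord d z)), ⟨trivial, Set.mem_Ioi.2 (sub_pos.2 hz)⟩, ?_⟩
      simp only [add_sub_cancel, h.frame_coord]
    · rintro ⟨p, ⟨-, hp⟩, rfl⟩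
      simp only [Set.mem_ofPred_eq, h.coord_frame_left, h.coord_frame_right]
      have : (0 : ℝ) < p.2 := hp
      linarith
  rw [this]
  exact (isConnected_univ.prod isConnected_Ioi).image _ (Continuous.continuousOn (by fun_prop))

lemma isConnected_below_inside (h : IsFrame d n) (hf : Continuous f) :
    IsConnected (below d n f).inside := by
  apply isConnected_coe_image
  have : {z | coord n z < f (coord d z)} =
      (fun p : ℝ × ℝ => (p.1 : ℂ) * d + ((f p.1 + p.2 : ℝ) : ℂ) * n) '' (Set.univ ×ˢ Set.Iio 0) := by
    ext z
    constructor
    · intro hz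
      refine ⟨(coord d z, coord n z - f (coord d z)), ⟨trivial, Set.mem_Iio.2 (sub_neg.2 hz)⟩, ?_⟩
      simp only [add_sub_cancel, h.frame_coord]
    · rintro ⟨p, ⟨-, hp⟩, rfl⟩
      simp only [Set.mem_ofPred_eq, h.coord_frame_left, h.coord_frame_right]
      have : p.2 < (0 : ℝ) := hp
      linarith
  rw [this]
  exact (isConnected_univ.prod isConnected_Iio).image _ (Continuous.continuousOn (by fun_prop))

lemma above_isJordan (h : IsFrame d n) (hf : Continuous f) : (above d n f).IsJordan where
  exists_param := graphCurve_exists_param h hf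
  disjoint := by
    rw [Set.disjoint_left]
    rintro w hw ⟨z, hz, rfl⟩
    simp only [above, graphCurve, Set.mem_insert_iff, OnePoint.coe_ne_infty, false_or,
      coe_mem_coe_image] at hw
    exact (ne_of_gt hz) hw
  isOpen_inside := isOpen_above_inside hf
  isConnected_inside := isConnected_above_inside h hf
  isOpen_outside := by rw [above_outside]; exact isOpen_below_inside hf
  isConnected_outside := by rw [above_outside]; exact isConnected_below_inside h hf

lemma below_isJordan (h : IsFrame d n) (hf : Continuous f) : (below d n f).IsJordan where
  exists_param := graphCurve_exists_param h hf
  disjoint := by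
    rw [Set.disjoint_left]
    rintro w hw ⟨z, hz, rfl⟩
    simp only [below, graphCurve, Set.mem_insert_iff, OnePoint.coe_ne_infty, false_or,
      coe_mem_coe_image] at hw
    exact (ne_of_lt hz) hw
  isOpen_inside := isOpen_below_inside hf
  isConnected_inside := isConnected_below_inside h hf
  isOpen_outside := by rw [below_outside]; exact isOpen_above_inside hf
  isConnected_outside := by rw [below_outside]; exact isConnected_above_inside h hf

end Jordan

/-! ### Configurations bounded by graphs -/

lemma forall_ne_fin_four {P : Fin 4 → Fin 4 → Prop} (symm : ∀ i j, P i j → P j i)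
    (h01 : P 0 1) (h02 : P 0 2) (h03 : P 0 3) (h12 : P 1 2) (h13 : P 1 3) (h23 : P 2 3) :
    ∀ i j, i ≠ j → P i j := by
  intro i j hij
  fin_cases i <;> fin_cases j <;> first | exact absurd rfl hij | assumption | (apply symm; assumption)

/-- By the median formula the squared distance from `z` to the midpoint is `r ^ 2 - ‖a - b‖ ^ 2 /
4`, which the separation of the centers makes nonpositive. -/
lemma eq_midpoint_of_mem_sphere {a b z : ℂ} {r : ℝ} (hz : z ∈ Metric.sphere a r)
    (hz' : z ∈ Metric.sphere b r) (hab : 2 * r ≤ ‖a - b‖) : z = (a + b) / 2 := by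
  rw [mem_sphere_iff_norm] at hz hz'
  have h0 : 0 ≤ r := hz ▸ norm_nonneg _
  have h1 : (2 * r) ^ 2 ≤ ‖a - b‖ ^ 2 := pow_le_pow_left₀ (by positivity) hab 2
  have h2 : ‖z - (a + b) / 2‖ ^ 2 ≤ 0 := by
    have e1 : ‖z - a‖ ^ 2 = r ^ 2 := by rw [hz]
    have e2 : ‖z - b‖ ^ 2 = r ^ 2 := by rw [hz']
    have : ‖z - (a + b) / 2‖ ^ 2 = (‖z - a‖ ^ 2 + ‖z - b‖ ^ 2) / 2 - ‖a - b‖ ^ 2 / 4 := by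
      simp only [norm_sq_eq]
      simp
      ring
    rw [this, e1, e2]
    linarith
  have h3 : ‖z - (a + b) / 2‖ = 0 := by
    have := sq_nonneg ‖z - (a + b) / 2‖
    exact pow_eq_zero_iff (two_ne_zero) |>.1 (le_antisymm h2 this)
  rw [norm_eq_zero] at h3
  exact sub_eq_zero.1 h3

lemma midpoint_mem_sphere {a b : ℂ} {r : ℝ} (hab : ‖a - b‖ = 2 * r) :
    (a + b) / 2 ∈ Metric.sphere a r ∩ Metric.sphere b r := by
  constructor
  · rw [mem_sphere_iff_norm, show (a + b) / 2 - a = -((a - b) / 2) by ring, norm_neg, norm_div, hab]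
    simp
  · rw [mem_sphere_iff_norm, show (a + b) / 2 - b = (a - b) / 2 by ring, norm_div, hab]
    simp

lemma circleCurve_inter_finite {a b : ℂ} {r : ℝ} (hab : 2 * r ≤ ‖a - b‖) :
    (circleCurve a r ∩ circleCurve b r).Finite := by
  refine (Set.finite_singleton (((a + b) / 2 : ℂ) : Sphere)).subset ?_
  rintro w ⟨⟨z, hz, rfl⟩, hz'⟩
  rw [circleCurve, coe_mem_coe_image] at hz'
  rw [eq_midpoint_of_mem_sphere hz hz' hab]
  rfl

lemma circleCurve_inter_eq {a b : ℂ} {r : ℝ} (hab : ‖a - b‖ = 2 * r) :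
    circleCurve a r ∩ circleCurve b r = {(((a + b) / 2 : ℂ) : Sphere)} := by
  ext w
  constructor
  · rintro ⟨⟨z, hz, rfl⟩, hz'⟩
    rw [circleCurve, coe_mem_coe_image] at hz'
    rw [eq_midpoint_of_mem_sphere hz hz' hab.ge]
    rfl
  · rintro rfl
    have := midpoint_mem_sphere hab
    exact ⟨⟨_, this.1, rfl⟩, ⟨_, this.2, rfl⟩⟩

/-- The function is, at each point, equal to one of finitely many affine functions. -/
def IsPiecewiseAffine (f : ℝ → ℝ) : Prop :=
  ∃ F : Finset (ℝ × ℝ), ∀ x, ∃ p ∈ F, f x = p.1 + p.2 * x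

lemma IsPiecewiseAffine.shift {f : ℝ → ℝ} (hf : IsPiecewiseAffine f) (s t : ℝ) :
    IsPiecewiseAffine (fun x => f (x + s) - t) := by
  obtain ⟨F, hF⟩ := hf
  classical
  refine ⟨F.image fun p => (p.1 + p.2 * s - t, p.2), fun x => ?_⟩
  obtain ⟨p, hp, h⟩ := hF (x + s)
  exact ⟨_, Finset.mem_image_of_mem _ hp, by simp only [h]; ring⟩

lemma finite_quadratic_roots {A : ℝ} (hA : A ≠ 0) (B C : ℝ) :
    {x : ℝ | A * x ^ 2 + B * x + C = 0}.Finite := by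
  rcases Set.eq_empty_or_nonempty {x : ℝ | A * x ^ 2 + B * x + C = 0} with h | ⟨y, hy⟩
  · rw [h]; exact Set.finite_empty
  · refine (Set.toFinite {y, -B / A - y}).subset ?_
    intro x hx
    have hx : A * x ^ 2 + B * x + C = 0 := hx
    have hy : A * y ^ 2 + B * y + C = 0 := hy
    have : (x - y) * (A * (x + y) + B) = 0 := by linear_combination hx - hy
    rcases mul_eq_zero.1 this with h | h
    · exact Or.inl (sub_eq_zero.1 h)
    · right
      rw [Set.mem_singleton_iff]
      field_simp
      linear_combination h

section

variable {d n : ℂ}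

/-- On each affine piece the equation of the circle is quadratic in the coordinate along `d`, with
leading coefficient `1 + p.2 ^ 2`. -/
lemma finite_sphere_inter_graph (h : IsFrame d n) {f : ℝ → ℝ} (hf : IsPiecewiseAffine f) (a : ℂ)
    (r : ℝ) : (Metric.sphere a r ∩ {z | coord n z = f (coord d z)}).Finite := by
  obtain ⟨F, hF⟩ := hf
  have : Metric.sphere a r ∩ {z | coord n z = f (coord d z)} ⊆
      ⋃ p ∈ F, Metric.sphere a r ∩ {z | coord n z = p.1 + p.2 * coord d z} := by
    rintro z ⟨hz, hz'⟩
    obtain ⟨p, hp, hp'⟩ := hF (coord d z)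
    simp only [Set.mem_iUnion]
    exact ⟨p, hp, hz, hz'.trans hp'⟩
  refine (Set.Finite.biUnion F.finite_toSet fun p _ => ?_).subset this
  have hq : 1 + p.2 ^ 2 ≠ 0 := by positivity
  refine Set.Finite.of_finite_image (f := coord d) ((finite_quadratic_roots hq
    (2 * p.2 * (p.1 - coord n a) - 2 * coord d a)
    (coord d a ^ 2 + (p.1 - coord n a) ^ 2 - r ^ 2)).subset ?_) ?_
  · rintro _ ⟨z, ⟨hz, hz'⟩, rfl⟩
    have hz' : coord n z = p.1 + p.2 * coord d z := hz'
    rw [mem_sphere_iff_norm] at hz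
    have := h.sq_norm (z - a)
    rw [hz, coord_sub, coord_sub, hz'] at this
    show _ = _
    linear_combination -this
  · rintro z ⟨-, hz⟩ w ⟨-, hw⟩ hzw
    have hz : coord n z = p.1 + p.2 * coord d z := hz
    have hw : coord n w = p.1 + p.2 * coord d w := hw
    exact h.ext hzw (by rw [hz, hw, hzw])

lemma circleCurve_inter_graphCurve_finite (h : IsFrame d n) {f : ℝ → ℝ}
    (hf : IsPiecewiseAffine f) (a : ℂ) (r : ℝ) : (circleCurve a r ∩ graphCurve d n f).Finite := by
  refine ((finite_sphere_inter_graph h hf a r).image (fun z : ℂ => (z : Sphere))).subset ?_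
  rintro w ⟨⟨z, hz, rfl⟩, hz'⟩
  simp only [graphCurve, Set.mem_insert_iff, OnePoint.coe_ne_infty, false_or,
    coe_mem_coe_image] at hz'
  exact ⟨z, ⟨hz, hz'⟩, rfl⟩

/-- The function whose graph is the translate by `-2 l` of the graph of `f`. -/
def lowered (l d n : ℂ) (f : ℝ → ℝ) : ℝ → ℝ := fun x => f (x + coord d (2 * l)) - coord n (2 * l)

lemma mob_T_graphCurve (l : ℂ) (f : ℝ → ℝ) :
    mob (T l) (graphCurve d n (lowered l d n f)) = graphCurve d n f := by
  rw [graphCurve, mob_T_insert_infty, graphCurve]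
  congr 2
  ext z
  simp only [Set.mem_ofPred_eq, lowered, coord_sub, sub_add_cancel]
  exact sub_left_inj

lemma mob_T_below_outside (l : ℂ) (f : ℝ → ℝ) :
    mob (T l) (below d n (lowered l d n f)).outside = (above d n f).inside := by
  rw [below_outside, above, above, mob_T_coe]
  congr 1
  ext z
  simp only [Set.mem_ofPred_eq, lowered, coord_sub, sub_add_cancel]
  exact sub_lt_sub_iff_right _

/-- Two tangent circles of the same radius between a graph and its translate. -/
noncomputable def graphConfig (l c d n : ℂ) (f : ℝ → ℝ) : Config :=
  ![disk (-c) ‖c‖, disk c ‖c‖, below d n (lowered l d n f), above d n f]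

lemma disjoint_disk_below {a : ℂ} {r : ℝ} {g : ℝ → ℝ}
    (hg : ∀ z ∈ Metric.ball a r, g (coord d z) ≤ coord n z) :
    Disjoint (disk a r).inside (below d n g).inside :=
  disjoint_coe_image (Set.disjoint_left.2 fun z hz hz' => (hg z hz).not_gt hz')

lemma disjoint_disk_above {a : ℂ} {r : ℝ} {f : ℝ → ℝ}
    (hf : ∀ z ∈ Metric.ball a r, coord n z ≤ f (coord d z)) :
    Disjoint (disk a r).inside (above d n f).inside :=
  disjoint_coe_image (Set.disjoint_left.2 fun z hz hz' => (hf z hz).not_gt hz')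

lemma disjoint_disk_disk {a b : ℂ} {r : ℝ} (hab : 2 * r ≤ ‖a - b‖) :
    Disjoint (disk a r).inside (disk b r).inside :=
  disjoint_coe_image (Metric.ball_disjoint_ball (by rw [dist_eq_norm]; linarith))

lemma norm_neg_sub_self (c : ℂ) : ‖-c - c‖ = 2 * ‖c‖ := by
  rw [show -c - c = -(2 * c) by ring, norm_neg, norm_mul]; simp

lemma graphCurve_inter {f g : ℝ → ℝ} (hfg : ∀ x, g x < f x) :
    graphCurve d n g ∩ graphCurve d n f = {∞} := by
  ext w
  constructor
  · rintro ⟨h1, h2⟩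
    rcases h1 with h1 | ⟨z, hz, rfl⟩
    · exact h1
    · rcases h2 with h2 | ⟨z', hz', h⟩
      · exact h2
      · rw [OnePoint.coe_injective h] at hz'
        have hz : coord n z = g (coord d z) := hz
        have hz' : coord n z = f (coord d z) := hz'
        have := hfg (coord d z)
        linarith
  · rintro rfl
    exact ⟨Or.inl rfl, Or.inl rfl⟩

/-- The lower curve is defined as the translate of the upper one, so `T` pairs them by construction,
and `S` pairs the circles because `c.re = 1`. The inequalities place both discs between the graphs,
so the insides are disjoint; the graphs themselves meet only at `∞`. -/
theorem graphConfig_isSchottkyConfig {l c : ℂ} (h : IsFrame d n) (hc : c.re = 1) {f : ℝ → ℝ}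
    (hf : Continuous f) (hf' : IsPiecewiseAffine f) (hlt : ∀ x, lowered l d n f x < f x)
    (h₁ : ∀ z ∈ Metric.ball (-c) ‖c‖ ∪ Metric.ball c ‖c‖, coord n z ≤ f (coord d z))
    (h₂ : ∀ z ∈ Metric.ball (-c) ‖c‖ ∪ Metric.ball c ‖c‖, lowered l d n f (coord d z) ≤ coord n z) :
    IsSchottkyConfig S (T l) (graphConfig l c d n f) := by
  have hR := norm_pos_of_re_eq_one hc
  have hcc : 2 * ‖c‖ ≤ ‖-c - c‖ := (norm_neg_sub_self c).ge
  have hg : Continuous (lowered l d n f) := by unfold lowered; fun_prop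
  have hg' : IsPiecewiseAffine (lowered l d n f) := hf'.shift _ _
  refine ⟨?_, ?_, ?_, ?_, ?_, ?_, ?_⟩
  · intro i
    fin_cases i
    · exact disk_isJordan _ hR
    · exact disk_isJordan _ hR
    · exact below_isJordan h hg
    · exact above_isJordan h hf
  · refine forall_ne_fin_four (fun _ _ h => Disjoint.symm h) ?_ ?_ ?_ ?_ ?_ ?_
    · exact disjoint_disk_disk hcc
    · exact disjoint_disk_below fun z hz => h₂ z (Or.inl hz)
    · exact disjoint_disk_above fun z hz => h₁ z (Or.inl hz)
    · exact disjoint_disk_below fun z hz => h₂ z (Or.inr hz)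
    · exact disjoint_disk_above fun z hz => h₁ z (Or.inr hz)
    · refine disjoint_coe_image (Set.disjoint_left.2 fun z hz hz' => ?_)
      exact lt_asymm (hlt (coord d z)) (hz'.trans hz)
  · refine forall_ne_fin_four (fun _ _ h => by rwa [Set.inter_comm]) ?_ ?_ ?_ ?_ ?_ ?_
    · exact circleCurve_inter_finite hcc
    · exact circleCurve_inter_graphCurve_finite h hg' _ _
    · exact circleCurve_inter_graphCurve_finite h hf' _ _
    · exact circleCurve_inter_graphCurve_finite h hg' _ _
    · exact circleCurve_inter_graphCurve_finite h hf' _ _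
    · show (graphCurve d n (lowered l d n f) ∩ graphCurve d n f).Finite
      rw [graphCurve_inter hlt]
      exact Set.finite_singleton _
  · exact mob_S_disk_curve hc
  · exact mob_S_disk_outside hc
  · exact mob_T_graphCurve l f
  · exact mob_T_below_outside l f

theorem areSchottkyCurves_of_graph {l c : ℂ} (h : IsFrame d n) (hc : c.re = 1) {f : ℝ → ℝ}
    (hf : Continuous f) (hf' : IsPiecewiseAffine f) (hlt : ∀ x, lowered l d n f x < f x)
    (h₁ : ∀ z ∈ Metric.ball (-c) ‖c‖ ∪ Metric.ball c ‖c‖, coord n z ≤ f (coord d z))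
    (h₂ : ∀ z ∈ Metric.ball (-c) ‖c‖ ∪ Metric.ball c ‖c‖, lowered l d n f (coord d z) ≤ coord n z) :
    AreSchottkyCurves S (T l) (circleCurve (-c) ‖c‖) (circleCurve c ‖c‖)
      (mob (T l)⁻¹ (graphCurve d n f)) (graphCurve d n f) := by
  refine ⟨_, graphConfig_isSchottkyConfig h hc hf hf' hlt h₁ h₂, rfl, rfl, ?_, rfl⟩
  rw [← mob_T_graphCurve l f, mob_inv_mob]
  rfl

end

/-! ### Configurations for `S` and a conjugate of `S` -/

lemma mob_T_disk_outside (l a : ℂ) (r : ℝ) :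
    mob (T l) (disk a r).outside = (disk (a + 2 * l) r).outside := by
  rw [disk_outside, disk_outside, mob_compl, mob_T_coe]
  congr 2
  ext z
  simp only [Set.mem_ofPred_eq, mem_closedBall_iff_norm]
  rw [sub_sub, add_comm (2 * l)]

lemma mob_T_disk_inside (l a : ℂ) (r : ℝ) :
    mob (T l) (disk a r).inside = (disk (a + 2 * l) r).inside := by
  rw [disk, disk, mob_T_coe]
  congr 1
  ext z
  simp only [Set.mem_ofPred_eq, mem_ball_iff_norm]
  rw [sub_sub, add_comm (2 * l)]

theorem areSchottkyCurves_conj {l c : ℂ} (hc : c.re = 1) (h₀ : ‖c‖ ≤ ‖l‖) (h₁ : ‖c‖ ≤ ‖l - c‖)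
    (h₂ : ‖c‖ ≤ ‖l + c‖) :
    AreSchottkyCurves S (T l * S * (T l)⁻¹) (circleCurve (-c) ‖c‖) (circleCurve c ‖c‖)
      (mob (T l) (circleCurve (-c) ‖c‖)) (mob (T l) (circleCurve c ‖c‖)) := by
  have hR := norm_pos_of_re_eq_one hc
  have hcc : 2 * ‖c‖ ≤ ‖-c - c‖ := (norm_neg_sub_self c).ge
  -- The differences between centers of the first pair and of its translate are `-2` times one of
  -- `l`, `l + c`, `l - c`.
  have e (z w : ℂ) (hz : ‖c‖ ≤ ‖z‖) (hw : w = -(2 * z)) : 2 * ‖c‖ ≤ ‖w‖ := by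
    rw [hw, norm_neg, norm_mul, Complex.norm_ofNat]; linarith
  have h02 : 2 * ‖c‖ ≤ ‖-c - (-c + 2 * l)‖ := e _ _ h₀ (by ring)
  have h03 : 2 * ‖c‖ ≤ ‖-c - (c + 2 * l)‖ := e _ _ h₂ (by ring)
  have h12 : 2 * ‖c‖ ≤ ‖c - (-c + 2 * l)‖ := e _ _ h₁ (by ring)
  have h13 : 2 * ‖c‖ ≤ ‖c - (c + 2 * l)‖ := e _ _ h₀ (by ring)
  have h23 : 2 * ‖c‖ ≤ ‖(-c + 2 * l) - (c + 2 * l)‖ := by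
    convert hcc using 2; ring
  rw [mob_T_circleCurve, mob_T_circleCurve]
  refine ⟨![disk (-c) ‖c‖, disk c ‖c‖, disk (-c + 2 * l) ‖c‖, disk (c + 2 * l) ‖c‖],
    ⟨?_, ?_, ?_, ?_, ?_, ?_, ?_⟩, rfl, rfl, rfl, rfl⟩
  · intro i
    fin_cases i <;> exact disk_isJordan _ hR
  · refine forall_ne_fin_four (fun _ _ h => Disjoint.symm h) ?_ ?_ ?_ ?_ ?_ ?_ <;>
      (apply disjoint_disk_disk; assumption)
  · refine forall_ne_fin_four (fun _ _ h => by rwa [Set.inter_comm]) ?_ ?_ ?_ ?_ ?_ ?_ <;>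
      (apply circleCurve_inter_finite; assumption)
  · exact mob_S_disk_curve hc
  · exact mob_S_disk_outside hc
  · show mob (T l * S * (T l)⁻¹) (circleCurve (-c + 2 * l) ‖c‖) = circleCurve (c + 2 * l) ‖c‖
    rw [mob_mul, mob_mul, ← mob_T_circleCurve, mob_inv_mob, ← mob_T_circleCurve]
    congr 1
    exact mob_S_disk_curve hc
  · show mob (T l * S * (T l)⁻¹) (disk (-c + 2 * l) ‖c‖).outside = (disk (c + 2 * l) ‖c‖).inside
    rw [mob_mul, mob_mul, ← mob_T_disk_outside, mob_inv_mob, ← mob_T_disk_inside,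
      mob_S_disk_outside hc]

/-! ### Polygonal curves as graphs -/

/-- A line that is a graph over the direction `d`. -/
def graphLine (d n : ℂ) (α β : ℝ) : Set ℂ := {z | coord n z = α + β * coord d z}

section

variable {d n : ℂ}

lemma mem_graphLine {α β : ℝ} {z : ℂ} : z ∈ graphLine d n α β ↔ coord n z = α + β * coord d z :=
  Iff.rfl

lemma levelLine_eq_graphLine (d n : ℂ) (h : ℝ) : levelLine n h = graphLine d n h 0 := by
  ext z
  rw [mem_graphLine, zero_mul, add_zero]
  rfl

lemma graphLine_inter (h : IsFrame d n) {α β α' β' : ℝ} (hβ : β ≠ β') {p : ℂ}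
    (hp : p ∈ graphLine d n α β) (hp' : p ∈ graphLine d n α' β') :
    graphLine d n α β ∩ graphLine d n α' β' = {p} := by
  ext z
  constructor
  · rintro ⟨hz, hz'⟩
    rw [mem_graphLine] at hp hp' hz hz'
    have h1 : (β - β') * (coord d z - coord d p) = 0 := by linear_combination hp - hp' - hz + hz'
    have h2 : coord d z = coord d p :=
      sub_eq_zero.1 ((mul_eq_zero.1 h1).resolve_left (sub_ne_zero.2 hβ))
    exact h.ext h2 (by rw [hz, hp, h2])
  · rintro rfl
    exact ⟨hp, hp'⟩

lemma segment_eq_graph (h : IsFrame d n) {α β : ℝ} {p q : ℂ} (hp : p ∈ graphLine d n α β)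
    (hq : q ∈ graphLine d n α β) (hpq : coord d p ≤ coord d q) :
    segment ℝ p q = {z ∈ graphLine d n α β | coord d p ≤ coord d z ∧ coord d z ≤ coord d q} := by
  rw [mem_graphLine] at hp hq
  ext z
  constructor
  · rintro ⟨s, t, hs, ht, hst, rfl⟩
    simp only [Set.mem_ofPred_eq, mem_graphLine, Complex.real_smul, coord_add, coord_real_mul]
    obtain rfl : s = 1 - t := by linarith
    refine ⟨?_, ?_, ?_⟩
    · linear_combination (1 - t) * hp + t * hq
    · nlinarith
    · nlinarith
  · rintro ⟨hz, h1, h2⟩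
    rw [mem_graphLine] at hz
    rcases hpq.eq_or_lt with he | hlt
    · have : z = p := h.ext (le_antisymm (he ▸ h2) h1) (by
        rw [hz, hp, le_antisymm (he ▸ h2) h1])
      rw [this]
      exact left_mem_segment ℝ p q
    · have hpos : 0 < coord d q - coord d p := sub_pos.2 hlt
      set t := (coord d z - coord d p) / (coord d q - coord d p) with ht
      have htx : t * (coord d q - coord d p) = coord d z - coord d p := by
        rw [ht]; field_simp
      refine ⟨1 - t, t, ?_, ?_, by ring, ?_⟩
      · rw [sub_nonneg, ht, div_le_one hpos]; linarith
      · exact div_nonneg (by linarith) hpos.le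
      · simp only [Complex.real_smul]
        apply h.ext
        · simp only [coord_add, coord_real_mul]
          linear_combination htx
        · simp only [coord_add, coord_real_mul]
          rw [hp, hq, hz]
          linear_combination β * htx

lemma mem_halfLine_iff (h : IsFrame d n) {α β : ℝ} {p q z : ℂ} (hp : p ∈ graphLine d n α β)
    (hq : q ∈ graphLine d n α β) (hpq : coord d p ≠ coord d q) :
    z ∈ halfLine p q ↔ z ∈ graphLine d n α β ∧
      0 ≤ (coord d z - coord d p) / (coord d q - coord d p) := by
  rw [mem_graphLine] at hp hq ⊢
  have hne : coord d q - coord d p ≠ 0 := sub_ne_zero.2 hpq.symm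
  constructor
  · rintro ⟨s, hs, rfl⟩
    simp only [coord_add, coord_real_mul, coord_sub]
    refine ⟨by linear_combination (1 - s) * hp + s * hq, ?_⟩
    rw [add_sub_cancel_left, mul_div_assoc, div_self hne, mul_one]
    exact hs
  · rintro ⟨hz, hs⟩
    refine ⟨_, hs, ?_⟩
    apply h.ext
    · simp only [coord_add, coord_real_mul, coord_sub]
      field_simp
      ring
    · simp only [coord_add, coord_real_mul, coord_sub]
      rw [hz, hp, hq]
      field_simp
      ring

lemma halfLine_eq_graph_left (h : IsFrame d n) {α β : ℝ} {p q : ℂ} (hp : p ∈ graphLine d n α β)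
    (hq : q ∈ graphLine d n α β) (hpq : coord d q < coord d p) :
    halfLine p q = {z ∈ graphLine d n α β | coord d z ≤ coord d p} := by
  ext z
  rw [mem_halfLine_iff h hp hq hpq.ne']
  refine and_congr_right fun _ => ?_
  rw [← neg_div_neg_eq, le_div_iff₀ (by linarith), zero_mul]
  constructor <;> intro h <;> linarith

lemma halfLine_eq_graph_right (h : IsFrame d n) {α β : ℝ} {p q : ℂ} (hp : p ∈ graphLine d n α β)
    (hq : q ∈ graphLine d n α β) (hpq : coord d p < coord d q) :
    halfLine p q = {z ∈ graphLine d n α β | coord d p ≤ coord d z} := by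
  ext z
  rw [mem_halfLine_iff h hp hq hpq.ne]
  refine and_congr_right fun _ => ?_
  rw [le_div_iff₀ (by linarith), zero_mul]
  exact sub_nonneg

/-- A zigzag: descending with slope `-s`, then horizontal at height `h`, rising with slope `t`,
horizontal at height `h'`, and descending with slope `-s` again. -/
noncomputable def zig (h₀ s t w h h' x : ℝ) : ℝ :=
  max (h₀ + -s * x) (min (max h (h₀ + t * x)) (min h' (h₀ + s * w + -s * x)))

lemma continuous_zig (h₀ s t w h h' : ℝ) : Continuous (zig h₀ s t w h h') := by
  unfold zig; fun_prop

lemma zig_cases (h₀ s t w h h' x : ℝ) :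
    zig h₀ s t w h h' x = h₀ + -s * x ∨ zig h₀ s t w h h' x = h ∨
    zig h₀ s t w h h' x = h₀ + t * x ∨ zig h₀ s t w h h' x = h' ∨
    zig h₀ s t w h h' x = h₀ + s * w + -s * x := by
  unfold zig
  rcases max_choice (h₀ + -s * x) (min (max h (h₀ + t * x)) (min h' (h₀ + s * w + -s * x)))
    with h1 | h1 <;> rw [h1]
  · exact Or.inl rfl
  · rcases min_choice (max h (h₀ + t * x)) (min h' (h₀ + s * w + -s * x)) with h2 | h2 <;> rw [h2]
    · rcases max_choice h (h₀ + t * x) with h3 | h3 <;> rw [h3] <;> simp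
    · rcases min_choice h' (h₀ + s * w + -s * x) with h3 | h3 <;> rw [h3] <;> simp

lemma isPiecewiseAffine_zig (h₀ s t w h h' : ℝ) : IsPiecewiseAffine (zig h₀ s t w h h') := by
  classical
  refine ⟨{(h₀, -s), (h, 0), (h₀, t), (h', 0), (h₀ + s * w, -s)}, fun x => ?_⟩
  rcases zig_cases h₀ s t w h h' x with e | e | e | e | e
  · exact ⟨(h₀, -s), by simp, e⟩
  · exact ⟨(h, 0), by simp, by rw [e]; ring⟩
  · exact ⟨(h₀, t), by simp, e⟩
  · exact ⟨(h', 0), by simp, by rw [e]; ring⟩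
  · exact ⟨(h₀ + s * w, -s), by simp, e⟩

/-- If the corners are in the right order, the curve of five arcs is the graph of a zigzag. -/
theorem fiveArcCurve_eq_graphCurve (hf : IsFrame d n) {h₀ s t w h h' : ℝ} (hs : 0 ≤ s) (ht : 0 ≤ t)
    (hw : 0 ≤ w) (hh : h ≤ h') {m₁ u₁ u₂ u₃ u₄ m₂ : ℂ}
    (hm₁ : m₁ ∈ graphLine d n h₀ (-s)) (hu₁ : u₁ ∈ graphLine d n h₀ (-s)) (hu₁' : coord n u₁ = h)
    (hu₂ : u₂ ∈ graphLine d n h₀ t) (hu₂' : coord n u₂ = h)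
    (hu₃ : u₃ ∈ graphLine d n h₀ t) (hu₃' : coord n u₃ = h')
    (hu₄ : u₄ ∈ graphLine d n (h₀ + s * w) (-s)) (hu₄' : coord n u₄ = h')
    (hm₂ : m₂ ∈ graphLine d n (h₀ + s * w) (-s))
    (h01 : coord d m₁ < coord d u₁) (h12 : coord d u₁ ≤ coord d u₂) (h23 : coord d u₂ ≤ coord d u₃)
    (h34 : coord d u₃ ≤ coord d u₄) (h45 : coord d u₄ < coord d m₂) :
    fiveArcCurve m₁ u₁ u₂ u₃ u₄ m₂ = graphCurve d n (zig h₀ s t w h h') := by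
  have l1 : u₁ ∈ graphLine d n h 0 := by rw [mem_graphLine, hu₁']; ring
  have l2 : u₂ ∈ graphLine d n h 0 := by rw [mem_graphLine, hu₂']; ring
  have l3 : u₃ ∈ graphLine d n h' 0 := by rw [mem_graphLine, hu₃']; ring
  have l4 : u₄ ∈ graphLine d n h' 0 := by rw [mem_graphLine, hu₄']; ring
  rw [fiveArcCurve, halfLine_eq_graph_left hf hu₁ hm₁ h01, segment_eq_graph hf l1 l2 h12,
    segment_eq_graph hf hu₂ hu₃ h23, segment_eq_graph hf l3 l4 h34,
    halfLine_eq_graph_right hf hu₄ hm₂ h45, graphCurve]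
  rw [mem_graphLine] at hu₁ hu₂ hu₃ hu₄
  rw [hu₁'] at hu₁
  rw [hu₂'] at hu₂
  rw [hu₃'] at hu₃
  rw [hu₄'] at hu₄
  have hsw : 0 ≤ s * w := mul_nonneg hs hw
  congr 2
  ext z
  generalize hx : coord d z = x
  generalize hy : coord n z = y
  simp only [Set.mem_union, Set.mem_ofPred_eq, mem_graphLine, hx, hy]
  generalize coord d u₁ = x₁ at *
  generalize coord d u₂ = x₂ at *
  generalize coord d u₃ = x₃ at *
  generalize coord d u₄ = x₄ at *
  -- The signs of the slopes order the two lines through a corner on either side of it. These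
  -- comparisons decide every maximum and minimum in `zig`.
  have s1 (hx : x ≤ x₁) : h ≤ h₀ + -s * x := by nlinarith
  have s1' (hx : x₁ ≤ x) : h₀ + -s * x ≤ h := by nlinarith
  have s2 (hx : x ≤ x₂) : h₀ + t * x ≤ h := by nlinarith
  have s2' (hx : x₂ ≤ x) : h ≤ h₀ + t * x := by nlinarith
  have s3 (hx : x ≤ x₃) : h₀ + t * x ≤ h' := by nlinarith
  have s3' (hx : x₃ ≤ x) : h' ≤ h₀ + t * x := by nlinarith
  have s4 (hx : x ≤ x₄) : h' ≤ h₀ + s * w + -s * x := by nlinarith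
  have s4' (hx : x₄ ≤ x) : h₀ + s * w + -s * x ≤ h' := by nlinarith
  have f1 (hx : x ≤ x₁) : zig h₀ s t w h h' x = h₀ + -s * x := by
    unfold zig
    rw [max_eq_left]
    rw [max_eq_left (s2 (hx.trans h12))]
    exact (min_le_left _ _).trans (s1 hx)
  have f2 (hx : x₁ ≤ x) (hx' : x ≤ x₂) : zig h₀ s t w h h' x = h := by
    unfold zig
    rw [max_eq_left (s2 hx'), min_eq_left (s4 (hx'.trans (h23.trans h34))), min_eq_left hh,
      max_eq_right (s1' hx)]
  have f3 (hx : x₂ ≤ x) (hx' : x ≤ x₃) : zig h₀ s t w h h' x = h₀ + t * x := by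
    unfold zig
    rw [max_eq_right (s2' hx), min_eq_left (s4 (hx'.trans h34)), min_eq_left (s3 hx'),
      max_eq_right ((s1' (h12.trans hx)).trans (s2' hx))]
  have f4 (hx : x₃ ≤ x) (hx' : x ≤ x₄) : zig h₀ s t w h h' x = h' := by
    unfold zig
    rw [min_eq_left (s4 hx'), min_eq_right (le_max_of_le_right (s3' hx)),
      max_eq_right ((s1' (h12.trans (h23.trans hx))).trans hh)]
  have f5 (hx : x₄ ≤ x) : zig h₀ s t w h h' x = h₀ + s * w + -s * x := by
    unfold zig
    rw [min_eq_right (s4' hx), min_eq_right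
      (le_max_of_le_right ((s4' hx).trans (s3' (h34.trans hx)))), max_eq_right (by linarith)]
  constructor
  · rintro ((((⟨hz, h1⟩ | ⟨hz, h1, h2⟩) | ⟨hz, h1, h2⟩) | ⟨hz, h1, h2⟩) | ⟨hz, h1⟩)
    · rw [f1 h1, hz]
    · rw [f2 h1 h2, hz]; ring
    · rw [f3 h1 h2, hz]
    · rw [f4 h1 h2, hz]; ring
    · rw [f5 h1, hz]
  · intro hz
    rcases le_total x x₁ with c1 | c1
    · exact Or.inl (Or.inl (Or.inl (Or.inl ⟨hz.trans (f1 c1), c1⟩)))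
    rcases le_total x x₂ with c2 | c2
    · exact Or.inl (Or.inl (Or.inl (Or.inr ⟨by rw [hz, f2 c1 c2]; ring, c1, c2⟩)))
    rcases le_total x x₃ with c3 | c3
    · exact Or.inl (Or.inl (Or.inr ⟨hz.trans (f3 c2 c3), c2, c3⟩))
    rcases le_total x x₄ with c4 | c4
    · exact Or.inl (Or.inr ⟨by rw [hz, f4 c3 c4]; ring, c3, c4⟩)
    · exact Or.inr ⟨hz.trans (f5 c4), c4⟩

/-- Shrinking the two horizontal pieces to points lets the curve of three arcs reuse the zigzag. -/
lemma threeArcCurve_eq_fiveArcCurve (m₁ u₁ u₂ m₂ : ℂ) :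
    threeArcCurve m₁ u₁ u₂ m₂ = fiveArcCurve m₁ u₁ u₁ u₂ u₂ m₂ := by
  rw [threeArcCurve, fiveArcCurve]
  congr 2
  have h1 : u₁ ∈ halfLine u₁ m₁ := ⟨0, le_rfl, by simp⟩
  have h2 : u₂ ∈ halfLine u₂ m₂ := ⟨0, le_rfl, by simp⟩
  rw [segment_same, segment_same]
  ext z
  simp only [Set.mem_union, Set.mem_singleton_iff]
  constructor
  · tauto
  · rintro ((((h | rfl) | h) | rfl) | h) <;> tauto

end

/-! ### Bisectors -/

/-- Equal circles that touch do so at the midpoint of their centers, so their common tangent can be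
handled as a bisector. -/
lemma tangentLine_eq_bisector (a b : ℂ) : tangentLine b ((a + b) / 2) = bisector a b := by
  ext z
  simp only [tangentLine, bisector, Set.mem_ofPred_eq, dist_eq_norm]
  rw [← sq_eq_sq₀ (norm_nonneg _) (norm_nonneg _), norm_sq_eq, norm_sq_eq,
    show (a + b) / 2 = ((1 / 2 : ℝ) : ℂ) * (a + b) by push_cast; ring]
  simp
  constructor <;> intro h <;> linarith

lemma bisector_comm (a b : ℂ) : bisector a b = bisector b a := by
  ext z; exact eq_comm

/-- The height of the point at equal distance from the centers of `A`, `B` and `T(A)`. -/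
noncomputable def apexHeight (R x H : ℝ) : ℝ := ((x - R) ^ 2 + H ^ 2 - R ^ 2) / (2 * H)

/-- The circles `A`, `B` with centers `-R d`, `R d`, and the translation by `x d + H n`, which
moves `A` to a place above the two circles, with disjoint interiors. -/
structure IsStacked (l c : ℂ) (e : ℝ) (d n : ℂ) (x H : ℝ) : Prop where
  frame : IsFrame d n
  re_eq : c.re = 1
  sign : e = 1 ∨ e = -1
  center : (e : ℂ) * c = (‖c‖ : ℝ) * d
  two_mul : 2 * l = x * d + H * n
  lt_height : ‖c‖ < H
  height_le : H ≤ 2 * ‖c‖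
  nonneg : 0 ≤ x
  -- This keeps the common point of the first two bisectors at or below `T(M₁)`, see `apex_le`.
  dev_le : |x - ‖c‖| ≤ H - ‖c‖
  -- The centers of `A` and `T(A)`, and in `sep₂` those of `T(A)` and `B`, are at least a diameter
  -- apart.
  sep₁ : 4 * ‖c‖ ^ 2 ≤ x ^ 2 + H ^ 2
  sep₂ : 4 * ‖c‖ ^ 2 ≤ (x - 2 * ‖c‖) ^ 2 + H ^ 2

/-! ### Bisectors of stacked circles and the curves of three and five arcs. -/

namespace IsStacked

variable {l c d n : ℂ} {e x H : ℝ} (st : IsStacked l c e d n x H)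
include st

lemma R_pos : 0 < ‖c‖ := norm_pos_of_re_eq_one st.re_eq

lemma H_pos : 0 < H := st.R_pos.trans st.lt_height

lemma le_two : x ≤ 2 * ‖c‖ := by
  have := (abs_le.1 st.dev_le).2
  have := st.height_le
  linarith

lemma two_mul_H_mul_apex : 2 * H * apexHeight ‖c‖ x H = (x - ‖c‖) ^ 2 + H ^ 2 - ‖c‖ ^ 2 := by
  have := st.H_pos
  rw [apexHeight]; field_simp

lemma apex_pos : 0 < apexHeight ‖c‖ x H := by
  have h1 := st.R_pos
  have h2 := st.lt_height
  have h3 := st.H_pos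
  rw [apexHeight]
  apply div_pos _ (by positivity)
  nlinarith [sq_nonneg (x - ‖c‖)]

/-- With `R = ‖c‖`, squaring `dev_le` gives `(x - R)² ≤ (H - R)²`, and `(H - R)² + H² - R² = 2 H (H
- R)`. -/
lemma apex_le : apexHeight ‖c‖ x H ≤ H - ‖c‖ := by
  have h3 := st.H_pos
  rw [apexHeight, div_le_iff₀ (by positivity)]
  have := sq_le_sq' (by linarith [neg_abs_le (x - ‖c‖), st.dev_le])
    ((le_abs_self _).trans st.dev_le)
  nlinarith

lemma coord_center : coord d ((e : ℂ) * c) = ‖c‖ ∧ coord n ((e : ℂ) * c) = 0 := by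
  have h1 := st.frame.coord_frame_left ‖c‖ 0
  have h2 := st.frame.coord_frame_right ‖c‖ 0
  simp only [Complex.ofReal_zero, zero_mul, add_zero] at h1 h2
  rw [st.center]
  exact ⟨h1, h2⟩

lemma coord_two_mul : coord d (2 * l) = x ∧ coord n (2 * l) = H := by
  rw [st.two_mul]
  exact ⟨st.frame.coord_frame_left _ _, st.frame.coord_frame_right _ _⟩

lemma coord_l : coord d l = x / 2 ∧ coord n l = H / 2 := by
  have h := st.coord_two_mul
  have h1 := coord_real_mul d l 2
  have h2 := coord_real_mul n l 2
  push_cast at h1 h2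
  constructor <;> linarith

/-- The quadratic terms cancel, leaving an affine function whose sign tells the side of the
bisector, since `2 * H` is positive. Both this bisector and the one in `sq_mid` pass through the
point of height `apexHeight` over `0`, which is equidistant from all three centers. -/
lemma sq_left (u : ℂ) : dist u (-(e * c) + 2 * l) ^ 2 - dist u (-(e * c)) ^ 2 =
    2 * H * (apexHeight ‖c‖ x H + -(x / H) * coord d u - coord n u) := by
  have hH := st.H_pos
  have ha := st.two_mul_H_mul_apex
  rw [dist_eq_norm, dist_eq_norm, st.frame.sq_norm, st.frame.sq_norm]
  simp only [coord_sub, coord_add, coord_neg, st.coord_center, st.coord_two_mul]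
  have : 2 * H * (apexHeight ‖c‖ x H + -(x / H) * coord d u - coord n u) =
    2 * H * apexHeight ‖c‖ x H - 2 * x * coord d u - 2 * H * coord n u := by field_simp; ring
  rw [this, ha]
  ring

lemma sq_mid (u : ℂ) : dist u (-(e * c) + 2 * l) ^ 2 - dist u (e * c) ^ 2 =
    2 * H * (apexHeight ‖c‖ x H + (2 * ‖c‖ - x) / H * coord d u - coord n u) := by
  have hH := st.H_pos
  have ha := st.two_mul_H_mul_apex
  rw [dist_eq_norm, dist_eq_norm, st.frame.sq_norm, st.frame.sq_norm]
  simp only [coord_sub, coord_add, coord_neg, st.coord_center, st.coord_two_mul]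
  have : 2 * H * (apexHeight ‖c‖ x H + (2 * ‖c‖ - x) / H * coord d u - coord n u) =
    2 * H * apexHeight ‖c‖ x H + 2 * (2 * ‖c‖ - x) * coord d u - 2 * H * coord n u := by
      field_simp
  rw [this, ha]
  ring

/-- `T` moves `A` and `B` by the same vector, so this bisector is the left one shifted by `2 * ‖c‖`
along `d`. -/
lemma sq_right (u : ℂ) : dist u (e * c + 2 * l) ^ 2 - dist u (e * c) ^ 2 =
    2 * H * (apexHeight ‖c‖ x H + x / H * (2 * ‖c‖) + -(x / H) * coord d u - coord n u) := by
  have hH := st.H_pos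
  have ha := st.two_mul_H_mul_apex
  rw [dist_eq_norm, dist_eq_norm, st.frame.sq_norm, st.frame.sq_norm]
  simp only [coord_sub, coord_add, st.coord_center, st.coord_two_mul]
  have : 2 * H * (apexHeight ‖c‖ x H + x / H * (2 * ‖c‖) + -(x / H) * coord d u - coord n u) =
    2 * H * apexHeight ‖c‖ x H + 4 * x * ‖c‖ - 2 * x * coord d u - 2 * H * coord n u := by
      field_simp; ring
  rw [this, ha]
  ring

lemma bisector_left : bisector (-(e * c)) (-(e * c) + 2 * l) =
    graphLine d n (apexHeight ‖c‖ x H) (-(x / H)) := by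
  ext u
  have := st.sq_left u
  rw [mem_graphLine, bisector, Set.mem_ofPred_eq, ← sq_eq_sq₀ dist_nonneg dist_nonneg, eq_comm,
    ← sub_eq_zero, this, mul_eq_zero_iff_left (by linarith [st.H_pos]), sub_eq_zero, eq_comm]

lemma bisector_mid : bisector (-(e * c) + 2 * l) (e * c) =
    graphLine d n (apexHeight ‖c‖ x H) ((2 * ‖c‖ - x) / H) := by
  ext u
  have := st.sq_mid u
  rw [mem_graphLine, bisector, Set.mem_ofPred_eq, ← sq_eq_sq₀ dist_nonneg dist_nonneg,
    ← sub_eq_zero, this, mul_eq_zero_iff_left (by linarith [st.H_pos]), sub_eq_zero, eq_comm]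

lemma bisector_right : bisector (e * c) (e * c + 2 * l) =
    graphLine d n (apexHeight ‖c‖ x H + x / H * (2 * ‖c‖)) (-(x / H)) := by
  ext u
  have := st.sq_right u
  rw [mem_graphLine, bisector, Set.mem_ofPred_eq, ← sq_eq_sq₀ dist_nonneg dist_nonneg, eq_comm,
    ← sub_eq_zero, this, mul_eq_zero_iff_left (by linarith [st.H_pos]), sub_eq_zero, eq_comm]

lemma dist_left : 2 * ‖c‖ ≤ dist (-(e * c)) (-(e * c) + 2 * l) := by
  rw [dist_self_add_right]
  apply (sq_le_sq₀ (by positivity) (norm_nonneg _)).1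
  rw [st.frame.sq_norm, st.coord_two_mul.1, st.coord_two_mul.2]
  linarith [st.sep₁]

lemma dist_mid : 2 * ‖c‖ ≤ dist (-(e * c) + 2 * l) (e * c) := by
  rw [dist_eq_norm]
  apply (sq_le_sq₀ (by positivity) (norm_nonneg _)).1
  rw [st.frame.sq_norm]
  simp only [coord_sub, coord_add, coord_neg, st.coord_center, st.coord_two_mul]
  linarith [st.sep₂]

lemma dist_right : 2 * ‖c‖ ≤ dist (e * c) (e * c + 2 * l) := by
  have := st.dist_left
  rw [dist_self_add_right] at this ⊢
  exact this

lemma ball_union : Metric.ball (-c) ‖c‖ ∪ Metric.ball c ‖c‖ =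
    Metric.ball (-(e * c)) ‖c‖ ∪ Metric.ball (e * c) ‖c‖ := by
  rcases st.sign with rfl | rfl
  · simp
  · simp [Set.union_comm]

lemma coord_sub_lt {a u : ℂ} (hu : u ∈ Metric.ball a ‖c‖) :
    |coord n u - coord n a| < ‖c‖ := by
  rw [mem_ball_iff_norm] at hu
  refine lt_of_le_of_lt ?_ hu
  rw [← coord_sub]
  apply abs_le_of_sq_le_sq _ (norm_nonneg _)
  rw [st.frame.sq_norm]
  nlinarith [sq_nonneg (coord d (u - a))]

-- The bisector of two centers that are two radii apart has the whole disc around `a` on the side of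
-- `a`.
omit st in
lemma sq_dist_le {a b u : ℂ} (hu : u ∈ Metric.ball a ‖c‖) (hab : 2 * ‖c‖ ≤ dist a b) :
    0 ≤ dist u b ^ 2 - dist u a ^ 2 := by
  rw [Metric.mem_ball] at hu
  have := dist_triangle_left a b u
  have := dist_nonneg (x := u) (y := a)
  rw [sub_nonneg]
  exact pow_le_pow_left₀ this (by linarith) 2

lemma nonneg_of_two_mul {s : ℝ} (h : 0 ≤ 2 * H * s) : 0 ≤ s :=
  nonneg_of_mul_nonneg_right h (by linarith [st.H_pos])

theorem areSchottkyCurves_zig {h h' : ℝ} (hh : h' < H + h) (hb : h ≤ H - ‖c‖) (hb' : ‖c‖ ≤ h') :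
    AreSchottkyCurves S (T l) (circleCurve (-c) ‖c‖) (circleCurve c ‖c‖)
      (mob (T l)⁻¹ (graphCurve d n
        (zig (apexHeight ‖c‖ x H) (x / H) ((2 * ‖c‖ - x) / H) (2 * ‖c‖) h h')))
      (graphCurve d n (zig (apexHeight ‖c‖ x H) (x / H) ((2 * ‖c‖ - x) / H) (2 * ‖c‖) h h')) := by
  have hH := st.H_pos
  have hR := st.R_pos
  have hx := st.nonneg
  have hs : 0 ≤ x / H := div_nonneg hx hH.le
  have hsx : 0 ≤ x / H * x := mul_nonneg hs hx
  have hsR : 0 ≤ x / H * (2 * ‖c‖) := mul_nonneg hs (by linarith)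
  refine areSchottkyCurves_of_graph st.frame st.re_eq (continuous_zig ..)
    (isPiecewiseAffine_zig ..) ?_ ?_ ?_
  -- The graph is strictly above its translate: the descending lines do not rise over the step `x ≥
  -- 0`, and the rest is capped by `h'`, which is less than `H` above the floor `h`.
  · intro y
    simp only [lowered, st.coord_two_mul, zig]
    generalize (2 * ‖c‖ - x) / H = t
    generalize hs' : x / H = s at *
    generalize apexHeight ‖c‖ x H = a
    rw [sub_lt_iff_lt_add, max_lt_iff]
    constructor
    · have := le_max_left (a + -s * y) (min (max h (a + t * y)) (min h' (a + s * (2 * ‖c‖) + -s * y)))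
      linarith
    · have h1 := le_max_right (a + -s * y)
        (min (max h (a + t * y)) (min h' (a + s * (2 * ‖c‖) + -s * y)))
      refine lt_of_lt_of_le ?_ (add_le_add_left h1 H)
      rw [← min_add_add_right, ← min_add_add_right, lt_min_iff, lt_min_iff]
      have h2 : min (max h (a + t * (y + x))) (min h' (a + s * (2 * ‖c‖) + -s * (y + x))) ≤ h' :=
        (min_le_right _ _).trans (min_le_left _ _)
      have h3 : min (max h (a + t * (y + x))) (min h' (a + s * (2 * ‖c‖) + -s * (y + x))) ≤
        a + s * (2 * ‖c‖) + -s * (y + x) := (min_le_right _ _).trans (min_le_right _ _)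
      have h4 := le_max_left h (a + t * y)
      exact ⟨by linarith, by linarith, by linarith⟩
  -- `A` is below the first descending line; `B` is below the middle bisector, the level `h'` and
  -- the last descending line.
  · intro u hu
    rw [st.ball_union] at hu
    rcases hu with hu | hu
    · have h1 := sq_dist_le hu st.dist_left
      rw [st.sq_left] at h1
      exact le_max_of_le_left (sub_nonneg.1 (st.nonneg_of_two_mul h1))
    · have h1 := sq_dist_le hu (st.dist_mid.trans_eq (dist_comm _ _))
      rw [st.sq_mid] at h1
      have h2 := sq_dist_le hu st.dist_right
      rw [st.sq_right] at h2
      have h3 := st.coord_sub_lt hu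
      rw [st.coord_center.2, sub_zero] at h3
      refine le_max_of_le_right (le_min (le_max_of_le_right ?_) (le_min ?_ ?_))
      · exact sub_nonneg.1 (st.nonneg_of_two_mul h1)
      · linarith [le_abs_self (coord n u)]
      · exact sub_nonneg.1 (st.nonneg_of_two_mul h2)
  -- `T(A)` is above the first descending line, the level `h` and the middle bisector. `T(B)` is
  -- above the last descending line, hence above the first, which is parallel to it and not higher.
  · intro u hu
    rw [st.ball_union] at hu
    rw [lowered, sub_le_iff_le_add, ← coord_add, ← coord_add]
    rcases hu with hu | hu
    · have hu' : u + 2 * l ∈ Metric.ball (-(e * c) + 2 * l) ‖c‖ := by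
        rw [Metric.mem_ball, dist_add_right]; exact hu
      have h1 := sq_dist_le hu' (st.dist_left.trans_eq (dist_comm _ _))
      rw [← neg_sub, st.sq_left, ← mul_neg, neg_sub] at h1
      have h2 := sq_dist_le hu' st.dist_mid
      rw [← neg_sub, st.sq_mid, ← mul_neg, neg_sub] at h2
      have h3 := st.coord_sub_lt hu'
      rw [coord_add _ (-_), coord_neg, st.coord_center.2, st.coord_two_mul.2] at h3
      have h3 := neg_abs_le (coord n (u + 2 * l) - (-0 + H))
      refine max_le (sub_nonneg.1 (st.nonneg_of_two_mul h1))
        ((min_le_left _ _).trans (max_le ?_ (sub_nonneg.1 (st.nonneg_of_two_mul h2))))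
      linarith
    · have hu' : u + 2 * l ∈ Metric.ball (e * c + 2 * l) ‖c‖ := by
        rw [Metric.mem_ball, dist_add_right]; exact hu
      have h1 := sq_dist_le hu' (st.dist_right.trans_eq (dist_comm _ _))
      rw [← neg_sub, st.sq_right, ← mul_neg, neg_sub] at h1
      have h2 := sub_nonneg.1 (st.nonneg_of_two_mul h1)
      refine max_le (by linarith) (le_trans ?_ h2)
      exact (min_le_right _ _).trans (min_le_right _ _)

/-- The half turn about `l` exchanges `B` with `T(A)` and so preserves the middle bisector. It moves
the point of height `apexHeight` over `0` to the point of height `H - apexHeight` over `x`; both lie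
on the bisector. -/
lemma slope_mul : (2 * ‖c‖ - x) / H * x = H - 2 * apexHeight ‖c‖ x H := by
  have hH := st.H_pos
  have ha := st.two_mul_H_mul_apex
  field_simp
  linarith

lemma left_mem : -(e * c) + l ∈ graphLine d n (apexHeight ‖c‖ x H) (-(x / H)) := by
  rw [← st.bisector_left, bisector, Set.mem_ofPred_eq, dist_eq_norm, dist_eq_norm, ← norm_neg]
  congr 1; ring

lemma right_mem :
    e * c + l ∈ graphLine d n (apexHeight ‖c‖ x H + x / H * (2 * ‖c‖)) (-(x / H)) := by
  rw [← st.bisector_right, bisector, Set.mem_ofPred_eq, dist_eq_norm, dist_eq_norm, ← norm_neg]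
  congr 1; ring

lemma mid_slope_nonneg : 0 ≤ (2 * ‖c‖ - x) / H :=
  div_nonneg (by linarith [st.le_two]) st.H_pos.le

theorem fiveArcConfiguration (hlt : H < 2 * ‖c‖) : FiveArcConfiguration l c e n := by
  have hH := st.H_pos
  have hR := st.R_pos
  have hab := abs_le.1 st.dev_le
  have hx : 0 < x := by linarith
  have hx' : 0 < 2 * ‖c‖ - x := by linarith
  have hs : 0 < x / H := div_pos hx hH
  have ht : 0 < (2 * ‖c‖ - x) / H := div_pos hx' hH
  have hst := st.slope_mul
  have hst' : x / H * (2 * ‖c‖ - x) = H - 2 * apexHeight ‖c‖ x H := by rw [← hst]; ring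
  have ha := st.apex_le
  have ha' := st.apex_pos
  have hHc : (2 * l * (starRingEnd ℂ) n).re = H := st.coord_two_mul.2
  have hl := st.left_mem
  have hr := st.right_mem
  have cl : coord d (-(e * c) + l) = x / 2 - ‖c‖ ∧ coord n (-(e * c) + l) = H / 2 := by
    simp only [coord_add, coord_neg, st.coord_center, st.coord_l]
    constructor <;> ring
  have cr : coord d (e * c + l) = x / 2 + ‖c‖ ∧ coord n (e * c + l) = H / 2 := by
    simp only [coord_add, st.coord_center, st.coord_l]
    constructor <;> ring
  unfold FiveArcConfiguration
  simp only [hHc, st.bisector_left, st.bisector_mid, st.bisector_right, levelLine_eq_graphLine d]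
  refine ⟨by linarith, by linarith, apexHeight ‖c‖ x H, ha', ha, ?_, ?_⟩
  · have e1 := st.frame.coord_frame_left 0 (apexHeight ‖c‖ x H)
    have e2 := st.frame.coord_frame_right 0 (apexHeight ‖c‖ x H)
    simp only [Complex.ofReal_zero, zero_mul, zero_add] at e1 e2
    refine graphLine_inter st.frame (by linarith) ?_ ?_ <;> rw [mem_graphLine, e1, e2] <;> ring
  · intro h h' h1 h2 h3 h4
    have hcfg := st.areSchottkyCurves_zig (h := h) (h' := h') (by linarith) h2 h3
    generalize apexHeight ‖c‖ x H = a at *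
    generalize hs' : x / H = s at *
    generalize ht' : (2 * ‖c‖ - x) / H = t at *
    have key (α β y : ℝ) (hβ : β ≠ 0) : ∃ u : ℂ, u ∈ graphLine d n α β ∧ coord n u = y ∧
        coord d u = (y - α) / β := by
      refine ⟨(((y - α) / β : ℝ) : ℂ) * d + (y : ℂ) * n, ?_, st.frame.coord_frame_right _ _,
        st.frame.coord_frame_left _ _⟩
      rw [mem_graphLine, st.frame.coord_frame_left, st.frame.coord_frame_right]
      field_simp
      ring
    obtain ⟨u₁, hu₁, hu₁', hx₁⟩ := key a (-s) h (by linarith)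
    obtain ⟨u₂, hu₂, hu₂', hx₂⟩ := key a t h ht.ne'
    obtain ⟨u₃, hu₃, hu₃', hx₃⟩ := key a t h' ht.ne'
    obtain ⟨u₄, hu₄, hu₄', hx₄⟩ := key (a + s * (2 * ‖c‖)) (-s) h' (by linarith)
    have l1 : u₁ ∈ graphLine d n h 0 := by rw [mem_graphLine, hu₁']; ring
    have l2 : u₂ ∈ graphLine d n h 0 := by rw [mem_graphLine, hu₂']; ring
    have l3 : u₃ ∈ graphLine d n h' 0 := by rw [mem_graphLine, hu₃']; ring
    have l4 : u₄ ∈ graphLine d n h' 0 := by rw [mem_graphLine, hu₄']; ring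
    refine ⟨u₁, u₂, u₃, u₄, graphLine_inter st.frame (by linarith) hu₁ l1,
      graphLine_inter st.frame (by linarith) l2 hu₂, graphLine_inter st.frame (by linarith) hu₃ l3,
      graphLine_inter st.frame (by linarith) l4 hu₄, ?_⟩
    -- Order of the corners: `u₁`, `u₂` lie on either side of the coordinate `0`, and `u₃`, `u₄` on
    -- either side of `x`. The midpoints have height `H / 2`, strictly between `h` and `h'` because
    -- `H < 2 * ‖c‖`.
    rw [fiveArcCurve_eq_graphCurve st.frame hs.le ht.le (w := 2 * ‖c‖) (by linarith)
      (by linarith) hl hu₁ hu₁' hu₂ hu₂' hu₃ hu₃' hu₄ hu₄' hr]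
    · exact hcfg
    · rw [mem_graphLine] at hl hu₁
      rw [hu₁'] at hu₁
      rw [cl.2] at hl
      by_contra hc
      rw [not_lt] at hc
      nlinarith
    · rw [hx₁, hx₂, div_neg, ← neg_div, neg_sub]
      exact (div_nonpos_of_nonpos_of_nonneg (by linarith) hs.le).trans
        (div_nonneg (by linarith) ht.le)
    · rw [hx₂, hx₃, div_le_div_iff_of_pos_right ht]
      linarith
    · trans x
      · rw [hx₃, div_le_iff₀ ht]
        linarith
      · rw [hx₄, div_neg, ← neg_div, le_div_iff₀ hs]
        linarith
    · rw [mem_graphLine] at hr hu₄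
      rw [hu₄'] at hu₄
      rw [cr.2] at hr
      by_contra hc
      rw [not_lt] at hc
      nlinarith

lemma two_norm : 2 * ‖c‖ ≤ ‖2 * l‖ := by
  have := st.dist_left
  rwa [dist_self_add_right] at this

lemma le_norm_l : ‖c‖ ≤ ‖l‖ := by
  have := st.two_norm
  rw [norm_mul, Complex.norm_ofNat] at this
  linarith

/-- The hypothesis says `‖2 * l‖ = 2 * ‖c‖`, so `A` touches `T(A)` and `B` touches `T(B)`, and the
tangents there are the outer bisectors. The curve is the zigzag whose levels pass through the two
points where the middle bisector meets them. -/
theorem threeArcConfiguration (heq : x ^ 2 + H ^ 2 = 4 * ‖c‖ ^ 2) :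
    ThreeArcConfiguration l c e (bisector (-(e * c) + 2 * l) (e * c)) := by
  have hH := st.H_pos
  have hR := st.R_pos
  have hab := abs_le.1 st.dev_le
  have hx := st.nonneg
  have hs : 0 ≤ x / H := div_nonneg hx hH.le
  have ht := st.mid_slope_nonneg
  have hst := st.slope_mul
  have hst' : x / H * (2 * ‖c‖ - x) = H - 2 * apexHeight ‖c‖ x H := by rw [← hst]; ring
  have ha := st.apex_le
  have ha' := st.apex_pos
  have hle := st.height_le
  have hl := st.left_mem
  have hr := st.right_mem
  have hx2 : x < 2 * ‖c‖ := by nlinarith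
  have hslope : -(x / H) ≠ (2 * ‖c‖ - x) / H := by
    have : 0 < (2 * ‖c‖ - x) / H := div_pos (by linarith) hH
    linarith
  have hnorm : ‖2 * l‖ = 2 * ‖c‖ := by
    rw [← sq_eq_sq₀ (norm_nonneg _) (by positivity), st.frame.sq_norm, st.coord_two_mul.1,
      st.coord_two_mul.2]
    linarith
  have cl : coord d (-(e * c) + l) = x / 2 - ‖c‖ ∧ coord n (-(e * c) + l) = H / 2 := by
    simp only [coord_add, coord_neg, st.coord_center, st.coord_l]
    constructor <;> ring
  have cr : coord d (e * c + l) = x / 2 + ‖c‖ ∧ coord n (e * c + l) = H / 2 := by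
    simp only [coord_add, st.coord_center, st.coord_l]
    constructor <;> ring
  have t1 : tangentLine (-(e * c)) (-(e * c) + l) = bisector (-(e * c)) (-(e * c) + 2 * l) := by
    rw [bisector_comm, ← tangentLine_eq_bisector]; congr 1; ring
  have t2 : tangentLine (e * c) (e * c + l) = bisector (e * c) (e * c + 2 * l) := by
    rw [bisector_comm, ← tangentLine_eq_bisector]; congr 1; ring
  have hnc : ‖c‖ ≤ ‖l - c‖ ∧ ‖c‖ ≤ ‖l + c‖ := by
    have h1 : ‖c‖ ≤ ‖l - e * c‖ := by
      have := st.dist_mid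
      rw [dist_eq_norm, show -(e * c) + 2 * l - e * c = 2 * (l - e * c) by ring, norm_mul,
        Complex.norm_ofNat] at this
      linarith
    -- The remaining pair, `A` and `T(B)`, is separated because `T` shifts by `x ≥ 0` in the
    -- direction from `A` to `B`.
    have h2 : ‖c‖ ≤ ‖l + e * c‖ := by
      apply (sq_le_sq₀ (by positivity) (norm_nonneg _)).1
      rw [st.frame.sq_norm (l + e * c)]
      simp only [coord_add, st.coord_center, st.coord_l]
      nlinarith
    rcases st.sign with rfl | rfl
    · simp only [Complex.ofReal_one, one_mul] at h1 h2
      exact ⟨h1, h2⟩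
    · simp only [Complex.ofReal_neg, Complex.ofReal_one, neg_mul, one_mul, sub_neg_eq_add,
        ← sub_eq_add_neg] at h1 h2
      exact ⟨h2, h1⟩
  refine ⟨areSchottkyCurves_conj st.re_eq st.le_norm_l hnc.1 hnc.2, ?_⟩
  obtain ⟨v₁, hv₁, hv₁'⟩ : ∃ v : ℂ, coord d v = 0 ∧ coord n v = apexHeight ‖c‖ x H :=
    ⟨_, st.frame.coord_frame_left _ _, st.frame.coord_frame_right _ _⟩
  obtain ⟨v₂, hv₂, hv₂'⟩ : ∃ v : ℂ, coord d v = x ∧ coord n v = H - apexHeight ‖c‖ x H :=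
    ⟨_, st.frame.coord_frame_left _ _, st.frame.coord_frame_right _ _⟩
  have i1 : v₁ ∈ graphLine d n (apexHeight ‖c‖ x H) (-(x / H)) := by
    rw [mem_graphLine, hv₁, hv₁']; ring
  have i2 : v₁ ∈ graphLine d n (apexHeight ‖c‖ x H) ((2 * ‖c‖ - x) / H) := by
    rw [mem_graphLine, hv₁, hv₁']; ring
  have i3 : v₂ ∈ graphLine d n (apexHeight ‖c‖ x H) ((2 * ‖c‖ - x) / H) := by
    rw [mem_graphLine, hv₂, hv₂']; linarith
  have i4 : v₂ ∈ graphLine d n (apexHeight ‖c‖ x H + x / H * (2 * ‖c‖)) (-(x / H)) := by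
    rw [mem_graphLine, hv₂, hv₂']; linarith
  refine ⟨-(e * c) + l, e * c + l, v₁, v₂, ?_, ?_, ?_, ?_, ?_⟩
  · rw [mob_T_circleCurve, circleCurve_inter_eq]
    · congr 2; ring
    · rw [← hnorm, ← norm_neg]; congr 1; ring
  · rw [mob_T_circleCurve, circleCurve_inter_eq]
    · congr 2; ring
    · rw [← hnorm, ← norm_neg]; congr 1; ring
  · rw [t1, st.bisector_left, st.bisector_mid]
    exact graphLine_inter st.frame hslope i1 i2
  · rw [t2, st.bisector_right, st.bisector_mid]
    exact graphLine_inter st.frame hslope.symm i3 i4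
  · rw [threeArcCurve_eq_fiveArcCurve, fiveArcCurve_eq_graphCurve st.frame hs ht (w := 2 * ‖c‖)
      (by linarith) (h := apexHeight ‖c‖ x H) (h' := H - apexHeight ‖c‖ x H) (by linarith)
      hl i1 hv₁' i2 hv₁' i3 hv₂' i4 hv₂' hr]
    · exact st.areSchottkyCurves_zig (by linarith) ha (by linarith)
    · rw [cl.1, hv₁]; linarith
    · exact le_rfl
    · rw [hv₁, hv₂]; exact hx
    · exact le_rfl
    · rw [cr.1, hv₂]; linarith

end IsStacked

/-! ### The region of the non-classical family -/

/-- Cosine decreases on `[0, π]`, so the angle is compared with `π / 3` by comparing `X / ‖z‖` with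
`1 / 2`, and then by squaring. -/
lemma pi_div_three_iff {X Y : ℝ} (hX : 0 ≤ X) (hY : 0 ≤ Y) (hz : (⟨X, Y⟩ : ℂ) ≠ 0) :
    (Real.pi / 3 ≤ (⟨X, Y⟩ : ℂ).arg ↔ √3 * X ≤ Y) ∧
    ((⟨X, Y⟩ : ℂ).arg ≤ Real.pi / 3 ↔ Y ≤ √3 * X) := by
  set z : ℂ := ⟨X, Y⟩ with hzd
  have h0 : 0 ≤ z.arg := Complex.arg_nonneg_iff.2 hY
  have hπ := Complex.arg_le_pi z
  have hcos := Complex.cos_arg hz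
  have hzX : z.re = X := rfl
  have hn : 0 < ‖z‖ := norm_pos_iff.2 hz
  have hsq : ‖z‖ ^ 2 = X ^ 2 + Y ^ 2 := norm_sq_eq z
  have h3 : (√3 : ℝ) ^ 2 = 3 := Real.sq_sqrt (by norm_num)
  have h3' : 0 ≤ √3 := Real.sqrt_nonneg 3
  have m1 : Real.pi / 3 ∈ Set.Icc 0 Real.pi := ⟨by positivity, by linarith [Real.pi_pos]⟩
  have m2 : z.arg ∈ Set.Icc 0 Real.pi := ⟨h0, hπ⟩
  constructor
  · rw [← Real.strictAntiOn_cos.le_iff_ge m2 m1, hcos, Real.cos_pi_div_three, hzX,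
      div_le_div_iff₀ hn two_pos, ← sq_le_sq₀ (by positivity) (by positivity),
      ← sq_le_sq₀ (by positivity) hY, mul_pow, mul_pow, mul_pow, hsq, h3]
    constructor <;> intro h <;> linarith
  · rw [← Real.strictAntiOn_cos.le_iff_ge m1 m2, hcos, Real.cos_pi_div_three, hzX,
      div_le_div_iff₀ two_pos hn, ← sq_le_sq₀ (by positivity) (by positivity),
      ← sq_le_sq₀ hY (by positivity), mul_pow, mul_pow, mul_pow, hsq, h3]
    constructor <;> intro h <;> linarith

lemma norm_abs (l : ℂ) : ‖(⟨|l.re|, |l.im|⟩ : ℂ)‖ = ‖l‖ := by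
  rw [← sq_eq_sq₀ (norm_nonneg _) (norm_nonneg _), norm_sq_eq, norm_sq_eq]
  simp

lemma mk_abs_ne_zero {l : ℂ} (hl : l ≠ 0) : (⟨|l.re|, |l.im|⟩ : ℂ) ≠ 0 := by
  rw [← norm_ne_zero_iff, norm_abs, norm_ne_zero_iff]
  exact hl

lemma k_line_iff (X Y : ℝ) : -(√3 * X / 3) + 2 * √3 / 3 ≤ Y ↔ 2 ≤ X + √3 * Y := by
  have h3 : (√3 : ℝ) ^ 2 = 3 := Real.sq_sqrt (by norm_num)
  have h3' : 0 < √3 := Real.sqrt_pos.2 (by norm_num)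
  have e : √3 * (Y - (-(√3 * X / 3) + 2 * √3 / 3)) = X + √3 * Y - 2 := by
    linear_combination (X / 3 - 2 / 3) * h3
  rw [← sub_nonneg, ← mul_nonneg_iff_of_pos_left h3', e, sub_nonneg]

lemma mem_ncf_iff (l : ℂ) : l ∈ ncf ↔ |l.im| < 1 - l.re ^ 2 / 4 ∧
    ((1 ≤ ‖l‖ ∧ √3 * |l.re| ≤ |l.im|) ∨ (2 ≤ |l.re| + √3 * |l.im| ∧ |l.im| ≤ √3 * |l.re|)) := by
  have hX := abs_nonneg l.re
  have hY := abs_nonneg l.im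
  have h2 : (⟨|l.re|, |l.im|⟩ : ℂ).arg ≤ Real.pi / 2 :=
    (abs_le.1 (Complex.abs_arg_le_pi_div_two_iff.2 hX)).2
  have h0 : 0 ≤ (⟨|l.re|, |l.im|⟩ : ℂ).arg := Complex.arg_nonneg_iff.2 hY
  simp only [ncf, symmetrized, ncfA₁, ncfA₂, Set.mem_ofPred_eq, Set.mem_union, norm_abs, abs_abs,
    sq_abs, k_line_iff]
  rw [← and_or_left]
  refine and_congr_right fun _ => ?_
  rcases eq_or_ne l 0 with rfl | hl
  · norm_num
  · have := pi_div_three_iff hX hY (mk_abs_ne_zero hl)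
    rw [this.1, this.2]
    tauto

/-- Cauchy–Schwarz with the vector `(1, √3)`. The `K`-line is tangent to the unit circle, so points
on or above it have norm at least `1`. -/
lemma abs_add_sqrt_three_le (l : ℂ) : |l.re| + √3 * |l.im| ≤ 2 * ‖l‖ := by
  have h3 : (√3 : ℝ) ^ 2 = 3 := Real.sq_sqrt (by norm_num)
  apply abs_le_of_sq_le_sq' _ (by positivity) |>.2
  rw [mul_pow, norm_sq_eq, ← sq_abs l.re, ← sq_abs l.im]
  nlinarith [sq_nonneg (√3 * |l.re| - |l.im|)]

lemma mem_interior_ncf_iff (l : ℂ) : l ∈ interior ncf ↔ |l.im| < 1 - l.re ^ 2 / 4 ∧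
    (2 < |l.re| + √3 * |l.im| ∨ (1 < ‖l‖ ∧ √3 * |l.re| < |l.im|)) := by
  have h3 : (√3 : ℝ) ^ 2 = 3 := Real.sq_sqrt (by norm_num)
  have h3' : 0 < √3 := Real.sqrt_pos.2 (by norm_num)
  constructor
  · intro hl
    refine ⟨((mem_ncf_iff l).1 (interior_subset hl)).1, ?_⟩
    -- An interior point stays in the region after shrinking by some `t < 1`; the lower bounds are
    -- homogeneous of degree one, so they are strict at the original point.
    have hc : Filter.Tendsto (fun t : ℝ => (t : ℂ) * l) (nhds 1) (nhds l) := by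
      have : Continuous fun t : ℝ => (t : ℂ) * l := by fun_prop
      simpa using this.tendsto 1
    have ev := (hc.eventually (isOpen_interior.mem_nhds hl)).and (lt_mem_nhds (one_pos (α := ℝ)))
    obtain ⟨t, ⟨ht, ht0⟩, ht1⟩ := ((ev.filter_mono nhdsWithin_le_nhds).and
      (self_mem_nhdsWithin : Set.Iio (1 : ℝ) ∈ nhdsWithin 1 (Set.Iio 1))).exists
    have ht1 : t < 1 := ht1
    have hm := ((mem_ncf_iff _).1 (interior_subset ht)).2
    have e1 : ((t : ℂ) * l).re = t * l.re := by simp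
    have e2 : ((t : ℂ) * l).im = t * l.im := by simp
    rw [e1, e2, norm_mul, Complex.norm_real, abs_mul, abs_mul, Real.norm_eq_abs,
      abs_of_pos ht0] at hm
    rcases hm with ⟨h1, h2⟩ | ⟨h1, h2⟩
    · have hlt : 1 < ‖l‖ := by nlinarith [norm_nonneg l]
      have h2 : √3 * |l.re| ≤ |l.im| := by
        apply le_of_mul_le_mul_left _ ht0
        linarith
      rcases h2.lt_or_eq with h2 | h2
      · exact Or.inr ⟨hlt, h2⟩
      -- On the ray of angle `π / 3`, where the two pieces are glued, `‖l‖ = 2 * |l.re|`, so `1 <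
      -- ‖l‖` puts `l` strictly above the `K`-line.
      · left
        have hn := norm_sq_eq l
        rw [← sq_abs l.re, ← sq_abs l.im, ← h2, mul_pow, h3] at hn
        have : 1 / 2 < |l.re| := by
          by_contra hcon
          rw [not_lt] at hcon
          nlinarith [abs_nonneg l.re]
        rw [← h2]
        nlinarith
    · left
      have : 0 ≤ |l.re| + √3 * |l.im| := by positivity
      nlinarith
  · intro hl
    have o1 : IsOpen {l : ℂ | |l.im| < 1 - l.re ^ 2 / 4} := isOpen_lt (by fun_prop) (by fun_prop)
    have o2 : IsOpen {l : ℂ | 2 < |l.re| + √3 * |l.im|} := isOpen_lt (by fun_prop) (by fun_prop)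
    have o3 : IsOpen {l : ℂ | 1 < ‖l‖} := isOpen_lt (by fun_prop) (by fun_prop)
    have o4 : IsOpen {l : ℂ | √3 * |l.re| < |l.im|} := isOpen_lt (by fun_prop) (by fun_prop)
    have hopen := o1.inter (o2.union (o3.inter o4))
    refine interior_maximal ?_ hopen hl
    intro l hl
    obtain ⟨h1, h2⟩ := hl
    refine (mem_ncf_iff l).2 ⟨h1, ?_⟩
    rcases h2 with h2 | ⟨h2, h4⟩
    · rcases le_total |l.im| (√3 * |l.re|) with h | h
      · exact Or.inr ⟨h2.le, h⟩
      · have h2 : 2 < |l.re| + √3 * |l.im| := h2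
        refine Or.inl ⟨?_, h⟩
        linarith [abs_add_sqrt_three_le l]
    · exact Or.inl ⟨h2.le, h4.le⟩

lemma mem_kSegment_symm {l : ℂ} (hl : l ∈ symmetrized kSegment) :
    |l.re| + √3 * |l.im| = 2 ∧ |l.im| ≤ √3 := by
  have h3 : (√3 : ℝ) ^ 2 = 3 := Real.sq_sqrt (by norm_num)
  have h3' : 0 < √3 := Real.sqrt_pos.2 (by norm_num)
  obtain ⟨a, b, ha, hb, hab, h⟩ := hl
  have h1 := congrArg Complex.re h
  have h2 := congrArg Complex.im h
  simp only [Complex.real_smul, Complex.add_re, Complex.re_ofReal_mul, Complex.re_ofNat] at h1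
  simp only [Complex.real_smul, Complex.add_im, Complex.im_ofReal_mul, Complex.im_ofNat] at h2
  rw [← h1, ← h2]
  constructor
  · linear_combination a / 2 * h3 + 2 * hab
  · nlinarith

/-! ### Existence of stacked circles -/

lemma sign_mul_self {e : ℝ} (he : e = 1 ∨ e = -1) : e * e = 1 := by
  rcases he with rfl | rfl <;> norm_num

lemma sign_abs {e : ℝ} (he : e = 1 ∨ e = -1) : |e| = 1 := by
  rcases he with rfl | rfl <;> norm_num

lemma isFrame_div {c n : ℂ} {e : ℝ} (hc : c.re = 1) (hn : ‖n‖ = 1)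
    (hnc : (n * (starRingEnd ℂ) c).re = 0) (he : e = 1 ∨ e = -1) :
    IsFrame ((e / ‖c‖ : ℝ) * c) n where
  norm_left := by
    rw [norm_mul, Complex.norm_real, Real.norm_eq_abs, abs_div, sign_abs he, abs_norm]
    have := norm_pos_of_re_eq_one hc
    field_simp
  norm_right := hn
  coord_left := by
    have : coord c n = 0 := hnc
    rw [coord_eq] at this ⊢
    simp only [Complex.re_ofReal_mul, Complex.im_ofReal_mul]
    linear_combination (e / ‖c‖) * this

/-- Taking `x = ‖c‖` puts the center of `T(A)` on the bisector `P` at height `H`. Both separation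
conditions become `‖c‖ ^ 2 + H ^ 2 ≥ 4 * ‖c‖ ^ 2`, which is where `√3` comes from. -/
theorem isStacked_of_apex {l c n : ℂ} {e H : ℝ} (hc : c.re = 1) (hn : ‖n‖ = 1)
    (hnc : (n * (starRingEnd ℂ) c).re = 0) (he : e = 1 ∨ e = -1)
    (hl : 2 * l = H * n + e * c) (h₁ : √3 * ‖c‖ ≤ H) (h₂ : H ≤ 2 * ‖c‖) :
    IsStacked l c e ((e / ‖c‖ : ℝ) * c) n ‖c‖ H := by
  have hR := norm_pos_of_re_eq_one hc
  have h3 : (√3 : ℝ) ^ 2 = 3 := Real.sq_sqrt (by norm_num)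
  have h3' : 1 < √3 := by
    rw [Real.lt_sqrt] <;> norm_num
  have hsq : 3 * ‖c‖ ^ 2 ≤ H ^ 2 := by
    have := pow_le_pow_left₀ (by positivity) h₁ 2
    rwa [mul_pow, h3] at this
  have hd : (e : ℂ) * c = (‖c‖ : ℝ) * (((e / ‖c‖ : ℝ) : ℂ) * c) := by
    rw [← mul_assoc, ← Complex.ofReal_mul]
    congr 2
    field_simp
  exact
    { frame := isFrame_div hc hn hnc he
      re_eq := hc
      sign := he
      center := hd
      two_mul := by rw [hl, ← hd]; ring
      lt_height := by nlinarith
      height_le := h₂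
      nonneg := hR.le
      dev_le := by rw [sub_self, abs_zero]; nlinarith
      sep₁ := by linarith
      sep₂ := by nlinarith }

/-- Circles for which the center of `T(A)` lies on the bisector of the centers of `A`, `B`. -/
theorem exists_apex {l : ℂ} {e : ℝ} (he : e = 1 ∨ e = -1) (hel : 0 ≤ e * l.re)
    (hk : 2 ≤ |l.re| + √3 * |l.im|) :
    ∃ (c n : ℂ) (H : ℝ), c.re = 1 ∧ ‖n‖ = 1 ∧ (n * (starRingEnd ℂ) c).re = 0 ∧
      2 * l = H * n + e * c ∧ √3 * ‖c‖ ≤ H ∧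
      (|l.re| + √3 * |l.im| = 2 → |l.im| ≤ √3 → H = √3 * ‖c‖) ∧
      (|l.im| < 1 - l.re ^ 2 / 4 → H < 2 * ‖c‖) := by
  have h3 : (√3 : ℝ) ^ 2 = 3 := Real.sq_sqrt (by norm_num)
  have hee := sign_mul_self he
  have hX : |l.re| = e * l.re := by
    rw [← abs_of_nonneg hel, abs_mul, sign_abs he, one_mul]
  obtain ⟨σ, hσ, hY⟩ : ∃ σ : ℝ, (σ = 1 ∨ σ = -1) ∧ |l.im| = σ * (e * l.im) := by
    rcases abs_cases l.im with h | h
    · exact ⟨e, he, by linear_combination h.1 - l.im * hee⟩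
    · refine ⟨-e, ?_, by linear_combination h.1 + l.im * hee⟩
      rcases he with rfl | rfl
      · exact Or.inr rfl
      · exact Or.inl (neg_neg 1)
  have hσσ := sign_mul_self hσ
  set X := |l.re| with hXd
  set Y := |l.im| with hYd
  have hY0 : 0 ≤ Y := abs_nonneg _
  -- Expanding shows that this is the condition `2 ≤ X + √3 Y`; it yields `√3 ≤ Y + q`, and `Y + q`
  -- is the ratio `H / ‖c‖`.
  have hD : (√3 - Y) ^ 2 ≤ Y ^ 2 + 2 * X - 1 := by nlinarith
  have hD0 : 0 ≤ Y ^ 2 + 2 * X - 1 := (sq_nonneg _).trans hD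
  -- With `c = 1 + iσ(Y - q)` and `H = (Y + q) ‖c‖`, the equation `2 l = H n + e c` reads `(1 + iσ(Y
  -- - q)) (1 + iσ(Y + q)) = 2 (X + iσY)`. Its real part determines `q ^ 2`.
  set q := √(Y ^ 2 + 2 * X - 1) with hq
  have hqq : q ^ 2 = Y ^ 2 + 2 * X - 1 := Real.sq_sqrt hD0
  have hq0 : 0 ≤ q := Real.sqrt_nonneg _
  have hq1 : √3 - Y ≤ q := Real.le_sqrt_of_sq_le hD
  set c : ℂ := ⟨1, σ * (Y - q)⟩ with hcd
  have hc : c.re = 1 := rfl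
  have hR := norm_pos_of_re_eq_one hc
  have hRC : ((‖c‖ : ℝ) : ℂ) ≠ 0 := by exact_mod_cast hR.ne'
  refine ⟨c, ((σ * e / ‖c‖ : ℝ) : ℂ) * (Complex.I * c), (Y + q) * ‖c‖, hc, ?_, ?_, ?_, ?_, ?_, ?_⟩
  · rw [norm_mul, norm_mul, Complex.norm_I, Complex.norm_real, Real.norm_eq_abs, abs_div, abs_mul,
      sign_abs he, sign_abs hσ, abs_norm]
    field_simp
  · simp only [Complex.mul_re, Complex.mul_im, Complex.conj_re, Complex.conj_im, Complex.I_re,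
      Complex.I_im, Complex.ofReal_re, Complex.ofReal_im]
    ring
  · have e1 : (((Y + q) * ‖c‖ : ℝ) : ℂ) * (((σ * e / ‖c‖ : ℝ) : ℂ) * (Complex.I * c)) =
        (((Y + q) * σ * e : ℝ) : ℂ) * (Complex.I * c) := by
      push_cast
      field_simp
    rw [e1]
    apply Complex.ext
    · simp [hcd]
      linear_combination (-2 * l.re) * hee - 2 * e * hX - e * hqq +
        (e * (Y ^ 2 - q ^ 2)) * hσσ
    · simp [hcd]
      linear_combination (-2 * l.im) * hee * 1 - 2 * l.im * hσσ * e ^ 2 - 2 * e * σ * hY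
  · nlinarith
  · intro h1 h2
    have : q = √3 - Y := by
      rw [hq, ← Real.sqrt_sq (sub_nonneg.2 h2)]
      congr 1
      nlinarith
    rw [this]; ring
  · intro h1
    have hX2 : l.re ^ 2 = X ^ 2 := (sq_abs _).symm
    rw [hX2] at h1
    have hY2 : Y < 2 := by nlinarith [sq_nonneg X]
    -- This amounts to `4 Y < 5 - 2 X`, a line tangent to the parabola from above at `X = 1`.
    have : q < 2 - Y := by
      rw [hq, Real.sqrt_lt' (by linarith)]
      nlinarith [sq_nonneg (X - 1)]
    nlinarith

/-- Stacked circles of radius `1`. -/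
theorem exists_isStacked_one {l : ℂ} {e : ℝ} (he : e = 1 ∨ e = -1) (hel : 0 ≤ e * l.re)
    (h₁ : √3 * |l.re| ≤ |l.im|) (h₂ : 1 ≤ ‖l‖) (h₃ : |l.im| ≤ 1) (h₄ : |l.re| ≤ 1 / 2) :
    ∃ n : ℂ, ‖n‖ = 1 ∧ (n * (starRingEnd ℂ) (1 : ℂ)).re = 0 ∧
      IsStacked l 1 e e n (2 * |l.re|) (2 * |l.im|) := by
  have h3' : 1 < √3 := by
    rw [Real.lt_sqrt] <;> norm_num
  have hee := sign_mul_self he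
  have hX : |l.re| = e * l.re := by
    rw [← abs_of_nonneg hel, abs_mul, sign_abs he, one_mul]
  obtain ⟨σ, hσ, hY⟩ : ∃ σ : ℝ, (σ = 1 ∨ σ = -1) ∧ |l.im| = σ * l.im := by
    rcases abs_cases l.im with h | h
    · exact ⟨1, Or.inl rfl, by linarith [h.1]⟩
    · exact ⟨-1, Or.inr rfl, by linarith [h.1]⟩
  have hσσ := sign_mul_self hσ
  have hsq : 1 ≤ |l.re| ^ 2 + |l.im| ^ 2 := by
    rw [sq_abs, sq_abs, ← norm_sq_eq]
    nlinarith
  have hX0 := abs_nonneg l.re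
  have hY0 := abs_nonneg l.im
  have hXY : |l.re| ≤ |l.im| := by nlinarith
  have hn : ‖(σ : ℂ) * Complex.I‖ = 1 := by
    rw [norm_mul, Complex.norm_I, Complex.norm_real, Real.norm_eq_abs, sign_abs hσ, mul_one]
  refine ⟨σ * Complex.I, hn, by simp, ?_⟩
  exact
    { frame := ⟨by rw [Complex.norm_real, Real.norm_eq_abs, sign_abs he], hn, by simp [coord]⟩
      re_eq := rfl
      sign := he
      center := by simp
      two_mul := by
        apply Complex.ext
        · simp
          linear_combination (-2 * l.re) * hee - 2 * e * hX
        · simp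
          linear_combination (-2 * l.im) * hσσ - 2 * σ * hY
      lt_height := by rw [norm_one]; nlinarith
      height_le := by rw [norm_one]; linarith
      nonneg := by positivity
      -- This needs `|l.re| ≤ |l.im|` and `1 ≤ |l.re| + |l.im|`; the latter follows from `1 ≤ ‖l‖`.
      dev_le := by
        rw [norm_one, abs_le]
        constructor <;> nlinarith
      sep₁ := by rw [norm_one]; nlinarith
      sep₂ := by rw [norm_one]; nlinarith }

/-! ### The non-classical families -/

/-- On the `K`-line `exists_apex` gives `H = √3 ‖c‖`. The centers of `A`, `B`, `T(A)` then form an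
equilateral triangle of side `2 ‖c‖`, and the three circles touch each other. -/
theorem exists_threeArc_of_mem_kSegment {l : ℂ} (hl : l ∈ symmetrized kSegment) {e : ℝ}
    (he : e = 1 ∨ e = -1) (hel : 0 ≤ e * l.re) :
    ∃ c p : ℂ, c.re = 1 ∧
      circleCurve (e * c) ‖c‖ ∩ mob (T l) (circleCurve (-(e * c)) ‖c‖) = {(p : Sphere)} ∧
      tangentLine (e * c) p = tangentLine (-(e * c) + 2 * l) p ∧
      ThreeArcConfiguration l c e (tangentLine (e * c) p) := by
  have h3 : (√3 : ℝ) ^ 2 = 3 := Real.sq_sqrt (by norm_num)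
  have h3' : √3 ≤ 2 := by rw [Real.sqrt_le_left] <;> norm_num
  obtain ⟨hk, hk'⟩ := mem_kSegment_symm hl
  obtain ⟨c, n, H, hc, hn, hnc, h2l, hH, hH', -⟩ := exists_apex he hel hk.ge
  have hR := norm_pos_of_re_eq_one hc
  have hH := hH' hk hk'
  have st := isStacked_of_apex hc hn hnc he h2l hH.ge (by rw [hH]; nlinarith)
  have hHH : H ^ 2 = 3 * ‖c‖ ^ 2 := by rw [hH, mul_pow, h3]
  have hd : ‖e * c - (-(e * c) + 2 * l)‖ = 2 * ‖c‖ := by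
    rw [← sq_eq_sq₀ (norm_nonneg _) (by positivity), st.frame.sq_norm]
    simp only [coord_sub, coord_add, coord_neg, st.coord_center, st.coord_two_mul]
    linear_combination hHH
  refine ⟨c, (-(e * c) + 2 * l + e * c) / 2, hc, ?_, ?_, ?_⟩
  · rw [mob_T_circleCurve, circleCurve_inter_eq hd, add_comm (e * c : ℂ)]
  · rw [tangentLine_eq_bisector, bisector_comm, ← tangentLine_eq_bisector, add_comm (e * c : ℂ)]
  · rw [tangentLine_eq_bisector]
    exact st.threeArcConfiguration (by linarith)

lemma unitArc_symm {l : ℂ} (hl : l ∈ symmetrized unitArc) :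
    ‖l‖ = 1 ∧ √3 * |l.re| ≤ |l.im| ∧ |l.im| ≤ 1 ∧ |l.re| ≤ 1 / 2 := by
  obtain ⟨h1, h2, -⟩ := hl
  have h3 : (√3 : ℝ) ^ 2 = 3 := Real.sq_sqrt (by norm_num)
  have h3' : 0 < √3 := Real.sqrt_pos.2 (by norm_num)
  rw [norm_abs] at h1
  have hl0 : l ≠ 0 := by rintro rfl; simp at h1
  have hX0 := abs_nonneg l.re
  have hY0 := abs_nonneg l.im
  have h4 := (pi_div_three_iff hX0 hY0 (mk_abs_ne_zero hl0)).1.1 h2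
  have hsq := norm_sq_eq l
  rw [h1, ← sq_abs l.re, ← sq_abs l.im] at hsq
  have h5 := pow_le_pow_left₀ (by positivity) h4 2
  rw [mul_pow, h3] at h5
  refine ⟨h1, h4, ?_, ?_⟩
  · nlinarith
  · nlinarith

theorem threeArc_of_mem_unitArc {l : ℂ} (hl : l ∈ symmetrized unitArc) {e : ℝ}
    (he : e = 1 ∨ e = -1) (hel : 0 ≤ e * l.re) :
    (l ∉ symmetrized kSegment →
      Disjoint (circleCurve (e : ℂ) 1) (mob (T l) (circleCurve (-(e : ℂ)) 1))) ∧
    ThreeArcConfiguration l 1 e (bisector (-(e : ℂ) + 2 * l) e) := by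
  obtain ⟨h1, h2, h3, h4⟩ := unitArc_symm hl
  obtain ⟨n, -, -, st⟩ := exists_isStacked_one he hel h2 h1.ge h3 h4
  have hsq := norm_sq_eq l
  rw [h1, ← sq_abs l.re, ← sq_abs l.im] at hsq
  constructor
  · intro hk
    have hlt : |l.re| < 1 / 2 := by
      refine lt_of_le_of_ne h4 fun h => hk ?_
      have hY : |l.im| = √3 / 2 := by
        rw [← sq_eq_sq₀ (abs_nonneg _) (by positivity), div_pow, Real.sq_sqrt (by norm_num)]
        rw [h] at hsq
        linarith
      show (⟨|l.re|, |l.im|⟩ : ℂ) ∈ kSegment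
      rw [h, hY]
      exact left_mem_segment ℝ _ _
    rw [mob_T_circleCurve]
    apply disjoint_coe_image
    rw [Set.disjoint_left]
    intro z hz hz'
    have hd := dist_triangle_left (-(e : ℂ) + 2 * l) e z
    rw [Metric.mem_sphere] at hz hz'
    have h5 : dist (-(e : ℂ) + 2 * l) e ^ 2 ≤ 2 ^ 2 :=
      pow_le_pow_left₀ dist_nonneg (by linarith) 2
    have hX : |l.re| = e * l.re := by
      rw [← abs_of_nonneg hel, abs_mul, sign_abs he, one_mul]
    have hee := sign_mul_self he
    -- Outside the `K`-segments `|l.re| < 1 / 2`, so this exceeds `4` and the circles cannot meet.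
    have h6 : dist (-(e : ℂ) + 2 * l) e ^ 2 = 8 - 8 * |l.re| := by
      rw [dist_eq_norm, norm_sq_eq]
      simp
      rw [sq_abs, sq_abs] at hsq
      linear_combination -4 * hsq + 4 * hee + 8 * hX
    linarith
  · have := st.threeArcConfiguration (by rw [norm_one]; linarith)
    rwa [mul_one] at this

/-- Strictly above the `K`-line the circles of `exists_apex` serve. The other interior points have
angle beyond `π / 3` in their mirrored position and `|l.re| ≤ 1 / 2`, where unit circles serve. -/
theorem exists_fiveArc_of_mem_interior {l : ℂ} (hl : l ∈ interior ncf) {e : ℝ}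
    (he : e = 1 ∨ e = -1) (hel : 0 ≤ e * l.re) :
    ∃ c n : ℂ, c.re = 1 ∧ ‖n‖ = 1 ∧ (n * (starRingEnd ℂ) c).re = 0 ∧
      FiveArcConfiguration l c e n ∧
      (2 < |l.re| + √3 * |l.im| → ((-(e * c) + 2 * l) * (starRingEnd ℂ) c).re = 0) := by
  obtain ⟨h1, h2⟩ := (mem_interior_ncf_iff l).1 hl
  by_cases hk : 2 < |l.re| + √3 * |l.im|
  · obtain ⟨c, n, H, hc, hn, hnc, h2l, hH, -, hH'⟩ := exists_apex he hel hk.le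
    have st := isStacked_of_apex hc hn hnc he h2l hH (hH' h1).le
    refine ⟨c, n, hc, hn, hnc, st.fiveArcConfiguration (hH' h1), fun _ => ?_⟩
    rw [h2l, show -(e * c) + (H * n + e * c) = (H : ℂ) * n by ring]
    have : coord c (H * n) = H * coord c n := coord_real_mul _ _ _
    rw [show coord c n = 0 from hnc, mul_zero] at this
    exact this
  · obtain ⟨h3, h4⟩ := h2.resolve_left hk
    rw [not_lt] at hk
    have hs : (√3 : ℝ) ^ 2 = 3 := Real.sq_sqrt (by norm_num)
    have hs' : 0 < √3 := Real.sqrt_pos.2 (by norm_num)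
    have h5 : |l.im| < 1 := by nlinarith [sq_nonneg l.re]
    have h6 : |l.re| ≤ 1 / 2 := by nlinarith
    obtain ⟨n, hn, hn1, st⟩ := exists_isStacked_one he hel h4.le h3.le h5.le h6
    refine ⟨1, n, rfl, hn, hn1, st.fiveArcConfiguration ?_, fun h => absurd h hk.not_gt⟩
    rw [norm_one]; linarith

/-- Used with `s = Im c` and `η = ±H / ‖c‖`, where `2 l = e ((1 - η s) + i (s + η))`. The hypotheses
then say `√3 ‖c‖ < H` and that the mirrored angle is at most `π / 3`; the conclusion puts `l`
strictly above the `K`-line. -/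
lemma two_lt_of_apex {s η : ℝ} (hη : 3 < η ^ 2) (h : |s + η| ≤ √3 * |1 - η * s|) :
    4 < |1 - η * s| + √3 * |s + η| := by
  wlog hpos : 0 < η generalizing s η
  · have := this (s := -s) (η := -η) (by simpa using hη) (by
      rw [show -s + -η = -(s + η) by ring, abs_neg, neg_mul_neg]; exact h) (by
        rcases lt_trichotomy η 0 with h0 | h0 | h0
        · linarith
        · rw [h0] at hη; norm_num at hη
        · exact absurd h0 hpos)
    rwa [show -s + -η = -(s + η) by ring, abs_neg, neg_mul_neg] at this
  have hs : (√3 : ℝ) ^ 2 = 3 := Real.sq_sqrt (by norm_num)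
  have hs' : 0 < √3 := Real.sqrt_pos.2 (by norm_num)
  generalize (√3 : ℝ) = r at *
  have hrη : r < η := by
    by_contra hc
    rw [not_lt] at hc
    nlinarith
  have h3 : 3 < r * η := by nlinarith
  -- The signs of `s + η` and `1 - η s` decide the absolute values. In the first case `s < -η`, so
  -- already `1 - η s > 1 + η ^ 2 > 4`.
  rcases lt_or_ge (s + η) 0 with h1 | h1
  · have : 4 < 1 - η * s := by nlinarith
    have := le_abs_self (1 - η * s)
    have : 0 ≤ r * |s + η| := by positivity
    linarith
  rw [abs_of_nonneg h1] at h ⊢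
  rcases lt_or_ge (1 - η * s) 0 with h2 | h2
  · rw [abs_of_neg h2] at h ⊢
    have h4 : r + η ≤ s * (r * η - 1) := by linarith
    have h5 : 2 ≤ s * (r + η) := by
      by_contra hc
      rw [not_le] at hc
      nlinarith
    nlinarith
  · rw [abs_of_nonneg h2] at h ⊢
    have h4 : s * (1 + r * η) ≤ r - η := by linarith
    have h5 : s < 0 := by
      by_contra hc
      rw [not_lt] at hc
      nlinarith
    nlinarith

theorem fiveArc_of_apex {c n l : ℂ} {e h : ℝ} (hc : c.re = 1) (hn : ‖n‖ = 1)
    (hnc : (n * (starRingEnd ℂ) c).re = 0) (he : e = 1 ∨ e = -1) (h₁ : (√3 - 1) * ‖c‖ < h)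
    (h₂ : h < ‖c‖) (hl : 2 * l = ((h + ‖c‖ : ℝ) : ℂ) * n - -(e * c)) :
    FiveArcConfiguration l c e n ∧ (l ∈ interior ncf ↔ |l.im| < 1 - l.re ^ 2 / 4) := by
  rw [sub_neg_eq_add] at hl
  have st := isStacked_of_apex hc hn hnc he hl (by linarith) (by linarith)
  refine ⟨st.fiveArcConfiguration (by linarith), fun hl => ((mem_interior_ncf_iff l).1 hl).1,
    fun hp => (mem_interior_ncf_iff l).2 ⟨hp, ?_⟩⟩
  have hs : (√3 : ℝ) ^ 2 = 3 := Real.sq_sqrt (by norm_num)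
  have hs' : 0 < √3 := Real.sqrt_pos.2 (by norm_num)
  have hR := norm_pos_of_re_eq_one hc
  have hR2 := norm_sq_eq c
  have hH : √3 * ‖c‖ < h + ‖c‖ := by linarith
  have hHH : 3 * ‖c‖ ^ 2 < (h + ‖c‖) ^ 2 := by
    have := pow_lt_pow_left₀ hH (by positivity) two_ne_zero
    rwa [mul_pow, hs] at this
  -- Beyond the angle `π / 3` only `1 < ‖l‖` is needed, and `‖2 l‖² = ‖c‖² + H² > 4 ‖c‖² ≥ 4`, where
  -- `H = h + ‖c‖`.
  rcases lt_or_ge (√3 * |l.re|) |l.im| with hlt | hge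
  · refine Or.inr ⟨?_, hlt⟩
    have h1 := st.frame.sq_norm (2 * l)
    rw [st.coord_two_mul.1, st.coord_two_mul.2, norm_mul, Complex.norm_ofNat] at h1
    rw [hc] at hR2
    have : 1 ^ 2 < ‖l‖ ^ 2 := by nlinarith [sq_nonneg c.im]
    exact (sq_lt_sq₀ zero_le_one (norm_nonneg _)).1 this
  · left
    obtain ⟨k, hk, hk1, hk2, -⟩ := st.frame.exists_sign
    have e1 := congrArg Complex.re hl
    have e2 := congrArg Complex.im hl
    simp only [Complex.add_re, Complex.add_im, Complex.ofReal_re, Complex.ofReal_im,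
      Complex.mul_re, Complex.mul_im, Complex.re_ofNat, Complex.im_ofNat, hk1, hk2, hc,
      mul_one, zero_mul, sub_zero, add_zero] at e1 e2
    set η := k * (h + ‖c‖) / ‖c‖ with hη
    have f1 : 2 * l.re = e * (1 - η * c.im) := by
      rw [e1, hη]; field_simp; ring
    have f2 : 2 * l.im = e * (c.im + η) := by
      rw [e2, hη]; field_simp; ring
    have g1 : 2 * |l.re| = |1 - η * c.im| := by
      simpa only [abs_mul, abs_two, sign_abs he, one_mul] using congrArg abs f1
    have g2 : 2 * |l.im| = |c.im + η| := by
      simpa only [abs_mul, abs_two, sign_abs he, one_mul] using congrArg abs f2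
    have := two_lt_of_apex (s := c.im) (η := η) (by
      rw [hη, div_pow, mul_pow, hk, one_mul, lt_div_iff₀ (by positivity)]
      exact hHH) (by rw [← g1, ← g2]; linarith)
    rw [← g1, ← g2] at this
    linarith

/-! ### Sides of round circles -/

/-- The sphere bounded by a line, with the lower side as inside. -/
def lowerHalf (n : ℂ) (h : ℝ) : SidedCurve where
  curve := insert ∞ ((fun z : ℂ => (z : Sphere)) '' levelLine n h)
  inside := (fun z : ℂ => (z : Sphere)) '' {z | coord n z < h}

/-- A line with the upper side as inside. -/
def upperHalf (n : ℂ) (h : ℝ) : SidedCurve where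
  curve := insert ∞ ((fun z : ℂ => (z : Sphere)) '' levelLine n h)
  inside := (fun z : ℂ => (z : Sphere)) '' {z | h < coord n z}

lemma coord_neg_left (n z : ℂ) : coord (-n) z = -coord n z := by
  simp only [coord_eq, Complex.neg_re, Complex.neg_im]; ring

lemma coord_real_mul_left (n z : ℂ) (t : ℝ) : coord (t * n) z = t * coord n z := by
  simp only [coord_eq, Complex.mul_re, Complex.mul_im, Complex.ofReal_re, Complex.ofReal_im]; ring

lemma mem_levelLine {n z : ℂ} {h : ℝ} : z ∈ levelLine n h ↔ coord n z = h := Iff.rfl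

lemma SidedCurve.ext' {J K : SidedCurve} (h : J.curve = K.curve) (h' : J.inside = K.inside) :
    J = K := by
  cases J; cases K; simp_all

lemma upperHalf_eq (n : ℂ) (h : ℝ) : upperHalf n h = lowerHalf (-n) (-h) := by
  apply SidedCurve.ext'
  · simp only [upperHalf, lowerHalf]
    congr 2
    ext z
    rw [mem_levelLine, mem_levelLine, coord_neg_left, neg_inj]
  · simp only [upperHalf, lowerHalf, coord_neg_left, neg_lt_neg_iff]

lemma lowerHalf_smul (n : ℂ) (h : ℝ) {r : ℝ} (hr : 0 < r) :
    lowerHalf (r * n) (r * h) = lowerHalf n h := by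
  apply SidedCurve.ext'
  · simp only [lowerHalf]
    congr 2
    ext z
    rw [mem_levelLine, mem_levelLine, coord_real_mul_left]
    exact mul_right_inj' hr.ne'
  · simp only [lowerHalf, coord_real_mul_left]
    congr 2
    ext z
    exact mul_lt_mul_iff_right₀ hr

lemma lowerHalf_outside (n : ℂ) (h : ℝ) : (lowerHalf n h).outside = (upperHalf n h).inside :=
  below_outside n n (fun _ => h)

lemma coord_self (n : ℂ) : coord n n = ‖n‖ ^ 2 := by
  rw [coord_eq, norm_sq_eq]; ring

lemma exists_coord_eq {n : ℂ} (hn : n ≠ 0) (t : ℝ) : ∃ z, coord n z = t := by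
  refine ⟨((t / ‖n‖ ^ 2 : ℝ) : ℂ) * n, ?_⟩
  rw [coord_real_mul, coord_self]
  have := norm_pos_iff.2 hn
  field_simp

/-- A round circle with one of its sides. -/
def IsRoundSided (J : SidedCurve) : Prop :=
  (∃ (a : ℂ) (r : ℝ), 0 < r ∧ J = disk a r) ∨ (∃ (a : ℂ) (r : ℝ), 0 < r ∧ J = codisk a r) ∨
  (∃ (n : ℂ) (h : ℝ), n ≠ 0 ∧ J = lowerHalf n h)

/-- The inside and the outside are connected, so each lies in `U` or in `V`. Together they cover `U
∪ V`, so they cannot lie in the same one. -/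
lemma SidedCurve.IsJordan.inside_eq {J : SidedCurve} (hJ : J.IsJordan) {U V : Set Sphere}
    (hU : IsOpen U) (hV : IsOpen V) (hU' : U.Nonempty) (hV' : V.Nonempty) (hUV : Disjoint U V)
    (h : J.curveᶜ = U ∪ V) : J.inside = U ∨ J.inside = V := by
  have hin : J.inside ⊆ U ∪ V := by
    rw [← h]; exact fun w hw hw' => Set.disjoint_left.1 hJ.disjoint hw' hw
  have hout : J.outside ⊆ U ∪ V := by
    rw [← h]; exact fun w hw hw' => hw (Or.inl hw')
  have hall : U ∪ V ⊆ J.inside ∪ J.outside := by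
    rw [← h]
    intro w hw
    by_cases hw' : w ∈ J.inside
    · exact Or.inl hw'
    · exact Or.inr fun hc => hc.elim hw hw'
  have hio : Disjoint J.inside J.outside :=
    Set.disjoint_left.2 fun w hw hw' => hw' (Or.inr hw)
  rcases hJ.isConnected_inside.isPreconnected.subset_or_subset hU hV hUV hin with h1 | h1 <;>
  rcases hJ.isConnected_outside.isPreconnected.subset_or_subset hU hV hUV hout with h2 | h2
  · obtain ⟨w, hw⟩ := hV'
    exact absurd hw (Set.disjoint_left.1 hUV ((hall (Or.inr hw)).elim (fun h => h1 h) fun h => h2 h))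
  · refine Or.inl (Set.Subset.antisymm h1 fun w hw => (hall (Or.inl hw)).resolve_right fun hc => ?_)
    exact Set.disjoint_left.1 hUV hw (h2 hc)
  · refine Or.inr (Set.Subset.antisymm h1 fun w hw => (hall (Or.inr hw)).resolve_right fun hc => ?_)
    exact Set.disjoint_left.1 hUV (h2 hc) hw
  · obtain ⟨w, hw⟩ := hU'
    exact absurd ((hall (Or.inl hw)).elim (fun h => h1 h) fun h => h2 h)
      (Set.disjoint_left.1 hUV hw)

lemma isRoundSided_of_isJordan {J : SidedCurve} (hJ : J.IsJordan) (hr : IsRoundCircle J.curve) :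
    IsRoundSided J := by
  rcases hr with ⟨a, r, hr, h⟩ | ⟨n, t, hn, h⟩
  · have hcompl : J.curveᶜ = (fun z : ℂ => (z : Sphere)) '' Metric.ball a r ∪
        ((fun z : ℂ => (z : Sphere)) '' Metric.closedBall a r)ᶜ := by
      rw [h, ← disk_outside]
      ext w
      simp only [SidedCurve.outside, disk, Set.mem_compl_iff, Set.mem_union]
      have : w ∈ circleCurve a r → w ∉ (fun z : ℂ => (z : Sphere)) '' Metric.ball a r :=
        fun hw => Set.disjoint_left.1 (disk_isJordan a hr).disjoint hw
      tauto
    have hdis : Disjoint ((fun z : ℂ => (z : Sphere)) '' Metric.ball a r)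
        (((fun z : ℂ => (z : Sphere)) '' Metric.closedBall a r)ᶜ) :=
      Set.disjoint_left.2 fun w hw hw' => hw' (Set.image_mono Metric.ball_subset_closedBall hw)
    rcases hJ.inside_eq (isOpen_coe_image Metric.isOpen_ball) (isOpen_compl_closedBall_sphere a r)
      ⟨_, ⟨a, Metric.mem_ball_self hr, rfl⟩⟩ ⟨∞, infty_notMem_coe_image⟩ hdis hcompl with h1 | h1
    · exact Or.inl ⟨a, r, hr, SidedCurve.ext' h h1⟩
    · exact Or.inr (Or.inl ⟨a, r, hr, SidedCurve.ext' h h1⟩)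
  · have hcompl : J.curveᶜ = (lowerHalf n t).inside ∪ (upperHalf n t).inside := by
      rw [h]
      ext w
      simp only [lowerHalf, upperHalf]
      induction w using OnePoint.rec with
      | infty => simp
      | coe z =>
        simp only [Set.mem_compl_iff, Set.mem_insert_iff, OnePoint.coe_ne_infty, false_or,
          Set.mem_union, coe_mem_coe_image, mem_levelLine, Set.mem_ofPred_eq]
        exact ne_iff_lt_or_gt
    have hdis : Disjoint (lowerHalf n t).inside (upperHalf n t).inside :=
      disjoint_coe_image (Set.disjoint_left.2 fun z (hz : coord n z < t) hz' => lt_asymm hz hz')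
    obtain ⟨z₁, hz₁⟩ := exists_coord_eq hn (t - 1)
    obtain ⟨z₂, hz₂⟩ := exists_coord_eq hn (t + 1)
    rcases hJ.inside_eq (isOpen_below_inside (d := n) (f := fun _ => t) continuous_const)
      (isOpen_above_inside (d := n) (f := fun _ => t) continuous_const)
      ⟨_, ⟨z₁, by rw [Set.mem_ofPred_eq, hz₁]; linarith, rfl⟩⟩
      ⟨_, ⟨z₂, by rw [Set.mem_ofPred_eq, hz₂]; linarith, rfl⟩⟩ hdis hcompl with h1 | h1
    · exact Or.inr (Or.inr ⟨n, t, hn, SidedCurve.ext' h h1⟩)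
    · refine Or.inr (Or.inr ⟨-n, -t, neg_ne_zero.2 hn, ?_⟩)
      rw [← upperHalf_eq]
      exact SidedCurve.ext' h h1

/-! ### Hermitian forms -/

/-- A real quadratic function on the sphere, with its leading coefficient as value at `∞`. -/
noncomputable def hermitian (A : ℝ) (B : ℂ) (D : ℝ) (w : Sphere) : ℝ :=
  w.elim A fun z => A * ‖z‖ ^ 2 + 2 * coord B z + D

/-- The zero set of a Hermitian form, with its negative side. -/
noncomputable def hermitianSide (A : ℝ) (B : ℂ) (D : ℝ) : SidedCurve where
  curve := {w | hermitian A B D w = 0}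
  inside := {w | hermitian A B D w < 0}

lemma hermitian_infty (A : ℝ) (B : ℂ) (D : ℝ) : hermitian A B D ∞ = A := rfl

lemma hermitian_coe (A : ℝ) (B : ℂ) (D : ℝ) (z : ℂ) :
    hermitian A B D z = A * ‖z‖ ^ 2 + 2 * coord B z + D := rfl

lemma sq_norm_sub (z a : ℂ) : ‖z - a‖ ^ 2 = ‖z‖ ^ 2 + 2 * coord (-a) z + ‖a‖ ^ 2 := by
  simp only [norm_sq_eq, coord_eq, Complex.sub_re, Complex.sub_im, Complex.neg_re, Complex.neg_im]
  ring

lemma disk_eq_hermitianSide (a : ℂ) {r : ℝ} (hr : 0 < r) :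
    disk a r = hermitianSide 1 (-a) (‖a‖ ^ 2 - r ^ 2) := by
  apply SidedCurve.ext' <;> ext w <;> induction w using OnePoint.rec
  · simp [disk, hermitianSide, hermitian_infty, circleCurve]
  · simp only [disk, hermitianSide, circleCurve, coe_mem_coe_image, Set.mem_ofPred_eq,
      hermitian_coe, mem_sphere_iff_norm]
    rw [← sq_eq_sq₀ (norm_nonneg _) hr.le, sq_norm_sub]
    constructor <;> intro h <;> linarith
  · simp [disk, hermitianSide, hermitian_infty]
  · simp only [disk, hermitianSide, coe_mem_coe_image, Set.mem_ofPred_eq,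
      hermitian_coe, mem_ball_iff_norm]
    rw [← sq_lt_sq₀ (norm_nonneg _) hr.le, sq_norm_sub]
    constructor <;> intro h <;> linarith

lemma codisk_eq_hermitianSide (a : ℂ) {r : ℝ} (hr : 0 < r) :
    codisk a r = hermitianSide (-1) a (r ^ 2 - ‖a‖ ^ 2) := by
  apply SidedCurve.ext' <;> ext w <;> induction w using OnePoint.rec
  · simp [codisk, hermitianSide, hermitian_infty, circleCurve]
  · simp only [codisk, hermitianSide, circleCurve, coe_mem_coe_image, Set.mem_ofPred_eq,
      hermitian_coe, mem_sphere_iff_norm]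
    rw [← sq_eq_sq₀ (norm_nonneg _) hr.le, sq_norm_sub, coord_neg_left]
    constructor <;> intro h <;> linarith
  · simp [codisk, hermitianSide, hermitian_infty]
  · simp only [codisk, hermitianSide, Set.mem_compl_iff, coe_mem_coe_image, Set.mem_ofPred_eq,
      hermitian_coe, mem_closedBall_iff_norm, not_le]
    rw [← sq_lt_sq₀ hr.le (norm_nonneg _), sq_norm_sub, coord_neg_left]
    constructor <;> intro h <;> linarith

lemma lowerHalf_eq_hermitianSide (n : ℂ) (h : ℝ) :
    lowerHalf n h = hermitianSide 0 (((1 / 2 : ℝ) : ℂ) * n) (-h) := by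
  apply SidedCurve.ext' <;> ext w <;> induction w using OnePoint.rec
  · simp [lowerHalf, hermitianSide, hermitian_infty]
  · simp only [lowerHalf, hermitianSide, coe_mem_coe_image, Set.mem_ofPred_eq,
      hermitian_coe, mem_levelLine, Set.mem_insert_iff, OnePoint.coe_ne_infty, false_or,
      coord_real_mul_left]
    constructor <;> intro h <;> linarith
  · simp [lowerHalf, hermitianSide, hermitian_infty]
  · simp only [lowerHalf, hermitianSide, coe_mem_coe_image, Set.mem_ofPred_eq,
      hermitian_coe, coord_real_mul_left]
    constructor <;> intro h <;> linarith

lemma hermitian_smul (A : ℝ) (B : ℂ) (D r : ℝ) (w : Sphere) :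
    hermitian (r * A) (r * B) (r * D) w = r * hermitian A B D w := by
  induction w using OnePoint.rec with
  | infty => rfl
  | coe z => simp only [hermitian_coe, coord_real_mul_left]; ring

lemma hermitianSide_smul (A : ℝ) (B : ℂ) (D : ℝ) {r : ℝ} (hr : 0 < r) :
    hermitianSide (r * A) (r * B) (r * D) = hermitianSide A B D := by
  apply SidedCurve.ext' <;> simp only [hermitianSide, hermitian_smul]
  · simp [hr.ne']
  · ext w
    simp only [Set.mem_ofPred_eq]
    constructor <;> intro h <;> nlinarith

/-- The sign of `A` tells whether `∞` is outside, on, or inside the curve. The positive number `‖B‖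
^ 2 - A * D` is `A ^ 2` times the squared radius; for `A = 0` it says that the normal is not zero.
-/
lemma isRoundSided_hermitianSide {A : ℝ} {B : ℂ} {D : ℝ} (h : A * D < ‖B‖ ^ 2) :
    IsRoundSided (hermitianSide A B D) := by
  rcases lt_trichotomy A 0 with hA | rfl | hA
  · right; left
    have hA' : 0 < -A := by linarith
    have hA'' := hA.ne
    have hpos : 0 < ‖((1 / -A : ℝ) : ℂ) * B‖ ^ 2 + 1 / -A * D := by
      rw [norm_mul, Complex.norm_real, mul_pow, Real.norm_eq_abs, sq_abs]
      have : (1 / -A) ^ 2 * ‖B‖ ^ 2 + 1 / -A * D = (‖B‖ ^ 2 - A * D) / A ^ 2 := by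
        field_simp
        ring
      rw [this]
      exact div_pos (by linarith) (by positivity)
    refine ⟨((1 / -A : ℝ) : ℂ) * B, √(‖((1 / -A : ℝ) : ℂ) * B‖ ^ 2 + 1 / -A * D), Real.sqrt_pos.2 hpos, ?_⟩
    rw [codisk_eq_hermitianSide _ (Real.sqrt_pos.2 hpos), Real.sq_sqrt hpos.le,
      ← hermitianSide_smul A B D (one_div_pos.2 hA')]
    congr 1
    · field_simp
    · ring
  · right; right
    refine ⟨2 * B, -D, ?_, ?_⟩
    · intro h0
      have : B = 0 := by simpa using h0
      simp [this] at h
    · rw [lowerHalf_eq_hermitianSide, neg_neg]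
      congr 1
      push_cast; ring
  · left
    have hpos : 0 < ‖((1 / A : ℝ) : ℂ) * B‖ ^ 2 - 1 / A * D := by
      rw [norm_mul, Complex.norm_real, mul_pow, Real.norm_eq_abs, sq_abs]
      have : (1 / A) ^ 2 * ‖B‖ ^ 2 - 1 / A * D = (‖B‖ ^ 2 - A * D) / A ^ 2 := by
        field_simp
      rw [this]
      exact div_pos (by linarith) (by positivity)
    refine ⟨-(((1 / A : ℝ) : ℂ) * B), √(‖((1 / A : ℝ) : ℂ) * B‖ ^ 2 - 1 / A * D),
      Real.sqrt_pos.2 hpos, ?_⟩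
    rw [disk_eq_hermitianSide _ (Real.sqrt_pos.2 hpos), Real.sq_sqrt hpos.le, norm_neg, neg_neg,
      ← hermitianSide_smul A B D (one_div_pos.2 hA)]
    congr 1
    · field_simp
    · ring

lemma IsRoundSided.exists_hermitian {J : SidedCurve} (hJ : IsRoundSided J) :
    ∃ (A : ℝ) (B : ℂ) (D : ℝ), A * D < ‖B‖ ^ 2 ∧ J = hermitianSide A B D := by
  rcases hJ with ⟨a, r, hr, rfl⟩ | ⟨a, r, hr, rfl⟩ | ⟨n, h, hn, rfl⟩
  · refine ⟨_, _, _, ?_, disk_eq_hermitianSide a hr⟩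
    rw [norm_neg]
    nlinarith
  · refine ⟨_, _, _, ?_, codisk_eq_hermitianSide a hr⟩
    nlinarith
  · refine ⟨_, _, _, ?_, lowerHalf_eq_hermitianSide n h⟩
    have := norm_pos_iff.2 hn
    rw [zero_mul, norm_mul, Complex.norm_real, Real.norm_of_nonneg (by norm_num)]
    positivity

/-! ### The inversion -/

/-- The map `z ↦ 1 / z`. -/
noncomputable def inversion : GL (Fin 2) ℂ :=
  Matrix.GeneralLinearGroup.mkOfDetNeZero !![0, 1; 1, 0] (by simp)

lemma inversion_smul_coe {z : ℂ} (hz : z ≠ 0) : inversion • (z : Sphere) = ((z⁻¹ : ℂ) : Sphere) := by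
  rw [OnePoint.smul_some_eq_ite]
  simp [inversion, Matrix.GeneralLinearGroup.mkOfDetNeZero, hz]

lemma inversion_smul_zero : inversion • ((0 : ℂ) : Sphere) = ∞ := by
  rw [OnePoint.smul_some_eq_ite]
  simp [inversion, Matrix.GeneralLinearGroup.mkOfDetNeZero]

lemma inversion_smul_infty : inversion • (∞ : Sphere) = ((0 : ℂ) : Sphere) := by
  rw [OnePoint.smul_infty_eq_ite]
  simp [inversion, Matrix.GeneralLinearGroup.mkOfDetNeZero]

lemma inversion_mul_self : inversion * inversion = 1 := by
  ext i j
  fin_cases i <;> fin_cases j <;>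
    simp [inversion, Matrix.GeneralLinearGroup.mkOfDetNeZero, Matrix.mul_apply]

/-- `1 / S(z) = 1 / z + 1`; the parameter is `1 / 2` because `T l` translates by `2 * l`. -/
lemma T_mul_inversion : T (1 / 2) * inversion = inversion * S := by
  ext i j
  fin_cases i <;> fin_cases j <;>
    simp [inversion, T, S, Matrix.GeneralLinearGroup.mkOfDetNeZero, Matrix.mul_apply]

/-- The image of a sided curve under a Möbius transformation. -/
def SidedCurve.map (g : GL (Fin 2) ℂ) (J : SidedCurve) : SidedCurve where
  curve := mob g J.curve
  inside := mob g J.inside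

lemma SidedCurve.map_outside (g : GL (Fin 2) ℂ) (J : SidedCurve) :
    (J.map g).outside = mob g J.outside := by
  rw [outside, map, outside, mob_compl, mob_union]

lemma mob_inversion_inversion (A : Set Sphere) : mob inversion (mob inversion A) = A := by
  rw [← mob_mul, inversion_mul_self]
  simp [mob]

lemma SidedCurve.map_inversion_inversion (J : SidedCurve) :
    (J.map inversion).map inversion = J :=
  SidedCurve.ext' (mob_inversion_inversion _) (mob_inversion_inversion _)

lemma coord_inv (B z : ℂ) : coord (conj B) z⁻¹ = coord B z / ‖z‖ ^ 2 := by
  rw [coord_eq, coord_eq, Complex.inv_re, Complex.inv_im, Complex.normSq_eq_norm_sq]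
  simp
  ring

/-- Inversion exchanges the leading and the constant coefficient. As the factor is positive, it
transports sides as well as curves. -/
lemma exists_pos_hermitian_inversion (A : ℝ) (B : ℂ) (D : ℝ) (w : Sphere) :
    ∃ r : ℝ, 0 < r ∧ hermitian D (conj B) A (inversion • w) = r * hermitian A B D w := by
  induction w using OnePoint.rec with
  | infty =>
    refine ⟨1, one_pos, ?_⟩
    rw [inversion_smul_infty, hermitian_coe, hermitian_infty]
    simp [coord]
  | coe z =>
    rcases eq_or_ne z 0 with rfl | hz
    · refine ⟨1, one_pos, ?_⟩
      rw [inversion_smul_zero, hermitian_coe, hermitian_infty]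
      simp [coord]
    · have hz' := norm_pos_iff.2 hz
      refine ⟨1 / ‖z‖ ^ 2, by positivity, ?_⟩
      rw [inversion_smul_coe hz, hermitian_coe, hermitian_coe]
      rw [coord_inv, norm_inv]
      field_simp
      ring

lemma hermitianSide_map_inversion (A : ℝ) (B : ℂ) (D : ℝ) :
    (hermitianSide A B D).map inversion = hermitianSide D (conj B) A := by
  apply SidedCurve.ext' <;> refine mob_eq_of_forall_mem_iff fun w => ?_ <;>
    obtain ⟨r, hr, h⟩ := exists_pos_hermitian_inversion A B D w <;>
    simp only [hermitianSide, Set.mem_ofPred_eq, h]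
  · simp [hr.ne']
  · constructor <;> intro h <;> nlinarith

lemma IsRoundSided.map_inversion {J : SidedCurve} (hJ : IsRoundSided J) :
    IsRoundSided (J.map inversion) := by
  obtain ⟨A, B, D, h, rfl⟩ := hJ.exists_hermitian
  rw [hermitianSide_map_inversion]
  apply isRoundSided_hermitianSide
  rw [RCLike.norm_conj]
  linarith

/-- The circle passes through `0`, so the constant coefficient vanishes and the image is a line. -/
lemma disk_map_inversion {c : ℂ} (hc : c ≠ 0) {p : ℝ} (hp : 0 < p) :
    (disk (-(p * c)) (p * ‖c‖)).map inversion = lowerHalf (conj c) (-(1 / (2 * p))) := by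
  have hc' := norm_pos_iff.2 hc
  rw [disk_eq_hermitianSide _ (by positivity), hermitianSide_map_inversion, neg_neg,
    lowerHalf_eq_hermitianSide, ← hermitianSide_smul 0 _ _ (mul_pos two_pos hp)]
  congr 1
  · rw [norm_neg, norm_mul, Complex.norm_real, Real.norm_of_nonneg hp.le]; ring
  · rw [map_mul, Complex.conj_ofReal]; push_cast; ring
  · field_simp

/-! ### Curves paired by a translation -/

lemma eq_of_ball_subset_closedBall {a b : ℂ} {r : ℝ} (hr : 0 < r)
    (h : Metric.ball a r ⊆ Metric.closedBall b r) : a = b := by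
  by_contra hab
  have hd : 0 < ‖a - b‖ := norm_pos_iff.2 (sub_ne_zero.2 hab)
  have h1 : Metric.closedBall a r ⊆ Metric.closedBall b r := by
    rw [← closure_ball a hr.ne']
    exact closure_minimal h Metric.isClosed_closedBall
  have h2 : a + ((r / ‖a - b‖ : ℝ) : ℂ) * (a - b) ∈ Metric.closedBall b r := by
    apply h1
    rw [mem_closedBall_iff_norm, add_sub_cancel_left, norm_mul, Complex.norm_real,
      Real.norm_of_nonneg (by positivity)]
    field_simp
    exact le_rfl
  rw [mem_closedBall_iff_norm, show a + ((r / ‖a - b‖ : ℝ) : ℂ) * (a - b) - b =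
    ((1 + r / ‖a - b‖ : ℝ) : ℂ) * (a - b) by push_cast; ring, norm_mul, Complex.norm_real,
    Real.norm_of_nonneg (by positivity), add_mul, div_mul_cancel₀ _ hd.ne'] at h2
  linarith

lemma mob_T_lowerHalf_curve (l n : ℂ) (t : ℝ) :
    mob (T l) (lowerHalf n t).curve = (upperHalf n (t + coord n (2 * l))).curve := by
  rw [lowerHalf, upperHalf, mob_T_insert_infty]
  congr 2
  ext z
  rw [Set.mem_ofPred_eq, mem_levelLine, mem_levelLine, coord_sub, sub_eq_iff_eq_add]

lemma mob_T_lowerHalf_outside (l n : ℂ) (t : ℝ) :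
    mob (T l) (lowerHalf n t).outside = (upperHalf n (t + coord n (2 * l))).inside := by
  rw [lowerHalf_outside, upperHalf, upperHalf, mob_T_coe]
  congr 1
  ext z
  simp only [Set.mem_ofPred_eq, coord_sub, lt_sub_iff_add_lt]

/-- For a circle, disjointness puts an open disc inside a closed one of the same radius, so the
centers agree and `l = 0`. For a line the displacement must be positive: a negative one makes the
half-planes overlap, and zero fixes the curve. -/
theorem eq_lowerHalf_of_paired {l : ℂ} (hl : l ≠ 0) {J : SidedCurve} (hJ : IsRoundSided J)
    (hdis : Disjoint J.inside (mob (T l) J.outside)) (hne : mob (T l) J.curve ≠ J.curve) :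
    ∃ (n : ℂ) (t : ℝ), ‖n‖ = 1 ∧ 0 < coord n (2 * l) ∧ J = lowerHalf n t := by
  rcases hJ with ⟨a, r, hr, rfl⟩ | ⟨a, r, hr, rfl⟩ | ⟨n, h, hn, rfl⟩
  · rw [mob_T_disk_outside, disk_outside] at hdis
    have : Metric.ball a r ⊆ Metric.closedBall (a + 2 * l) r := by
      intro z hz
      have := Set.disjoint_left.1 hdis (coe_mem_coe_image.2 hz)
      rwa [Set.notMem_compl_iff, coe_mem_coe_image] at this
    have := eq_of_ball_subset_closedBall hr this
    simp [hl] at this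
  · have hout : (codisk a r).outside = (disk a r).inside := by
      rw [SidedCurve.outside, codisk, disk, circleCurve, Set.compl_union, compl_compl,
        ← Metric.ball_union_sphere, Set.image_union]
      ext w
      have : w ∈ (fun z : ℂ => (z : Sphere)) '' Metric.sphere a r →
          w ∉ (fun z : ℂ => (z : Sphere)) '' Metric.ball a r :=
        fun hw => Set.disjoint_left.1 (disjoint_coe_image Metric.sphere_disjoint_ball) hw
      simp only [Set.mem_inter_iff, Set.mem_compl_iff, Set.mem_union]
      tauto
    rw [hout, mob_T_disk_inside] at hdis
    have : Metric.ball (a + 2 * l) r ⊆ Metric.closedBall a r := by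
      intro z hz
      have := Set.disjoint_right.1 hdis (coe_mem_coe_image.2 hz)
      rwa [codisk, Set.notMem_compl_iff, coe_mem_coe_image] at this
    have := eq_of_ball_subset_closedBall hr this
    simp [hl] at this
  · have hn' := norm_pos_iff.2 hn
    have hm : ((1 / ‖n‖ : ℝ) : ℂ) * n ≠ 0 := by
      apply mul_ne_zero _ hn
      exact_mod_cast (one_div_pos.2 hn').ne'
    rw [← lowerHalf_smul n h (one_div_pos.2 hn')] at hdis hne ⊢
    refine ⟨_, _, ?_, ?_, rfl⟩
    · rw [norm_mul, Complex.norm_real, Real.norm_of_nonneg (by positivity)]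
      field_simp
    · generalize ((1 / ‖n‖ : ℝ) : ℂ) * n = m at *
      generalize 1 / ‖n‖ * h = t at *
      rw [mob_T_lowerHalf_outside] at hdis
      rw [mob_T_lowerHalf_curve] at hne
      rcases lt_trichotomy (coord m (2 * l)) 0 with hk | hk | hk
      · obtain ⟨z, hz⟩ := exists_coord_eq hm (t + coord m (2 * l) / 2)
        have h1 : (z : Sphere) ∈ (lowerHalf m t).inside :=
          coe_mem_coe_image.2 (by rw [Set.mem_ofPred_eq, hz]; linarith)
        have h2 : (z : Sphere) ∈ (upperHalf m (t + coord m (2 * l))).inside :=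
          coe_mem_coe_image.2 (by rw [Set.mem_ofPred_eq, hz]; linarith)
        exact absurd h2 (Set.disjoint_left.1 hdis h1)
      · rw [hk, add_zero] at hne
        exact absurd rfl hne
      · exact hk

/-! ### The shape of classical configurations -/

/-- A Jordan curve is infinite, so curves with a finite intersection are different. This supplies
the hypothesis `hne` of `eq_lowerHalf_of_paired`. -/
lemma SidedCurve.IsJordan.curve_ne {J K : SidedCurve} (hJ : J.IsJordan)
    (h : (J.curve ∩ K.curve).Finite) : K.curve ≠ J.curve := by
  intro he
  rw [he, Set.inter_self] at h
  obtain ⟨f, -, hf, hr⟩ := hJ.exists_param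
  rw [← hr] at h
  have : Infinite Circle := Set.infinite_coe_iff.2 (by
    have h1 : (Set.range fun t : Set.Ico (0 : ℝ) 1 =>
        Complex.exp ((t : ℝ) * Complex.I)).Infinite := by
      apply Set.infinite_range_of_injective
      intro s t hst
      obtain ⟨k, hk⟩ := Complex.exp_eq_exp_iff_exists_int.1 hst
      have h2 : (s : ℝ) = t + k * (2 * Real.pi) := by
        have := congrArg Complex.im hk
        simpa using this
      have hs := s.2
      have ht := t.2
      have hπ := Real.pi_gt_three
      have hk0 : k = 0 := by
        by_contra hne
        rcases lt_or_gt_of_ne hne with h3 | h3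
        · have : (k : ℝ) ≤ -1 := by exact_mod_cast Int.le_sub_one_of_lt h3
          nlinarith [hs.1, hs.2, ht.1, ht.2]
        · have : (1 : ℝ) ≤ k := by exact_mod_cast h3
          nlinarith [hs.1, hs.2, ht.1, ht.2]
      rw [hk0] at h2
      exact Subtype.ext (by simpa using h2)
    refine h1.mono ?_
    rintro _ ⟨t, rfl⟩
    exact mem_sphere_zero_iff_norm.2 (Complex.norm_exp_ofReal_mul_I t))
  exact Set.infinite_range_of_injective hf h

lemma mob_disjoint (g : GL (Fin 2) ℂ) {A B : Set Sphere} (h : Disjoint A B) :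
    Disjoint (mob g A) (mob g B) :=
  (Set.disjoint_image_iff (MulAction.injective g)).2 h

lemma mob_injective (g : GL (Fin 2) ℂ) : Function.Injective (mob g) :=
  Function.LeftInverse.injective (mob_inv_mob g)

theorem exists_lines_of_paired_S {J K : SidedCurve} (hJ : IsRoundSided J)
    (hdis : Disjoint J.inside K.inside) (hne : K.curve ≠ J.curve) (hc : mob S J.curve = K.curve)
    (hs : mob S J.outside = K.inside) :
    ∃ (c : ℂ) (t : ℝ), c.re = 1 ∧ J = (lowerHalf (conj c) t).map inversion ∧
      K = (upperHalf (conj c) (t + 1)).map inversion := by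
  have e1 (A : Set Sphere) : mob (T (1 / 2)) (mob inversion A) = mob inversion (mob S A) := by
    rw [← mob_mul, T_mul_inversion, mob_mul]
  obtain ⟨m, t, hm, hpos, h⟩ := eq_lowerHalf_of_paired (l := 1 / 2) (by norm_num) hJ.map_inversion
    (by rw [SidedCurve.map_outside, e1, hs]; exact mob_disjoint _ hdis)
    (by
      show mob (T (1 / 2)) (mob inversion J.curve) ≠ mob inversion J.curve
      rw [e1, hc]
      exact (mob_injective _).ne hne)
  have hre : coord m (2 * (1 / 2)) = m.re := by norm_num [coord_eq]
  rw [hre] at hpos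
  -- Scaling the normal to have real part `1` makes the translation `z ↦ z + 1` raise its level
  -- lines by exactly `1`; this is the source of `c.re = 1`.
  set c : ℂ := conj (((1 / m.re : ℝ) : ℂ) * m) with hcd
  have hc1 : c.re = 1 := by
    rw [hcd, Complex.conj_re, Complex.re_ofReal_mul]
    field_simp
  have hcc : coord (conj c) (2 * (1 / 2)) = 1 := by
    norm_num [coord_eq, hc1]
  have hcm : conj c = ((1 / m.re : ℝ) : ℂ) * m := by rw [hcd, Complex.conj_conj]
  rw [← lowerHalf_smul m t (one_div_pos.2 hpos), ← hcm] at h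
  refine ⟨c, 1 / m.re * t, hc1, ?_, ?_⟩
  · rw [← h, SidedCurve.map_inversion_inversion]
  · rw [← SidedCurve.map_inversion_inversion K]
    congr 1
    apply SidedCurve.ext'
    · show mob inversion K.curve = _
      have h5 := mob_T_lowerHalf_curve (1 / 2) (conj c) (1 / m.re * t)
      rw [hcc] at h5
      rw [← hc, ← e1, ← h5, ← h]
      rfl
    · show mob inversion K.inside = _
      rw [← hs, ← e1, ← SidedCurve.map_outside, h, mob_T_lowerHalf_outside, hcc]

/-- For `0 ≤ t` the inverted half-plane contains `{z | coord c z < 0}`, and no half-plane fits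
between two parallel lines. The witnesses are `u n - c` with `u` large, its sign chosen to keep the
coordinate along `c` negative. -/
lemma not_disjoint_halves {c n : ℂ} (hc : c ≠ 0) (hn : ‖n‖ = 1) {t h h' : ℝ} (ht : 0 ≤ t)
    (h₁ : Disjoint ((lowerHalf (conj c) t).map inversion).inside (lowerHalf n h).inside)
    (h₂ : Disjoint ((lowerHalf (conj c) t).map inversion).inside (upperHalf n h').inside) :
    False := by
  have key (z : ℂ) (hz : coord c z < 0) :
      (z : Sphere) ∈ ((lowerHalf (conj c) t).map inversion).inside := by
    have hz0 : z ≠ 0 := by rintro rfl; simp [coord] at hz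
    refine ⟨((z⁻¹ : ℂ) : Sphere), coe_mem_coe_image.2 ?_, ?_⟩
    · rw [Set.mem_ofPred_eq, coord_inv]
      have := norm_pos_iff.2 hz0
      exact lt_of_lt_of_le (div_neg_of_neg_of_pos hz (by positivity)) ht
    · show inversion • ((z⁻¹ : ℂ) : Sphere) = _
      rw [inversion_smul_coe (inv_ne_zero hz0), inv_inv]
  have hc' := norm_pos_iff.2 hc
  have hsymm : coord n c = coord c n := by rw [coord_eq, coord_eq]; ring
  have hval (u : ℝ) : coord c (u * n + ((-1 : ℝ) : ℂ) * c) = u * coord c n - ‖c‖ ^ 2 ∧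
      coord n (u * n + ((-1 : ℝ) : ℂ) * c) = u - coord c n := by
    rw [coord_add, coord_add, coord_real_mul, coord_real_mul, coord_real_mul, coord_real_mul,
      coord_self, coord_self, hn, hsymm]
    constructor <;> ring
  rcases le_total (coord c n) 0 with hν | hν
  · have hv := hval (|h'| + 1)
    refine Set.disjoint_left.1 h₂ (key (((|h'| + 1 : ℝ) : ℂ) * n + ((-1 : ℝ) : ℂ) * c) ?_)
      (coe_mem_coe_image.2 ?_)
    · rw [hv.1]; nlinarith [abs_nonneg h']
    · rw [Set.mem_ofPred_eq, hv.2]; linarith [le_abs_self h']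
  · have hv := hval (-(|h| + 1))
    refine Set.disjoint_left.1 h₁ (key (((-(|h| + 1) : ℝ) : ℂ) * n + ((-1 : ℝ) : ℂ) * c) ?_)
      (coe_mem_coe_image.2 ?_)
    · rw [hv.1]; nlinarith [abs_nonneg h]
    · rw [Set.mem_ofPred_eq, hv.2]; linarith [neg_abs_le h]

theorem IsClassicalConfig.exists_standard {l : ℂ} (hl : l ≠ 0) {X : Config}
    (hX : IsClassicalConfig S (T l) X) :
    ∃ (c n : ℂ) (p q t : ℝ), c.re = 1 ∧ ‖n‖ = 1 ∧ 0 < p ∧ 0 < q ∧ p + q = 2 * p * q ∧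
      X 0 = disk (-(p * c)) (p * ‖c‖) ∧ X 1 = disk (q * c) (q * ‖c‖) ∧
      X 2 = lowerHalf n t ∧ X 3 = upperHalf n (t + coord n (2 * l)) := by
  have hS := hX.isSchottkyConfig
  have hr (i : Fin 4) := isRoundSided_of_isJordan (hS.isJordan i) (hX.isRoundCircle i)
  obtain ⟨n, t, hn, hpos, h2⟩ := eq_lowerHalf_of_paired hl (hr 2)
    (by rw [hS.side₂]; exact hS.disjoint_inside 2 3 (by decide))
    (by rw [hS.curve₂]; exact (hS.isJordan 2).curve_ne (hS.finite_inter 2 3 (by decide)))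
  have h3 : X 3 = upperHalf n (t + coord n (2 * l)) := by
    apply SidedCurve.ext'
    · rw [← hS.curve₂, h2, mob_T_lowerHalf_curve]
    · rw [← hS.side₂, h2, mob_T_lowerHalf_outside]
  obtain ⟨c, s, hc, h0, h1⟩ := exists_lines_of_paired_S (hr 0) (hS.disjoint_inside 0 1 (by decide))
    ((hS.isJordan 0).curve_ne (hS.finite_inter 0 1 (by decide))) hS.curve₁ hS.side₁
  have hc0 : c ≠ 0 := by rintro rfl; simp at hc
  have hs0 : s < 0 := by
    by_contra hcon
    rw [not_lt] at hcon
    apply not_disjoint_halves hc0 hn hcon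
    · rw [← h0, ← h2]; exact hS.disjoint_inside 0 2 (by decide)
    · rw [← h0, ← h3]; exact hS.disjoint_inside 0 3 (by decide)
  have h1' : X 1 = (lowerHalf (conj (-c)) (-(s + 1))).map inversion := by
    rw [h1, upperHalf_eq, map_neg]
  have hs1 : -1 < s := by
    by_contra hcon
    rw [not_lt] at hcon
    apply not_disjoint_halves (neg_ne_zero.2 hc0) hn (t := -(s + 1)) (by linarith)
    · rw [← h1', ← h2]; exact hS.disjoint_inside 1 2 (by decide)
    · rw [← h1', ← h3]; exact hS.disjoint_inside 1 3 (by decide)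
  have hs2 : 0 < -s := by linarith
  have hs3 : 0 < s + 1 := by linarith
  -- The lines at heights `s < 0 < s + 1` invert to circles scaled by `p = 1 / (2 (-s))` and `q = 1
  -- / (2 (s + 1))`; their unit distance becomes `1/p + 1/q = 2`.
  have hp : 0 < 1 / (2 * -s) := by positivity
  have hq : 0 < 1 / (2 * (s + 1)) := by positivity
  refine ⟨c, n, 1 / (2 * -s), 1 / (2 * (s + 1)), t, hc, hn, hp, hq, ?_, ?_, ?_, h2, h3⟩
  · have := hs0.ne
    field_simp
    ring
  · have := disk_map_inversion hc0 hp
    rw [h0, ← SidedCurve.map_inversion_inversion (disk _ _), this]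
    congr 2
    have := hs0.ne
    field_simp
  · have := disk_map_inversion (neg_ne_zero.2 hc0) hq
    rw [mul_neg, neg_neg, norm_neg] at this
    rw [h1', ← SidedCurve.map_inversion_inversion (disk _ _), this]
    congr 2
    field_simp

lemma le_of_disjoint_lowerHalf {a n : ℂ} {r t : ℝ} (hr : 0 < r) (hn : ‖n‖ = 1)
    (h : Disjoint (disk a r).inside (lowerHalf n t).inside) : t ≤ coord n a - r := by
  by_contra hcon
  rw [not_le] at hcon
  obtain ⟨s, hs1, hs2⟩ := exists_between (show max (coord n a - t) 0 < r from
    max_lt (by linarith) hr)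
  have hs0 : 0 < s := (le_max_right _ _).trans_lt hs1
  have hs3 := (le_max_left _ _).trans_lt hs1
  have hm : ((a + ((-s : ℝ) : ℂ) * n : ℂ) : Sphere) ∈ (disk a r).inside := by
    refine coe_mem_coe_image.2 ?_
    rw [mem_ball_iff_norm, add_sub_cancel_left, norm_mul, hn, Complex.norm_real, norm_neg,
      Real.norm_of_nonneg hs0.le, mul_one]
    exact hs2
  refine Set.disjoint_left.1 h hm (coe_mem_coe_image.2 ?_)
  rw [Set.mem_ofPred_eq, coord_add, coord_real_mul, coord_self, hn]
  linarith

lemma le_of_disjoint_upperHalf {a n : ℂ} {r t : ℝ} (hr : 0 < r) (hn : ‖n‖ = 1)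
    (h : Disjoint (disk a r).inside (upperHalf n t).inside) : coord n a + r ≤ t := by
  rw [upperHalf_eq] at h
  have := le_of_disjoint_lowerHalf hr (by rwa [norm_neg]) h
  rw [coord_neg_left] at this
  linarith

/-- Circles with centers `-c`, `c` that meet at `0`, between the lines of height `-t` and `t`. -/
noncomputable def stripConfig (c n : ℂ) (t : ℝ) : Config :=
  ![disk (-c) ‖c‖, disk c ‖c‖, lowerHalf n (-t), upperHalf n t]

theorem IsClassicalConfig.height_ge {l : ℂ} (hl : l ≠ 0) {X : Config}
    (hX : IsClassicalConfig S (T l) X) :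
    ∃ c n : ℂ, c.re = 1 ∧ ‖n‖ = 1 ∧ ‖c‖ + |coord n c| ≤ coord n l ∧
      (coord n l = ‖c‖ + |coord n c| → X = stripConfig c n (‖c‖ + |coord n c|)) := by
  obtain ⟨c, n, p, q, t, hc, hn, hp, hq, hpq, h0, h1, h2, h3⟩ := hX.exists_standard hl
  have hdis := hX.isSchottkyConfig.disjoint_inside
  have hR := norm_pos_of_re_eq_one hc
  have d02 := hdis 0 2 (by decide)
  have d03 := hdis 0 3 (by decide)
  have d12 := hdis 1 2 (by decide)
  have d13 := hdis 1 3 (by decide)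
  have hk : coord n (2 * l) = 2 * coord n l := by
    have := coord_real_mul n l 2
    push_cast at this
    exact this
  rw [h0, h2] at d02
  rw [h0, h3] at d03
  rw [h1, h2] at d12
  rw [h1, h3] at d13
  have i1 := le_of_disjoint_lowerHalf (by positivity) hn d02
  have i2 := le_of_disjoint_upperHalf (by positivity) hn d03
  have i3 := le_of_disjoint_lowerHalf (by positivity) hn d12
  have i4 := le_of_disjoint_upperHalf (by positivity) hn d13
  simp only [coord_neg, coord_real_mul, hk] at i1 i2 i3 i4
  -- From `(p + q)² ≥ 4 p q = 2 (p + q)`.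
  have hsum : 2 ≤ p + q := by nlinarith [sq_nonneg (p - q)]
  have hA : 0 < ‖c‖ + |coord n c| := by positivity
  -- The sign of `coord n c` tells which disc comes closer to which line; the two matching
  -- inequalities add up.
  have hW : (p + q) * (‖c‖ + |coord n c|) ≤ 2 * coord n l := by
    rcases abs_cases (coord n c) with h | h <;> rw [h.1] <;> linarith
  refine ⟨c, n, hc, hn, by nlinarith, fun he => ?_⟩
  have hsum' : p + q = 2 := by
    rw [he] at hW
    exact le_antisymm (le_of_mul_le_mul_right hW hA) hsum
  have hp1 : p = 1 := by
    have : (p - 1) ^ 2 = 0 := by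
      have : q = 2 - p := by linarith
      rw [this] at hpq
      nlinarith
    linarith [pow_eq_zero_iff two_ne_zero |>.1 this]
  have hq1 : q = 1 := by linarith
  rw [hp1] at i1 i2 h0
  rw [hq1] at i3 i4 h1
  rw [he] at i2 i4 hk
  have ht : t = -(‖c‖ + |coord n c|) := by
    rcases abs_cases (coord n c) with h | h <;> rw [h.1] at i2 i4 ⊢ <;> linarith
  simp only [Complex.ofReal_one, one_mul] at h0 h1
  rw [hk, ht] at h3
  rw [ht] at h2
  funext i
  fin_cases i
  · exact h0
  · exact h1
  · exact h2
  · rw [show -(‖c‖ + |coord n c|) + 2 * (‖c‖ + |coord n c|) = ‖c‖ + |coord n c| by ring] at h3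
    exact h3

lemma isFrame_rotate {n : ℂ} (hn : ‖n‖ = 1) : IsFrame (Complex.I * n) n :=
  ⟨by rw [norm_mul, Complex.norm_I, hn, mul_one], hn, by simp [coord_eq]; ring⟩

lemma abs_coord_le {n : ℂ} (hn : ‖n‖ = 1) (z : ℂ) : |coord n z| ≤ ‖z‖ := by
  apply abs_le_of_sq_le_sq _ (norm_nonneg _)
  rw [(isFrame_rotate hn).sq_norm z]
  nlinarith [sq_nonneg (coord (Complex.I * n) z)]

/-- A level line is the graph of a constant, so this is a case of `graphConfig`. -/
theorem stripConfig_isClassical {l c n : ℂ} (hc : c.re = 1) (hn : ‖n‖ = 1)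
    (h : ‖c‖ + |coord n c| ≤ coord n l) :
    IsClassicalConfig S (T l) (stripConfig c n (coord n l)) := by
  have hR := norm_pos_of_re_eq_one hc
  have hk : coord n (2 * l) = 2 * coord n l := by
    have := coord_real_mul n l 2
    push_cast at this
    exact this
  have hlow : lowered l (Complex.I * n) n (fun _ => coord n l) = fun _ => -coord n l := by
    funext x; rw [lowered, hk]; ring
  have hab := abs_le.1 (le_refl |coord n c|)
  have hball : ∀ z ∈ Metric.ball (-c) ‖c‖ ∪ Metric.ball c ‖c‖,
      -coord n l ≤ coord n z ∧ coord n z ≤ coord n l := by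
    rintro z (hz | hz) <;> rw [mem_ball_iff_norm] at hz <;>
      have h1 := abs_le.1 ((abs_coord_le hn _).trans hz.le)
    · rw [coord_sub, coord_neg] at h1
      constructor <;> linarith
    · rw [coord_sub] at h1
      constructor <;> linarith
  have hcfg : graphConfig l c (Complex.I * n) n (fun _ => coord n l) =
      stripConfig c n (coord n l) := by
    rw [graphConfig, hlow]; rfl
  refine ⟨?_, ?_⟩
  · rw [← hcfg]
    refine graphConfig_isSchottkyConfig (isFrame_rotate hn) hc continuous_const
      ⟨{(coord n l, 0)}, fun x => ⟨_, Finset.mem_singleton_self _, by ring⟩⟩ ?_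
      (fun z hz => (hball z hz).2) ?_
    · rw [hlow]
      have := abs_nonneg (coord n c)
      intro _; dsimp only; linarith
    · rw [hlow]
      exact fun z hz => (hball z hz).1
  · have hn0 : n ≠ 0 := by rintro rfl; simp at hn
    intro i
    fin_cases i
    · exact Or.inl ⟨-c, ‖c‖, hR, rfl⟩
    · exact Or.inl ⟨c, ‖c‖, hR, rfl⟩
    · exact Or.inr ⟨n, _, hn0, rfl⟩
    · exact Or.inr ⟨n, _, hn0, rfl⟩

/-! ### Points of tangency -/

lemma tangencyPoints_eq (X : Config) : tangencyPoints X =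
    (X 0).curve ∩ (X 1).curve ∪ (X 0).curve ∩ (X 2).curve ∪ (X 0).curve ∩ (X 3).curve ∪
    (X 1).curve ∩ (X 2).curve ∪ (X 1).curve ∩ (X 3).curve ∪ (X 2).curve ∩ (X 3).curve := by
  ext w
  constructor
  · rintro ⟨i, j, hij, hi, hj⟩
    revert hi hj
    refine forall_ne_fin_four (P := fun i j => w ∈ (X i).curve → w ∈ (X j).curve → _)
      (fun i j h h1 h2 => h h2 h1) ?_ ?_ ?_ ?_ ?_ ?_ i j hij <;>
      intro h1 h2 <;> simp [h1, h2]
  · rintro (((((h | h) | h) | h) | h) | h)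
    · exact ⟨0, 1, by decide, h⟩
    · exact ⟨0, 2, by decide, h⟩
    · exact ⟨0, 3, by decide, h⟩
    · exact ⟨1, 2, by decide, h⟩
    · exact ⟨1, 3, by decide, h⟩
    · exact ⟨2, 3, by decide, h⟩

lemma circle_inter_line (a n : ℂ) (r h : ℝ) :
    circleCurve a r ∩ (insert ∞ ((fun z : ℂ => (z : Sphere)) '' levelLine n h)) =
      (fun z : ℂ => (z : Sphere)) '' (Metric.sphere a r ∩ levelLine n h) := by
  ext w
  constructor
  · rintro ⟨⟨z, hz, rfl⟩, h | h⟩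
    · exact absurd h (OnePoint.coe_ne_infty z)
    · exact ⟨z, ⟨hz, coe_mem_coe_image.1 h⟩, rfl⟩
  · rintro ⟨z, ⟨hz, hz'⟩, rfl⟩
    exact ⟨⟨z, hz, rfl⟩, Or.inr ⟨z, hz', rfl⟩⟩

lemma sphere_inter_line_empty {a n : ℂ} (hn : ‖n‖ = 1) {r h : ℝ} (hlt : r < |h - coord n a|) :
    Metric.sphere a r ∩ levelLine n h = ∅ := by
  rw [Set.eq_empty_iff_forall_notMem]
  rintro z ⟨hz, hz'⟩
  rw [mem_sphere_iff_norm] at hz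
  rw [mem_levelLine] at hz'
  have := abs_coord_le hn (z - a)
  rw [coord_sub, hz', hz] at this
  linarith

lemma sphere_inter_line_eq {a n : ℂ} (hn : ‖n‖ = 1) {r h s : ℝ} (hs : s = 1 ∨ s = -1) (hr : 0 ≤ r)
    (hh : h = coord n a + s * r) :
    Metric.sphere a r ∩ levelLine n h = {a + ((s * r : ℝ) : ℂ) * n} := by
  ext z
  constructor
  · rintro ⟨hz, hz'⟩
    rw [mem_sphere_iff_norm] at hz
    rw [mem_levelLine] at hz'
    have h1 := (isFrame_rotate hn).sq_norm (z - a)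
    have h2 := sign_mul_self hs
    have h3 := (isFrame_rotate hn).coord_left
    rw [hz, coord_sub n, hz', hh] at h1
    have h4 : coord (Complex.I * n) (z - a) = 0 := by
      apply pow_eq_zero_iff two_ne_zero |>.1
      linear_combination -h1 - r ^ 2 * h2
    apply (isFrame_rotate hn).ext
    · rw [coord_add, coord_real_mul, h3]
      rw [coord_sub] at h4
      linarith
    · rw [coord_add, coord_real_mul, coord_self, hn, hz', hh]
      ring
  · rintro rfl
    constructor
    · rw [mem_sphere_iff_norm, add_sub_cancel_left, norm_mul, hn, Complex.norm_real,
        Real.norm_eq_abs, abs_mul, sign_abs hs, abs_of_nonneg hr]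
      ring
    · rw [mem_levelLine, coord_add, coord_real_mul, coord_self, hn, hh]
      ring

lemma lines_inter {n : ℂ} {t t' : ℝ} (h : t < t') :
    (lowerHalf n t).curve ∩ (upperHalf n t').curve = {∞} :=
  graphCurve_inter (d := n) (n := n) (fun _ => h)

lemma tangencyPoints_stripConfig (c n : ℂ) {t : ℝ} (ht : 0 < t) :
    tangencyPoints (stripConfig c n t) = insert ∞ ((fun z : ℂ => (z : Sphere)) '' ({0} ∪
      (Metric.sphere (-c) ‖c‖ ∩ levelLine n (-t)) ∪ (Metric.sphere (-c) ‖c‖ ∩ levelLine n t) ∪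
      (Metric.sphere c ‖c‖ ∩ levelLine n (-t)) ∪ (Metric.sphere c ‖c‖ ∩ levelLine n t))) := by
  have h01 : (stripConfig c n t 0).curve ∩ (stripConfig c n t 1).curve =
      (fun z : ℂ => (z : Sphere)) '' {0} := by
    show circleCurve (-c) ‖c‖ ∩ circleCurve c ‖c‖ = _
    rw [circleCurve_inter_eq (norm_neg_sub_self c), Set.image_singleton]
    simp
  rw [tangencyPoints_eq, h01]
  rw [show (stripConfig c n t 0).curve ∩ (stripConfig c n t 2).curve = _ from
      circle_inter_line _ _ _ _,
    show (stripConfig c n t 0).curve ∩ (stripConfig c n t 3).curve = _ from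
      circle_inter_line _ _ _ _,
    show (stripConfig c n t 1).curve ∩ (stripConfig c n t 2).curve = _ from
      circle_inter_line _ _ _ _,
    show (stripConfig c n t 1).curve ∩ (stripConfig c n t 3).curve = _ from
      circle_inter_line _ _ _ _,
    show (stripConfig c n t 2).curve ∩ (stripConfig c n t 3).curve = _ from
      lines_inter (by linarith)]
  rw [Set.union_singleton, Set.image_union, Set.image_union, Set.image_union, Set.image_union]

lemma ncard_insert_infty {A : Set ℂ} (hA : A.Finite) :
    (insert ∞ ((fun z : ℂ => (z : Sphere)) '' A)).ncard = A.ncard + 1 := by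
  rw [Set.ncard_insert_of_notMem infty_notMem_coe_image (hA.image _),
    Set.ncard_image_of_injective _ OnePoint.coe_injective]

lemma ncard_tangencyPoints_of_gt {c n : ℂ} (hn : ‖n‖ = 1) {t : ℝ} (ht : ‖c‖ + |coord n c| < t) :
    (tangencyPoints (stripConfig c n t)).ncard = 2 := by
  have h1 := abs_le.1 (le_refl |coord n c|)
  have h2 := norm_nonneg c
  rw [tangencyPoints_stripConfig c n (by linarith [abs_nonneg (coord n c)]),
    sphere_inter_line_empty hn, sphere_inter_line_empty hn, sphere_inter_line_empty hn,
    sphere_inter_line_empty hn]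
  · simp only [Set.union_empty]
    rw [ncard_insert_infty (Set.finite_singleton _), Set.ncard_singleton]
  · rw [lt_abs]; left; linarith
  · rw [lt_abs]; right; linarith
  · rw [coord_neg, lt_abs]; left; linarith
  · rw [coord_neg, lt_abs]; right; linarith

lemma ncard_four {q : ℂ} (hq : q ≠ 0) :
    (insert ∞ ((fun z : ℂ => (z : Sphere)) '' ({0, -q, q} : Set ℂ))).ncard = 4 := by
  rw [ncard_insert_infty (Set.toFinite _), Set.ncard_insert_of_notMem, Set.ncard_pair]
  · exact fun h => hq (CharZero.neg_eq_self_iff.1 h)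
  · simp [hq, hq.symm]

lemma ncard_six {q r : ℂ} (hq : q ≠ 0) (hr : r ≠ 0) (h₁ : q ≠ r) (h₂ : q ≠ -r) :
    (insert ∞ ((fun z : ℂ => (z : Sphere)) '' ({0, -q, q, -r, r} : Set ℂ))).ncard = 6 := by
  have h₃ : -q ≠ r := fun h => h₂ (by rw [← h, neg_neg])
  rw [ncard_insert_infty (Set.toFinite _), Set.ncard_insert_of_notMem,
    Set.ncard_insert_of_notMem, Set.ncard_insert_of_notMem, Set.ncard_pair]
  · exact fun h => hr (CharZero.neg_eq_self_iff.1 h)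
  · simp [h₁, h₂]
  · simp only [Set.mem_insert_iff, Set.mem_singleton_iff, not_or, neg_inj]
    exact ⟨fun h => hq (CharZero.neg_eq_self_iff.1 h), h₁, h₃⟩
  · simp [hq, hr, hq.symm, hr.symm]

/-- The contacts are symmetric under `z ↦ -z`. If `coord n c = 0`, each circle touches both lines;
otherwise each touches only the line on the side of its center. The points `0` and `∞` complete the
count. -/
lemma ncard_tangencyPoints_of_eq {c n : ℂ} (hc : c ≠ 0) (hn : ‖n‖ = 1) :
    (tangencyPoints (stripConfig c n (‖c‖ + |coord n c|))).ncard =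
      if coord n c = 0 then 6 else 4 := by
  have hR := norm_pos_iff.2 hc
  have hval (s : ℝ) : coord n (c + ((s * ‖c‖ : ℝ) : ℂ) * n) = coord n c + s * ‖c‖ := by
    rw [coord_add, coord_real_mul, coord_self, hn]; ring
  have hz : coord n 0 = 0 := by simp [coord]
  rw [tangencyPoints_stripConfig c n (by positivity)]
  have hneg (s : ℝ) : -c + ((-s * ‖c‖ : ℝ) : ℂ) * n = -(c + ((s * ‖c‖ : ℝ) : ℂ) * n) := by
    push_cast; ring
  rcases lt_trichotomy (coord n c) 0 with hP | hP | hP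
  · rw [if_neg hP.ne, abs_of_neg hP]
    rw [sphere_inter_line_empty (a := -c) hn (h := -(‖c‖ + -coord n c)),
      sphere_inter_line_eq (a := -c) hn (s := - -1) (by norm_num) hR.le,
      sphere_inter_line_eq (a := c) hn (s := -1) (by norm_num) hR.le,
      sphere_inter_line_empty (a := c) hn (h := ‖c‖ + -coord n c), hneg]
    · refine (congrArg (fun A : Set ℂ => (insert ∞ ((fun z : ℂ => (z : Sphere)) '' A)).ncard)
        ?_).trans (ncard_four (q := c + ((-1 * ‖c‖ : ℝ) : ℂ) * n) ?_)
      · ext z; simp only [Set.mem_union, Set.mem_singleton_iff, Set.mem_insert_iff,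
          Set.mem_empty_iff_false]; tauto
      · intro h
        have := hval (-1)
        rw [h, hz] at this
        linarith
    · rw [lt_abs]; left; linarith
    · ring
    · rw [coord_neg]; ring
    · rw [coord_neg, lt_abs]; right; linarith
  · rw [if_pos hP, hP, abs_zero, add_zero]
    rw [sphere_inter_line_eq (a := -c) hn (s := -1) (by norm_num) hR.le,
      sphere_inter_line_eq (a := -c) hn (s := - -1) (by norm_num) hR.le,
      sphere_inter_line_eq (a := c) hn (s := -1) (by norm_num) hR.le,
      sphere_inter_line_eq (a := c) hn (s := 1) (by norm_num) hR.le, hneg, hneg]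
    · refine (congrArg (fun A : Set ℂ => (insert ∞ ((fun z : ℂ => (z : Sphere)) '' A)).ncard)
        ?_).trans (ncard_six (q := c + ((1 * ‖c‖ : ℝ) : ℂ) * n) (r := c + ((-1 * ‖c‖ : ℝ) : ℂ) * n)
        ?_ ?_ ?_ ?_)
      · ext z; simp only [Set.mem_union, Set.mem_singleton_iff, Set.mem_insert_iff]; tauto
      · intro h
        have := hval 1
        rw [h, hz] at this
        linarith
      · intro h
        have := hval (-1)
        rw [h, hz] at this
        linarith
      · intro h
        have h1 := hval 1
        rw [h, hval] at h1
        linarith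
      · intro h
        have h1 : (2 : ℂ) * c = 0 := by
          push_cast at h
          linear_combination h
        exact hc (by simpa using h1)
    · rw [hP]; ring
    · rw [hP]; ring
    · rw [coord_neg, hP]; ring
    · rw [coord_neg, hP]; ring
  · rw [if_neg hP.ne', abs_of_pos hP]
    rw [sphere_inter_line_eq (a := -c) hn (s := -1) (by norm_num) hR.le,
      sphere_inter_line_empty (a := -c) hn (h := ‖c‖ + coord n c),
      sphere_inter_line_empty (a := c) hn (h := -(‖c‖ + coord n c)),
      sphere_inter_line_eq (a := c) hn (s := 1) (by norm_num) hR.le, hneg]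
    · refine (congrArg (fun A : Set ℂ => (insert ∞ ((fun z : ℂ => (z : Sphere)) '' A)).ncard)
        ?_).trans (ncard_four (q := c + ((1 * ‖c‖ : ℝ) : ℂ) * n) ?_)
      · ext z; simp only [Set.mem_union, Set.mem_singleton_iff, Set.mem_insert_iff,
          Set.mem_empty_iff_false]; tauto
      · intro h
        have := hval 1
        rw [h, hz] at this
        linarith
    · ring
    · rw [lt_abs]; right; linarith
    · rw [coord_neg, lt_abs]; left; linarith
    · rw [coord_neg]; ring

/-! ### Classical Schottky space -/

/-- The inequality behind the description of the classical space, with the cases of equality;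
`(u, v)` is the direction of the lines, `(1, s)` the center of a circle. -/
lemma parabola_le {x y u v s R : ℝ} (huv : u ^ 2 + v ^ 2 = 1) (hR : R ^ 2 = 1 + s ^ 2) (hR0 : 0 ≤ R)
    (h : R + |u + s * v| ≤ x * u + y * v) :
    1 - x ^ 2 / 4 ≤ |y| ∧ (|y| = 1 - x ^ 2 / 4 → x * u + y * v = R + |u + s * v| ∧
      (|x| < 2 → u + s * v = 0) ∧ (|x| = 2 → s * u + v = 0 ∧ |v| ≤ |u| ∧ 0 < x * u)) := by
  have hx : x * u ≤ |x| * |u| := by rw [← abs_mul]; exact le_abs_self _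
  have hy : y * v ≤ |y| * |v| := by rw [← abs_mul]; exact le_abs_self _
  have hx2 : x ^ 2 = |x| ^ 2 := (sq_abs x).symm
  have huv' : |u| ^ 2 + |v| ^ 2 = 1 := by rw [sq_abs, sq_abs]; exact huv
  have hx0 := abs_nonneg x
  have hy0 := abs_nonneg y
  have hu0 := abs_nonneg u
  have hv0 := abs_nonneg v
  -- Cauchy–Schwarz: `(u - s v)² + (s u + v)² = (1 + s²) (u² + v²)`.
  have f1 : |u - s * v| ≤ R := by
    apply abs_le_of_sq_le_sq _ hR0
    rw [hR]
    nlinarith [sq_nonneg (s * u + v)]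
  have f2 : 2 * |u| ≤ |u - s * v| + |u + s * v| := by
    have := abs_add_le (u - s * v) (u + s * v)
    rw [show u - s * v + (u + s * v) = 2 * u by ring, abs_mul, abs_two] at this
    exact this
  -- The number `1` is the first coordinate of `(1, s)`, expanded in the frame `(u, v)`, `(-v, u)`;
  -- the second component is at most `R`.
  have f3 : 1 ≤ |u + s * v| * |u| + R * |v| := by
    have h1 : |s * u - v| ≤ R := by
      apply abs_le_of_sq_le_sq _ hR0
      rw [hR]
      nlinarith [sq_nonneg (u + s * v)]
    have h2 : (u + s * v) * u - (s * u - v) * v = 1 := by linear_combination huv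
    have h3 : (u + s * v) * u ≤ |u + s * v| * |u| := by rw [← abs_mul]; exact le_abs_self _
    have h4 : -((s * u - v) * v) ≤ |s * u - v| * |v| := by rw [← abs_mul]; exact neg_le_abs _
    nlinarith
  have hP0 := abs_nonneg (u + s * v)
  -- Steep normals give the parabola by completing a square. The others give only `2 - |x| ≤ |y|`,
  -- whose boundary is tangent to the parabolas at `±2`.
  rcases lt_or_ge |u| |v| with hlt | hge
  · have hv : 0 < |v| := hu0.trans_lt hlt
    have g1 : |v| * (R + |u + s * v|) ≤ |v| * (|x| * |u| + |y| * |v|) :=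
      mul_le_mul_of_nonneg_left (by linarith) hv0
    have g2 : |u + s * v| * |u| ≤ |u + s * v| * |v| := mul_le_mul_of_nonneg_left hlt.le hP0
    have g3 : (1 - x ^ 2 / 4) * |v| ^ 2 + (|u| - |x| * |v| / 2) ^ 2 =
      1 - |v| * (|x| * |u|) := by rw [hx2]; linear_combination huv'
    constructor
    · have h5 : (1 - x ^ 2 / 4) * |v| ^ 2 ≤ |y| * |v| ^ 2 := by
        linarith [sq_nonneg (|u| - |x| * |v| / 2)]
      exact le_of_mul_le_mul_right h5 (by positivity)
    · intro he
      rw [← he] at g3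
      -- Equality makes both nonnegative terms vanish: the circles are centered on the middle line
      -- of the strip, and the direction of the normal is determined.
      have key : |u + s * v| * (|v| - |u|) + (|u| - |x| * |v| / 2) ^ 2 ≤ 0 := by linarith
      have hm : 0 ≤ |u + s * v| * (|v| - |u|) := mul_nonneg hP0 (sub_nonneg.2 hlt.le)
      have hq := sq_nonneg (|u| - |x| * |v| / 2)
      have hP : |u + s * v| = 0 :=
        (mul_eq_zero.1 (le_antisymm (by linarith) hm)).resolve_right (sub_pos.2 hlt).ne'
      have hsq : (|u| - |x| * |v| / 2) ^ 2 ≤ 0 := by linarith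
      refine ⟨?_, fun _ => abs_eq_zero.1 hP, fun h2 => ?_⟩
      · apply le_antisymm _ h
        have : |v| * (x * u + y * v) ≤ |v| * (R + |u + s * v|) := by
          have := mul_le_mul_of_nonneg_left (add_le_add hx hy) hv0
          linarith
        exact le_of_mul_le_mul_left this hv
      · exfalso
        rw [h2] at hsq
        have := pow_eq_zero_iff two_ne_zero |>.1 (le_antisymm hsq (sq_nonneg _))
        linarith
  · have hu : 0 < |u| := by
      by_contra hc
      have h1 : |u| = 0 := le_antisymm (not_lt.1 hc) hu0
      have h2 : |v| = 0 := le_antisymm (h1 ▸ hge) hv0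
      rw [h1, h2] at huv'
      norm_num at huv'
    have g1 : 2 * |u| ≤ |x| * |u| + |y| * |v| := by linarith
    have g2 : |y| * |v| ≤ |y| * |u| := mul_le_mul_of_nonneg_left hge hy0
    have g3 : 2 - |x| ≤ |y| := by
      have : (2 - |x|) * |u| ≤ |y| * |u| := by linarith
      exact le_of_mul_le_mul_right this hu
    rw [hx2]
    constructor
    · linarith [sq_nonneg (|x| - 2)]
    · intro he
      refine ⟨?_, fun hlt => ?_, fun h2 => ?_⟩
      · have hx2 : |x| = 2 := by
          have : (|x| - 2) ^ 2 ≤ 0 := by linarith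
          linarith [pow_eq_zero_iff two_ne_zero |>.1 (le_antisymm this (sq_nonneg _))]
        rw [hx2] at he hx
        have : |y| = 0 := by rw [he]; norm_num
        rw [this] at hy
        linarith
      · exfalso
        have : 0 < (2 - |x|) ^ 2 := pow_pos (sub_pos.2 hlt) 2
        linarith
      · rw [h2] at he hx
        have hyz : |y| = 0 := by rw [he]; norm_num
        rw [hyz] at hy
        have e1 : R = |u - s * v| := by linarith
        have e2 : |u - s * v| + |u + s * v| = 2 * |u| := by linarith
        have e3 : s * u + v = 0 := by
          have h4 : R ^ 2 = (u - s * v) ^ 2 := by rw [e1, sq_abs]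
          have h5 : (s * u + v) ^ 2 = 0 := by
            linear_combination (1 + s ^ 2) * huv + h4 - hR
          exact pow_eq_zero_iff two_ne_zero |>.1 h5
        have e4 : 0 < x * u := by
          have := y * v
          have : 0 < R + |u + s * v| := by linarith
          linarith
        exact ⟨e3, hge, e4⟩

lemma coord_of_re_eq_one {c : ℂ} (hc : c.re = 1) (n : ℂ) : coord n c = n.re + c.im * n.im := by
  rw [coord_eq, hc]; ring

/-- Circles touching two parallel lines, whose distance is at most the height of the
translation. -/
theorem exists_strip (l : ℂ) : ∃ c n : ℂ, c.re = 1 ∧ ‖n‖ = 1 ∧ coord n c = 0 ∧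
    (1 - l.re ^ 2 / 4 ≤ |l.im| → ‖c‖ ≤ coord n l) ∧
    (1 - l.re ^ 2 / 4 < |l.im| → ‖c‖ < coord n l) := by
  obtain ⟨σ, hσ, hY⟩ : ∃ σ : ℝ, (σ = 1 ∨ σ = -1) ∧ |l.im| = σ * l.im := by
    rcases abs_cases l.im with h | h
    · exact ⟨1, Or.inl rfl, by linarith [h.1]⟩
    · exact ⟨-1, Or.inr rfl, by linarith [h.1]⟩
  have hσσ := sign_mul_self hσ
  -- The equality case `u + s v = 0`, `|u| = |x| |v| / 2` of `parabola_le` suggests this center and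
  -- a normal perpendicular to it. Then `‖c‖ ≤ coord n l` reads `1 + x² / 4 ≤ x² / 2 + |y|`.
  set c : ℂ := ⟨1, -(σ * l.re / 2)⟩ with hcd
  have hc : c.re = 1 := rfl
  have hR := norm_pos_of_re_eq_one hc
  have hR2 : ‖c‖ ^ 2 = 1 + l.re ^ 2 / 4 := by
    rw [norm_sq_eq, hcd]
    linear_combination l.re ^ 2 / 4 * hσσ
  have hco : coord (((σ / ‖c‖ : ℝ) : ℂ) * (Complex.I * c)) l = (l.re ^ 2 / 2 + |l.im|) / ‖c‖ := by
    rw [coord_real_mul_left, coord_eq, hcd]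
    simp
    rw [hY]
    linear_combination (l.re ^ 2 / (2 * ‖c‖)) * hσσ
  refine ⟨c, ((σ / ‖c‖ : ℝ) : ℂ) * (Complex.I * c), hc, ?_, ?_, ?_, ?_⟩
  · rw [norm_mul, norm_mul, Complex.norm_I, Complex.norm_real, Real.norm_eq_abs, abs_div,
      sign_abs hσ, abs_norm]
    field_simp
  · rw [coord_real_mul_left, coord_eq]
    simp
    ring_nf
    simp
  · intro h
    rw [hco, le_div_iff₀ hR, ← sq, hR2]
    linarith
  · intro h
    rw [hco, lt_div_iff₀ hR, ← sq, hR2]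
    linarith

theorem classicalTSchottkySpace_eq :
    classicalTSchottkySpace = {l : ℂ | 1 - l.re ^ 2 / 4 ≤ |l.im|} := by
  ext l
  constructor
  · rintro ⟨hl, X, hX⟩
    obtain ⟨c, n, hc, hn, hle, -⟩ := hX.height_ge hl
    rw [coord_of_re_eq_one hc, coord_eq] at hle
    have hn2 := norm_sq_eq n
    have hc2 := norm_sq_eq c
    rw [hn] at hn2
    rw [hc] at hc2
    exact (parabola_le (by linarith) (by linarith) (norm_nonneg c) hle).1
  · intro h
    have h : 1 - l.re ^ 2 / 4 ≤ |l.im| := h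
    have hl : l ≠ 0 := by
      rintro rfl
      norm_num at h
    obtain ⟨c, n, hc, hn, h0, h1, -⟩ := exists_strip l
    refine ⟨hl, _, stripConfig_isClassical hc hn ?_⟩
    rw [h0, abs_zero, add_zero]
    exact h1 h

lemma interior_classicalTSchottkySpace :
    interior classicalTSchottkySpace = {l : ℂ | 1 - l.re ^ 2 / 4 < |l.im|} := by
  rw [classicalTSchottkySpace_eq]
  apply Set.Subset.antisymm
  · intro l hl
    have hm : l ∈ {l : ℂ | 1 - l.re ^ 2 / 4 ≤ |l.im|} := interior_subset hl
    have h : 1 - l.re ^ 2 / 4 ≤ |l.im| := hm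
    refine lt_of_le_of_ne h fun he => ?_
    -- A point with equality leaves the set when it is shrunk by `t < 1`: the two sides then differ
    -- by `(1 - t) (1 + t x² / 4) > 0`.
    have hc : Filter.Tendsto (fun t : ℝ => (t : ℂ) * l) (nhds 1) (nhds l) := by
      have : Continuous fun t : ℝ => (t : ℂ) * l := by fun_prop
      simpa using this.tendsto 1
    have ev := (hc.eventually (isOpen_interior.mem_nhds hl)).and (lt_mem_nhds (one_pos (α := ℝ)))
    obtain ⟨t, ⟨ht, ht0⟩, ht1⟩ := ((ev.filter_mono nhdsWithin_le_nhds).and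
      (self_mem_nhdsWithin : Set.Iio (1 : ℝ) ∈ nhdsWithin 1 (Set.Iio 1))).exists
    have ht1 : t < 1 := ht1
    have hm' : (t : ℂ) * l ∈ {l : ℂ | 1 - l.re ^ 2 / 4 ≤ |l.im|} := interior_subset ht
    have hm : 1 - ((t : ℂ) * l).re ^ 2 / 4 ≤ |((t : ℂ) * l).im| := hm'
    rw [Complex.re_ofReal_mul, Complex.im_ofReal_mul, abs_mul, abs_of_pos ht0, ← he] at hm
    have : 0 < (1 - t) * (1 + t * l.re ^ 2 / 4) := mul_pos (by linarith) (by positivity)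
    nlinarith
  · apply interior_maximal
    · intro l hl
      have hl : 1 - l.re ^ 2 / 4 < |l.im| := hl
      exact hl.le
    · exact isOpen_lt (by fun_prop) (by fun_prop)

lemma frontier_classicalTSchottkySpace :
    frontier classicalTSchottkySpace = schottkyParabolas := by
  have hcl : IsClosed classicalTSchottkySpace := by
    rw [classicalTSchottkySpace_eq]
    exact isClosed_le (by fun_prop) (by fun_prop)
  rw [frontier, hcl.closure_eq, interior_classicalTSchottkySpace, classicalTSchottkySpace_eq]
  ext l
  simp only [Set.mem_sdiff, Set.mem_ofPred_eq, schottkyParabolas, not_lt]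
  constructor
  · rintro ⟨h1, h2⟩
    have h3 := abs_nonneg l.im
    have h4 : l.re ^ 2 ≤ 2 ^ 2 := by linarith
    have := abs_le.1 (abs_le_of_sq_le_sq h4 (by norm_num))
    exact ⟨this.1, this.2, le_antisymm h2 h1⟩
  · rintro ⟨-, -, h⟩
    exact ⟨h.ge, h.le⟩

theorem exists_config_of_mem_interior {l : ℂ} (hl : l ∈ interior classicalTSchottkySpace) :
    ∃ (X : Config) (c : ℂ), IsClassicalConfig S (T l) X ∧ c.re = 1 ∧
      (X 0).curve = circleCurve (-c) ‖c‖ ∧ (X 1).curve = circleCurve c ‖c‖ ∧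
      (X 0).curve ∪ (X 1).curve ⊆ (X 2).outside ∩ (X 3).outside ∧
      (X 0).curve ∩ (X 1).curve = {((0 : ℂ) : Sphere)} ∧
      (X 2).curve ∩ (X 3).curve = {OnePoint.infty} ∧
      (tangencyPoints X).ncard = 2 := by
  have hl0 : l ≠ 0 := (interior_subset hl).1
  rw [interior_classicalTSchottkySpace] at hl
  obtain ⟨c, n, hc, hn, h0, -, h1⟩ := exists_strip l
  have h1 := h1 hl
  have hR := norm_pos_of_re_eq_one hc
  refine ⟨stripConfig c n (coord n l), c, stripConfig_isClassical hc hn ?_, hc, rfl, rfl, ?_, ?_, ?_,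
    ncard_tangencyPoints_of_gt hn ?_⟩
  · rw [h0, abs_zero, add_zero]; exact h1.le
  · have key (z a : ℂ) (ha : coord n a = 0) (hz : z ∈ Metric.sphere a ‖c‖) :
        (z : Sphere) ∈ (lowerHalf n (-coord n l)).outside ∩ (upperHalf n (coord n l)).outside := by
      rw [mem_sphere_iff_norm] at hz
      have h2 := abs_le.1 ((abs_coord_le hn (z - a)).trans hz.le)
      rw [coord_sub, ha, sub_zero] at h2
      constructor
      · rw [lowerHalf_outside]
        refine coe_mem_coe_image.2 ?_
        rw [Set.mem_ofPred_eq]; linarith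
      · rw [show (upperHalf n (coord n l)).outside = (lowerHalf n (coord n l)).inside from
          above_outside n n fun _ => coord n l]
        refine coe_mem_coe_image.2 ?_
        rw [Set.mem_ofPred_eq]; linarith
    rintro w (⟨z, hz, rfl⟩ | ⟨z, hz, rfl⟩)
    · exact key z (-c) (by rw [coord_neg, h0, neg_zero]) hz
    · exact key z c h0 hz
  · show circleCurve (-c) ‖c‖ ∩ circleCurve c ‖c‖ = _
    rw [circleCurve_inter_eq (norm_neg_sub_self c)]
    simp
  · exact lines_inter (by linarith)
  · rw [h0, abs_zero, add_zero]; exact h1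

theorem IsClassicalConfig.eq_stripConfig {l : ℂ} (hl : |l.im| = 1 - l.re ^ 2 / 4) {X : Config}
    (hX : IsClassicalConfig S (T l) X) :
    ∃ c n : ℂ, c.re = 1 ∧ ‖n‖ = 1 ∧ X = stripConfig c n (‖c‖ + |coord n c|) ∧
      (|l.re| < 2 → coord n c = 0) ∧
      (|l.re| = 2 → c.im * n.re + n.im = 0 ∧ |n.im| ≤ |n.re| ∧ 0 < l.re * n.re) := by
  have hl0 : l ≠ 0 := by rintro rfl; norm_num at hl
  obtain ⟨c, n, hc, hn, hle, h⟩ := hX.height_ge hl0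
  have hn2 := norm_sq_eq n
  have hc2 := norm_sq_eq c
  rw [hn] at hn2
  rw [hc] at hc2
  refine ⟨c, n, hc, hn, ?_⟩
  have hle' := hle
  rw [coord_of_re_eq_one hc, coord_eq] at hle'
  obtain ⟨h1, h2, h3⟩ := (parabola_le (by linarith) (by linarith) (norm_nonneg c) hle').2 hl
  refine ⟨h ?_, ?_, h3⟩
  · rw [coord_of_re_eq_one hc, coord_eq]; exact h1
  · rw [coord_of_re_eq_one hc]; exact h2

/-- The configurations for `l = 2` and `l = -2`. -/
noncomputable def cuspConfig (e τ : ℝ) : Config :=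
  stripConfig ⟨1, -τ⟩ ⟨e / √(1 + τ ^ 2), e * τ / √(1 + τ ^ 2)⟩ (2 / √(1 + τ ^ 2))

/-! ### The configurations at the parameters `±2`. -/

section

variable {e τ : ℝ}

lemma cusp_norm_normal (he : e = 1 ∨ e = -1) :
    ‖(⟨e / √(1 + τ ^ 2), e * τ / √(1 + τ ^ 2)⟩ : ℂ)‖ = 1 := by
  have h := Real.sq_sqrt (show 0 ≤ 1 + τ ^ 2 by positivity)
  have hpos : 0 < √(1 + τ ^ 2) := Real.sqrt_pos.2 (by positivity)
  have hee := sign_mul_self he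
  rw [norm_eq_iff_sq zero_le_one]
  field_simp
  rw [h]
  linear_combination (1 + τ ^ 2) * hee

lemma cusp_norm_center : ‖(⟨1, -τ⟩ : ℂ)‖ = √(1 + τ ^ 2) := by
  rw [norm_eq_iff_sq (Real.sqrt_nonneg _), Real.sq_sqrt (by positivity)]
  ring

lemma cusp_coord : coord ⟨e / √(1 + τ ^ 2), e * τ / √(1 + τ ^ 2)⟩ ⟨1, -τ⟩ =
    e * (1 - τ ^ 2) / √(1 + τ ^ 2) := by
  rw [coord_eq]; ring

lemma cusp_height (he : e = 1 ∨ e = -1) (hτ : |τ| ≤ 1) :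
    ‖(⟨1, -τ⟩ : ℂ)‖ + |coord ⟨e / √(1 + τ ^ 2), e * τ / √(1 + τ ^ 2)⟩ ⟨1, -τ⟩| =
      2 / √(1 + τ ^ 2) := by
  have h := Real.sq_sqrt (show 0 ≤ 1 + τ ^ 2 by positivity)
  have hpos : 0 < √(1 + τ ^ 2) := Real.sqrt_pos.2 (by positivity)
  have hτ2 : 0 ≤ 1 - τ ^ 2 := by
    have := (sq_le_one_iff_abs_le_one τ).2 hτ
    linarith
  rw [cusp_coord, cusp_norm_center, abs_div, abs_mul, sign_abs he, abs_of_nonneg hτ2,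
    abs_of_pos hpos]
  field_simp
  rw [h]
  ring

lemma cuspConfig_isClassical (he : e = 1 ∨ e = -1) (hτ : |τ| ≤ 1) :
    IsClassicalConfig S (T (2 * e)) (cuspConfig e τ) := by
  have hee := sign_mul_self he
  have h := cusp_height he hτ
  have h2 : coord ⟨e / √(1 + τ ^ 2), e * τ / √(1 + τ ^ 2)⟩ (2 * (e : ℂ)) = 2 / √(1 + τ ^ 2) := by
    rw [coord_eq]
    simp
    linear_combination 2 / √(1 + τ ^ 2) * hee
  rw [cuspConfig, ← h2]
  exact stripConfig_isClassical rfl (cusp_norm_normal he) (by rw [h, h2])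

lemma cuspConfig_ncard (he : e = 1 ∨ e = -1) (hτ : |τ| ≤ 1) :
    (tangencyPoints (cuspConfig e τ)).ncard = if |τ| = 1 then 6 else 4 := by
  have hpos : 0 < √(1 + τ ^ 2) := Real.sqrt_pos.2 (by positivity)
  have he0 : e ≠ 0 := by rcases he with rfl | rfl <;> norm_num
  rw [cuspConfig, ← cusp_height he hτ, ncard_tangencyPoints_of_eq _ (cusp_norm_normal he), cusp_coord]
  · have hiff : e * (1 - τ ^ 2) / √(1 + τ ^ 2) = 0 ↔ |τ| = 1 := by
      rw [div_eq_zero_iff, mul_eq_zero, or_iff_left hpos.ne', or_iff_right he0, sub_eq_zero,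
        eq_comm, sq_eq_one_iff, abs_eq zero_le_one]
    simp only [hiff]
  · intro h
    simpa using congrArg Complex.re h

/-- The second circle meets the imaginary axis at `0` and at `-2 τ i`, which recovers `τ`. For `τ =
0` these points coincide, so the argument is also run with the two parameters exchanged. -/
lemma cuspConfig_injective (e : ℝ) : Function.Injective (cuspConfig e) := by
  have key {τ τ' : ℝ} (h : cuspConfig e τ = cuspConfig e τ') : τ = 0 ∨ τ = τ' := by
    have h1 : circleCurve ⟨1, -τ⟩ ‖(⟨1, -τ⟩ : ℂ)‖ = circleCurve ⟨1, -τ'⟩ ‖(⟨1, -τ'⟩ : ℂ)‖ :=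
      congrArg (fun X : Config => (X 1).curve) h
    have h2 : ((⟨0, -(2 * τ)⟩ : ℂ) : Sphere) ∈ circleCurve ⟨1, -τ⟩ ‖(⟨1, -τ⟩ : ℂ)‖ := by
      refine coe_mem_coe_image.2 ?_
      rw [mem_sphere_iff_norm, norm_eq_iff_sq (norm_nonneg _), norm_sq_eq]
      simp
      ring
    rw [h1] at h2
    have h3 := coe_mem_coe_image.1 h2
    rw [mem_sphere_iff_norm, norm_eq_iff_sq (norm_nonneg _), norm_sq_eq] at h3
    simp only [Complex.sub_re, Complex.sub_im] at h3
    have h4 : τ * (τ - τ') = 0 := by linear_combination h3 / 4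
    rcases mul_eq_zero.1 h4 with h5 | h5
    · exact Or.inl h5
    · exact Or.inr (sub_eq_zero.1 h5)
  intro τ τ' h
  rcases key h with h1 | h1
  · rcases key h.symm with h2 | h2
    · rw [h1, h2]
    · exact h2.symm
  · exact h1

/-- The parameter is the slope of the normal. Equality in Cauchy–Schwarz, `c.im * n.re + n.im = 0`,
fixes `c`, and `0 < l.re * n.re` fixes the sign of `n`. -/
lemma IsClassicalConfig.eq_cuspConfig (he : e = 1 ∨ e = -1) {X : Config}
    (hX : IsClassicalConfig S (T (2 * e)) X) : ∃ τ : ℝ, |τ| ≤ 1 ∧ X = cuspConfig e τ := by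
  have hee := sign_mul_self he
  have hre : (2 * (e : ℂ)).re = 2 * e := by simp
  have him : (2 * (e : ℂ)).im = 0 := by simp
  obtain ⟨c, n, hc, hn, h, -, h2⟩ := hX.eq_stripConfig (by
    rw [hre, him, abs_zero]; linear_combination hee)
  rw [hre] at h2
  obtain ⟨h3, h4, h5⟩ := h2 (by rw [abs_mul, sign_abs he, abs_two, mul_one])
  have hn0 : n.re ≠ 0 := by
    intro h0
    rw [h0, mul_zero] at h5
    exact lt_irrefl _ h5
  have hen : 0 < e * n.re := by linarith
  have hn2 := norm_sq_eq n
  rw [hn] at hn2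
  set τ := n.im / n.re with hτ
  have hτn : n.im = τ * n.re := by rw [hτ]; field_simp
  have hτ1 : |τ| ≤ 1 := by
    rw [hτ, abs_div, div_le_one (abs_pos.2 hn0)]
    exact h4
  have hcτ : c = ⟨1, -τ⟩ := by
    apply Complex.ext
    · exact hc
    · show c.im = -τ
      have : (c.im + τ) * n.re = 0 := by rw [← h3, hτn]; ring
      have := (mul_eq_zero.1 this).resolve_right hn0
      linarith
  have hs : √(1 + τ ^ 2) = 1 / (e * n.re) := by
    rw [Real.sqrt_eq_iff_mul_self_eq (by positivity) (by positivity)]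
    have : e ^ 2 = 1 := by rw [sq]; exact hee
    field_simp
    rw [this]
    rw [hτn] at hn2
    linear_combination -hn2
  have hnτ : n = ⟨e / √(1 + τ ^ 2), e * τ / √(1 + τ ^ 2)⟩ := by
    apply Complex.ext
    · show n.re = e / √(1 + τ ^ 2)
      rw [hs, div_div_eq_mul_div, div_one]
      linear_combination -n.re * hee
    · show n.im = e * τ / √(1 + τ ^ 2)
      rw [hs, div_div_eq_mul_div, div_one, hτn]
      linear_combination -(τ * n.re) * hee
  refine ⟨τ, hτ1, ?_⟩
  rw [cuspConfig, ← cusp_height he hτ1, ← hcτ, ← hnτ]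
  exact h

theorem cusp_configs (he : e = 1 ∨ e = -1) :
    (∀ X : Config, IsClassicalConfig S (T (2 * e)) X →
      (tangencyPoints X).ncard = 4 ∨ (tangencyPoints X).ncard = 6) ∧
    {X : Config | IsClassicalConfig S (T (2 * e)) X ∧ (tangencyPoints X).ncard = 4}.Infinite ∧
    {X : Config | IsClassicalConfig S (T (2 * e)) X ∧ (tangencyPoints X).ncard = 6}.ncard = 2 := by
  refine ⟨?_, ?_, ?_⟩
  · intro X hX
    obtain ⟨τ, hτ, rfl⟩ := hX.eq_cuspConfig he
    rw [cuspConfig_ncard he hτ]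
    split_ifs
    · exact Or.inr rfl
    · exact Or.inl rfl
  · refine ((Set.Ioo_infinite (zero_lt_one (α := ℝ))).image
      (cuspConfig_injective e).injOn).mono ?_
    rintro _ ⟨τ, ⟨h0, h1⟩, rfl⟩
    have hτ : |τ| = τ := abs_of_pos h0
    refine ⟨cuspConfig_isClassical he (by rw [hτ]; exact h1.le), ?_⟩
    rw [cuspConfig_ncard he (by rw [hτ]; exact h1.le), if_neg (by rw [hτ]; exact h1.ne)]
  · have : {X : Config | IsClassicalConfig S (T (2 * e)) X ∧ (tangencyPoints X).ncard = 6} =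
        {cuspConfig e 1, cuspConfig e (-1)} := by
      ext X
      constructor
      · rintro ⟨hX, h6⟩
        obtain ⟨τ, hτ, rfl⟩ := hX.eq_cuspConfig he
        rw [cuspConfig_ncard he hτ] at h6
        have h1 : |τ| = 1 := by
          by_contra hne
          rw [if_neg hne] at h6
          norm_num at h6
        rcases eq_or_eq_neg_of_abs_eq h1 with h | h
        · exact Or.inl (by rw [h])
        · exact Or.inr (by rw [h]; rfl)
      · rintro (rfl | rfl)
        · exact ⟨cuspConfig_isClassical he (by simp), by rw [cuspConfig_ncard he (by simp)]; simp⟩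
        · exact ⟨cuspConfig_isClassical he (by simp), by rw [cuspConfig_ncard he (by simp)]; simp⟩
    rw [this, Set.ncard_pair]
    intro h
    have := cuspConfig_injective e h
    norm_num at this

end

theorem configs_of_mem_frontier {l : ℂ} (hl : l ∈ frontier classicalTSchottkySpace) :
    (∃ X : Config, IsClassicalConfig S (T l) X) ∧
    (l ≠ 2 → l ≠ -2 →
      ∀ X : Config, IsClassicalConfig S (T l) X → (tangencyPoints X).ncard = 6) ∧
    ((l = 2 ∨ l = -2) →
      (∀ X : Config, IsClassicalConfig S (T l) X →
        (tangencyPoints X).ncard = 4 ∨ (tangencyPoints X).ncard = 6) ∧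
      {X : Config | IsClassicalConfig S (T l) X ∧ (tangencyPoints X).ncard = 4}.Infinite ∧
      {X : Config | IsClassicalConfig S (T l) X ∧ (tangencyPoints X).ncard = 6}.ncard = 2) := by
  rw [frontier_classicalTSchottkySpace] at hl
  obtain ⟨h1, h2, h3⟩ := hl
  refine ⟨?_, ?_, ?_⟩
  · have : l ∈ classicalTSchottkySpace := by
      rw [classicalTSchottkySpace_eq]; exact h3.ge
    exact this.2
  · intro hne hne' X hX
    obtain ⟨c, n, hc, hn, rfl, h4, -⟩ := hX.eq_stripConfig h3
    have hc0 : c ≠ 0 := by rintro rfl; simp at hc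
    have hlt : |l.re| < 2 := by
      refine lt_of_le_of_ne (abs_le.2 ⟨h1, h2⟩) fun h => ?_
      have him : l.im = 0 := by
        rw [← abs_eq_zero, h3, ← sq_abs, h]; norm_num
      rcases eq_or_eq_neg_of_abs_eq h with h | h
      · exact hne (Complex.ext h him)
      · exact hne' (Complex.ext (by simpa using h) (by simpa using him))
    rw [ncard_tangencyPoints_of_eq hc0 hn, if_pos (h4 hlt)]
  · rintro (rfl | rfl)
    · have := cusp_configs (e := 1) (Or.inl rfl)
      rwa [Complex.ofReal_one, mul_one] at this
    · have := cusp_configs (e := -1) (Or.inr rfl)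
      rwa [Complex.ofReal_neg, Complex.ofReal_one, mul_neg, mul_one] at this

end TwoParabolic

open TwoParabolic in
theorem mainTheorem7 :
    -- the regions
    (classicalTSchottkySpace = {l : ℂ | 1 - l.re ^ 2 / 4 ≤ |l.im|} ∧
      frontier classicalTSchottkySpace = schottkyParabolas) ∧
    -- interior of classical T-Schottky space
    (∀ l ∈ interior classicalTSchottkySpace,
      ∃ (X : Config) (c : ℂ), IsClassicalConfig S (T l) X ∧ c.re = 1 ∧
        (X 0).curve = circleCurve (-c) ‖c‖ ∧ (X 1).curve = circleCurve c ‖c‖ ∧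
        (X 0).curve ∪ (X 1).curve ⊆ (X 2).outside ∩ (X 3).outside ∧
        (X 0).curve ∩ (X 1).curve = {((0 : ℂ) : Sphere)} ∧
        (X 2).curve ∩ (X 3).curve = {OnePoint.infty} ∧
        (tangencyPoints X).ncard = 2) ∧
    -- boundary of classical T-Schottky space
    (∀ l ∈ frontier classicalTSchottkySpace,
      (∃ X : Config, IsClassicalConfig S (T l) X) ∧
      (l ≠ 2 → l ≠ -2 →
        ∀ X : Config, IsClassicalConfig S (T l) X → (tangencyPoints X).ncard = 6) ∧
      ((l = 2 ∨ l = -2) →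
        (∀ X : Config, IsClassicalConfig S (T l) X →
          (tangencyPoints X).ncard = 4 ∨ (tangencyPoints X).ncard = 6) ∧
        {X : Config | IsClassicalConfig S (T l) X ∧ (tangencyPoints X).ncard = 4}.Infinite ∧
        {X : Config | IsClassicalConfig S (T l) X ∧ (tangencyPoints X).ncard = 6}.ncard = 2)) ∧
    -- lower boundary of the non-classical family: the segments
    (∀ l ∈ symmetrized kSegment, ∀ e : ℝ, (e = 1 ∨ e = -1) → 0 ≤ e * l.re →
      ∃ c p : ℂ, c.re = 1 ∧
        circleCurve (e * c) ‖c‖ ∩ mob (T l) (circleCurve (-(e * c)) ‖c‖) = {(p : Sphere)} ∧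
        tangentLine (e * c) p = tangentLine (-(e * c) + 2 * l) p ∧
        ThreeArcConfiguration l c e (tangentLine (e * c) p)) ∧
    -- lower boundary of the non-classical family: the arcs
    (∀ l ∈ symmetrized unitArc, ∀ e : ℝ, (e = 1 ∨ e = -1) → 0 ≤ e * l.re →
      (l ∉ symmetrized kSegment →
        Disjoint (circleCurve (e : ℂ) 1) (mob (T l) (circleCurve (-(e : ℂ)) 1))) ∧
      ThreeArcConfiguration l 1 e (bisector (-(e : ℂ) + 2 * l) e)) ∧
    -- interior of the non-classical family
    (∀ l ∈ interior ncf, ∀ e : ℝ, (e = 1 ∨ e = -1) → 0 ≤ e * l.re →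
      ∃ c n : ℂ, c.re = 1 ∧ ‖n‖ = 1 ∧ (n * (starRingEnd ℂ) c).re = 0 ∧
        FiveArcConfiguration l c e n ∧
        (2 < |l.re| + √3 * |l.im| → ((-(e * c) + 2 * l) * (starRingEnd ℂ) c).re = 0)) ∧
    -- the parameters obtained from circles `C₁`, `C₂` and a point `q₀ = h n` of `P`
    (∀ (c n l : ℂ) (e h : ℝ), c.re = 1 → ‖n‖ = 1 → (n * (starRingEnd ℂ) c).re = 0 →
      (e = 1 ∨ e = -1) → (√3 - 1) * ‖c‖ < h → h < ‖c‖ →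
      2 * l = ((h + ‖c‖ : ℝ) : ℂ) * n - -(e * c) →
      FiveArcConfiguration l c e n ∧ (l ∈ interior ncf ↔ |l.im| < 1 - l.re ^ 2 / 4)) := by
  exact ⟨⟨classicalTSchottkySpace_eq, frontier_classicalTSchottkySpace⟩,
    fun _ hl => exists_config_of_mem_interior hl, fun _ hl => configs_of_mem_frontier hl,
    fun _ hl _ he hel => exists_threeArc_of_mem_kSegment hl he hel,
    fun _ hl _ he hel => threeArc_of_mem_unitArc hl he hel,
    fun _ hl _ he hel => exists_fiveArc_of_mem_interior hl he hel,
    fun _ _ _ _ _ hc hn hnc he h₁ h₂ hl => fiveArc_of_apex hc hn hnc he h₁ h₂ hl⟩
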